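/- Conventions. For $M\in M_n(\mathbb C)\otimes M_n(\mathbb C)$ write $M^i{}_j{}^k{}_l$ for its components, $M_{ab}$ for $M$ placed in the tensor legs $a,b$, and let $P$ be the permutation matrix. Let $R,R'\in M_n\otimes M_n$ be invertible, with $R_{12}R_{13}R_{23}=R_{23}R_{13}R_{12}$ and (i) $R_{12}R_{13}R'_{23}=R'_{23}R_{13}R_{12}$, $\;R_{23}R_{13}R'_{12}=R'_{12}R_{13}R_{23}$; (ii) $(PR+1)(PR'-1)=0$; (iii) $R_{21}R'_{12}=R'_{21}R_{12}$. The algebra of braided covectors $V^*(R')$ is generated by $x_1,\dots,x_n$ with relations $\mathbf x_1\mathbf x_2=\mathbf x_2\mathbf x_1R'_{12}$, i.e. $x_jx_l=\sum_{a,c}x_cx_a\,R'^a{}_j{}^c{}_l$. Let $A$ be a Hopf algebra over $\mathbb C$ generated as an algebra by a matrix $\mathbf t=(t^i{}_j)$ with $\Delta t^i{}_j=\sum_a t^i{}_a\otimes t^a{}_j$, $\epsilon(t^i{}_j)=\delta^i_j$, with a dual quasitriangular structure $\mathcal R:A\otimes A\to\mathbb C$ (convolution-invertible, $\mathcal R(ab\otimes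 c)=\mathcal R(a\otimes c_{(1)})\mathcal R(b\otimes c_{(2)})$, $\mathcal R(a\otimes bc)=\mathcal R(a_{(1)}\otimes c)\mathcal R(a_{(2)}\otimes b)$, $b_{(1)}a_{(1)}\mathcal R(a_{(2)}\otimes b_{(2)})=\mathcal R(a_{(1)}\otimes b_{(1)})a_{(2)}b_{(2)}$) such that $\mathcal R(\mathbf t_1\otimes\mathbf t_2)=\lambda R_{12}$ for a constant $\lambda\neq0$, and suppose that $R'_{12}\mathbf t_1\mathbf t_2=\mathbf t_2\mathbf t_1R'_{12}$ in $A$. Let $\tilde A=A\otimes\mathbb C\mathbb Z$ be the extension of $A$ by a central invertible group-like $g$, with $\mathcal R((a\otimes g^m)\otimes(b\otimes g^l))=\lambda^{-ml}\mathcal R(a\otimes b)$. **Theorem 6.** (a) $\tilde A$ is dual quasitriangular, and $V^*(R')$ is a Hopf algebra in the braided category of right $\tilde A$-comodules, with coaction $\beta(x_j)=\sum_a x_a\otimes t^a{}_jg$, braiding $\Psi(\mathbf x_1\otimes\mathbf x_2)=\mathbf x_2\otimes\mathbf x_1R_{12}$, braided coproduct $\underline\Delta x_j=x_j\otimes1+1\otimes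 x_j$, counit $\underline\epsilon(x_j)=0$ and braided antipode $\underline Sx_j=-x_j$. Its bosonization is an ordinary Hopf algebra, the semidirect product and coproduct $V^*(R')\rtimes\tilde A$. That is: there is a Hopf algebra structure on the vector space $V^*(R')\otimes\tilde A$, with $b\otimes h=(1\otimes h)(b\otimes 1)$, that contains $V^*(R')$ as a subalgebra and $\tilde A$ as a sub-Hopf algebra; for $b\in V^*(R')$ and $h\in\tilde A$, with $\beta(b)=b^{(1)}\otimes b^{(2)}$, it has $b\,h=h_{(1)}(b\triangleleft h_{(2)})$ where $b\triangleleft h=b^{(1)}\mathcal R(b^{(2)}\otimes h)$, $\Delta b=b_{\underline{(1)}}{}^{(1)}\otimes b_{\underline{(1)}}{}^{(2)}\,b_{\underline{(2)}}$, $\epsilon(b)=\underline\epsilon(b)$, and $S(b)=\underline S(b^{(1)})\,S(b^{(2)})$. Explicitly, writing $p_j$ for the generators $x_j$, it is presented as an algebra by its subalgebras $V^*(R')$ and $\tilde A$ with the cross relations $$\mathbf p\,g=\lambda^{-1}g\,\mathbf p,\qquad \mathbf p_1\mathbf t_2=\lambda\,\mathbf t_2\mathbf p_1R_{12},$$ and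 its coproduct is $$\Delta\mathbf p=\mathbf p\otimes\mathbf t g+1\otimes\mathbf p,\qquad \Delta\mathbf t=\mathbf t\otimes\mathbf t,\qquad \Delta g=g\otimes g.$$ (b) (Braided Minkowski space.) Let $q\in\mathbb C^\times$ and let $r$ be the $R$-matrix of $SL_q(2)$, $r^1{}_1{}^1{}_1=r^2{}_2{}^2{}_2=q$, $r^1{}_1{}^2{}_2=r^2{}_2{}^1{}_1=1$, $r^1{}_2{}^2{}_1=q-q^{-1}$, other components $0$. Let $SL_q(2)\bowtie SL_q(2)$ be generated by two copies $\mathbf t,\mathbf s$ of the generators of $SL_q(2)$ (relations $r\mathbf t_1\mathbf t_2=\mathbf t_2\mathbf t_1r$ and $t^1{}_1t^2{}_2-q^{-1}t^1{}_2t^2{}_1=1$; likewise for $\mathbf s$) with cross relations $r\,\mathbf s_1\mathbf t_2=\mathbf t_2\mathbf s_1r$, and let $SO_q(1,3)$ be its subalgebra generated by $\Lambda^{(i_0,i_1)}{}_{(j_0,j_1)}=t^{i_0}{}_{j_0}s^{i_1}{}_{j_1}$. Let $R=r_{41}^{-1}r_{13}r_{24}r_{23}$, the legs $(1,2)$ and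 $(3,4)$ forming the two vector indices, and let $R'=P+\mu P(PR-q^{-2})(PR-q^2)$ with $\mu\ne0$ such that $R'$ is invertible. Then $R,R'$ satisfy all the conditions above; $SO_q(1,3)$ is a Hopf algebra with $\Delta\Lambda=\Lambda\otimes\Lambda$, $\epsilon(\Lambda)=1$, and has a dual quasitriangular structure with $\mathcal R(\Lambda_1\otimes\Lambda_2)=q^{-1}R_{12}$; and all the conclusions of (a) hold for $V^*(R')=\underline{\mathbb R}^{1,3}$, $A=SO_q(1,3)$, $\lambda=q^{-1}$. The resulting Hopf algebra is the $q$-Poincaré group $P_q=\underline{\mathbb R}^{1,3}\rtimes\widetilde{SO_q(1,3)}$. -/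

import Mathlib

universe u

open scoped TensorProduct LaurentPolynomial
open Coalgebra (comul counit)
open HopfAlgebra (antipode)

namespace BraidedMomentum

noncomputable section

/-! ### Matrices with two tensor legs

An element `M` of `M_n ⊗ M_n` is a matrix indexed by pairs; the entry `M (i, k) (j, l)` is the
component usually written `M^i_j^k_l`. -/

section Matrices

variable {k : Type*} [Field k] {ι : Type*} [Fintype ι] [DecidableEq ι]

/-- For distinct positions `a`, `b` in a set `σ` of tensor legs: the matrix `M_{ab}` acting as `M`
in the legs `a`, `b` (in this order) and as the identity in the other legs. -/
def leg {σ : Type*} [Fintype σ] [DecidableEq σ] (a b : σ) (M : Matrix (ι × ι) (ι × ι) k) :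
    Matrix (σ → ι) (σ → ι) k :=
  fun f g => if ∀ c, c ≠ a → c ≠ b → f c = g c then M (f a, f b) (g a, g b) else 0

/-- The permutation matrix `P`, with `P^i_j^k_l = δ^i_l δ^k_j`. -/
def perm (k ι : Type*) [Field k] [DecidableEq ι] : Matrix (ι × ι) (ι × ι) k :=
  fun x y => if x.1 = y.2 ∧ x.2 = y.1 then 1 else 0

/-- `M_{21}`, with components `(M_{21})^i_j^k_l = M^k_l^i_j`. -/
def flipLegs (M : Matrix (ι × ι) (ι × ι) k) : Matrix (ι × ι) (ι × ι) k :=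
  M.submatrix Prod.swap Prod.swap

/-- The quantum Yang--Baxter equation `R₁₂ R₁₃ R₂₃ = R₂₃ R₁₃ R₁₂`. -/
def IsQYBE (R : Matrix (ι × ι) (ι × ι) k) : Prop :=
  leg (0 : Fin 3) 1 R * leg 0 2 R * leg 1 2 R = leg 1 2 R * leg 0 2 R * leg 0 1 R

/-- The conditions on a pair of matrices `R`, `R'` under which the braided covectors form a braided
Hopf algebra with linear coproduct. -/
structure IsCovectorPair (R R' : Matrix (ι × ι) (ι × ι) k) : Prop where
  isUnit_R : IsUnit R
  isUnit_R' : IsUnit R'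
  qybe : IsQYBE R
  mixed_left : leg (0 : Fin 3) 1 R * leg 0 2 R * leg 1 2 R' =
    leg 1 2 R' * leg 0 2 R * leg 0 1 R
  mixed_right : leg (1 : Fin 3) 2 R * leg 0 2 R * leg 0 1 R' =
    leg 0 1 R' * leg 0 2 R * leg 1 2 R
  linear : (perm k ι * R + 1) * (perm k ι * R' - 1) = 0
  flip : flipLegs R * R' = flipLegs R' * R

/-- The exchange relation `M u₁ v₂ = v₂ u₁ M` between two matrices of elements of an algebra,
that is, `M^i_a^k_b u^a_j v^b_l = v^k_b u^i_a M^a_j^b_l` (summed over `a`, `b`). -/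
def Exchange {A : Type*} [Ring A] [Algebra k A] (M : Matrix (ι × ι) (ι × ι) k)
    (u v : Matrix ι ι A) : Prop :=
  ∀ i k' j l, ∑ a, ∑ b, M (i, k') (a, b) • (u a j * v b l) =
    ∑ a, ∑ b, M (a, b) (j, l) • (v k' b * u i a)

/-- The defining relations `x₁ x₂ = x₂ x₁ R'₁₂` of the braided covectors, that is,
`x_j x_l = x_c x_a R'^a_j^c_l` (summed over `a`, `c`). -/
inductive CovectorRel (R' : Matrix (ι × ι) (ι × ι) k) :
    FreeAlgebra k ι → FreeAlgebra k ι → Prop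
  | rel (j l : ι) : CovectorRel R' (FreeAlgebra.ι k j * FreeAlgebra.ι k l)
      (∑ a, ∑ c, R' (a, c) (j, l) • (FreeAlgebra.ι k c * FreeAlgebra.ι k a))

/-- The algebra `V*(R')` of braided covectors. -/
abbrev Covector (R' : Matrix (ι × ι) (ι × ι) k) : Type _ := RingQuot (CovectorRel R')

/-- The generators `x_i` of `V*(R')`. -/
def Covector.gen (R' : Matrix (ι × ι) (ι × ι) k) (i : ι) : Covector R' :=
  RingQuot.mkAlgHom k (CovectorRel R') (FreeAlgebra.ι k i)

end Matrices

/-! ### Dual quasitriangular Hopf algebras -/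

section DualQuasitriangular

variable {k : Type*} [Field k] {H : Type*} [Ring H] [HopfAlgebra k H]

/-- `r` is a dual quasitriangular structure on the Hopf algebra `H`: a convolution-invertible form
`r : H ⊗ H → k` with `r(ab ⊗ c) = r(a ⊗ c₁) r(b ⊗ c₂)`, `r(a ⊗ bc) = r(a₁ ⊗ c) r(a₂ ⊗ b)` and
`b₁ a₁ r(a₂ ⊗ b₂) = r(a₁ ⊗ b₁) a₂ b₂`. -/
structure IsDualQuasitriangular (r : LinearMap.BilinForm k H) : Prop where
  one_left : ∀ a, r 1 a = counit (R := k) a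
  one_right : ∀ a, r a 1 = counit (R := k) a
  mul_left : ∀ a b c, r (a * b) c =
    LinearMap.mul' k k (TensorProduct.map (r a) (r b) (comul (R := k) c))
  mul_right : ∀ a b c, r a (b * c) =
    LinearMap.mul' k k (TensorProduct.map (r.flip c) (r.flip b) (comul (R := k) a))
  quasicomm : ∀ a b : H,
    TensorProduct.rid k H (TensorProduct.map
        (LinearMap.mul' k H ∘ₗ (TensorProduct.comm k H H).toLinearMap) (TensorProduct.lift r)
        (comul (R := k) (a ⊗ₜ[k] b))) =
      TensorProduct.lid k H (TensorProduct.map (TensorProduct.lift r) (LinearMap.mul' k H)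
        (comul (R := k) (a ⊗ₜ[k] b)))
  invertible : ∃ s : LinearMap.BilinForm k H, ∀ a b : H,
    LinearMap.mul' k k (TensorProduct.map (TensorProduct.lift r) (TensorProduct.lift s)
        (comul (R := k) (a ⊗ₜ[k] b))) = counit (R := k) a * counit (R := k) b ∧
    LinearMap.mul' k k (TensorProduct.map (TensorProduct.lift s) (TensorProduct.lift r)
        (comul (R := k) (a ⊗ₜ[k] b))) = counit (R := k) a * counit (R := k) b

end DualQuasitriangular

/-! ### Braided Hopf algebras in the category of right comodules, and their bosonization -/

section Braided

variable {k : Type*} [Field k] {H : Type*} [Ring H] [HopfAlgebra k H]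
  (r : LinearMap.BilinForm k H) {B : Type*} [Ring B] [Algebra k B] (β : B →ₗ[k] B ⊗[k] H)

/-- The braiding of a right comodule with itself, `Ψ(v ⊗ w) = w¹ ⊗ v¹ r(v² ⊗ w²)`, where
`β v = v¹ ⊗ v²` is the coaction. -/
def braiding : B ⊗[k] B →ₗ[k] B ⊗[k] B :=
  (TensorProduct.comm k B B).toLinearMap ∘ₗ
    (TensorProduct.rid k (B ⊗[k] B)).toLinearMap ∘ₗ
      (TensorProduct.lift r).lTensor (B ⊗[k] B) ∘ₗ
        (TensorProduct.tensorTensorTensorComm k B H B H).toLinearMap ∘ₗ TensorProduct.map β β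

/-- The product `(a ⊗ b)(c ⊗ d) = a Ψ(b ⊗ c) d` of the braided tensor product algebra. -/
def braidedMul : (B ⊗[k] B) ⊗[k] (B ⊗[k] B) →ₗ[k] B ⊗[k] B :=
  TensorProduct.map (LinearMap.mul' k B) (LinearMap.mul' k B) ∘ₗ
    (TensorProduct.tensorTensorTensorAssoc k B B B B).symm.toLinearMap ∘ₗ
      ((braiding r β).lTensor B).rTensor B ∘ₗ
        (TensorProduct.tensorTensorTensorAssoc k B B B B).toLinearMap

/-- The tensor product coaction `b ⊗ c ↦ b¹ ⊗ c¹ ⊗ b² c²`. -/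
def tensorCoact : B ⊗[k] B →ₗ[k] (B ⊗[k] B) ⊗[k] H :=
  (LinearMap.mul' k H).lTensor (B ⊗[k] B) ∘ₗ
    (TensorProduct.tensorTensorTensorComm k B H B H).toLinearMap ∘ₗ TensorProduct.map β β

/-- The right action `b ◁ h = b¹ r(b² ⊗ h)` into which the form `r` turns the coaction. -/
def rightAction : B ⊗[k] H →ₗ[k] B :=
  (TensorProduct.rid k B).toLinearMap ∘ₗ (TensorProduct.lift r).lTensor B ∘ₗ
    (TensorProduct.assoc k B H H).toLinearMap ∘ₗ β.rTensor H

/-- A structure on the algebra `B` of a Hopf algebra in the braided category of right comodules of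
the dual quasitriangular Hopf algebra `(H, r)`. -/
structure BraidedHopfAlgebra (B : Type*) [Ring B] [Algebra k B] where
  /-- The coaction; it is an algebra map. -/
  coact : B →ₐ[k] B ⊗[k] H
  coact_coassoc : ∀ b, TensorProduct.assoc k B H H (coact.toLinearMap.rTensor H (coact b)) =
    (comul (R := k) (A := H)).lTensor B (coact b)
  coact_counit : ∀ b, TensorProduct.rid k B ((counit (R := k) (A := H)).lTensor B (coact b)) = b
  /-- The braided coproduct. -/
  cop : B →ₗ[k] B ⊗[k] B
  /-- The braided counit; it is an algebra map. -/
  cou : B →ₐ[k] k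
  /-- The braided antipode. -/
  anti : B →ₗ[k] B
  cop_coassoc : ∀ b, TensorProduct.assoc k B B B (cop.rTensor B (cop b)) = cop.lTensor B (cop b)
  cou_cop : ∀ b, TensorProduct.lid k B (cou.toLinearMap.rTensor B (cop b)) = b
  cop_cou : ∀ b, TensorProduct.rid k B (cou.toLinearMap.lTensor B (cop b)) = b
  cop_one : cop 1 = 1 ⊗ₜ[k] 1
  cop_mul : ∀ b c, cop (b * c) = braidedMul r coact.toLinearMap (cop b ⊗ₜ[k] cop c)
  anti_mul : ∀ b, LinearMap.mul' k B (anti.rTensor B (cop b)) = algebraMap k B (cou b)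
  mul_anti : ∀ b, LinearMap.mul' k B (anti.lTensor B (cop b)) = algebraMap k B (cou b)
  cop_covariant : ∀ b, tensorCoact coact.toLinearMap (cop b) = cop.rTensor H (coact b)
  cou_covariant : ∀ b, TensorProduct.lid k H (cou.toLinearMap.rTensor H (coact b)) =
    algebraMap k H (cou b)
  anti_covariant : ∀ b, coact (anti b) = anti.rTensor H (coact b)

variable {r}

/-- The linear map `B ⊗ H → P`, `b ⊗ h ↦ h b`, attached to two maps `i : B → P`, `j : H → P`. -/
def orderedProduct {P : Type*} [Ring P] [Algebra k P] (i : B →ₗ[k] P) (j : H →ₗ[k] P) :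
    B ⊗[k] H →ₗ[k] P :=
  LinearMap.mul' k P ∘ₗ TensorProduct.map j i ∘ₗ (TensorProduct.comm k B H).toLinearMap

/-- The Hopf algebra `P`, with the maps `i : B → P` and `j : H → P`, is the bosonization `B ⋊ H` of
the braided Hopf algebra `B`: it is built on the vector space `B ⊗ H` (with `b ⊗ h` standing for
`(1 ⊗ h)(b ⊗ 1)`) as the semidirect product by the action `◁`, with cross relations
`b h = h₁ (b ◁ h₂)`, and as the semidirect coproduct by the coaction, with
`Δ b = (b₍₁₎)¹ ⊗ (b₍₁₎)² b₍₂₎` where `b₍₁₎ ⊗ b₍₂₎` is the braided coproduct; its antipode is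
`S b = (S̲ b¹) (S b²)` where `S̲` is the braided antipode. -/
structure IsBosonization (D : BraidedHopfAlgebra r B) {P : Type*} [Ring P] [HopfAlgebra k P]
    (i : B →ₐ[k] P) (j : H →ₐc[k] P) : Prop where
  bijective : Function.Bijective (orderedProduct i.toLinearMap (j : H →ₗ[k] P))
  cross : ∀ b h, i b * j h = LinearMap.mul' k P (TensorProduct.map (j : H →ₗ[k] P)
    (i.toLinearMap ∘ₗ TensorProduct.curry (rightAction r D.coact.toLinearMap) b)
    (comul (R := k) h))
  comul_eq : ∀ b, comul (R := k) (i b) = (LinearMap.mul' k P).lTensor P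
    (TensorProduct.assoc k P P P (TensorProduct.map
      (TensorProduct.map i.toLinearMap (j : H →ₗ[k] P) ∘ₗ D.coact.toLinearMap) i.toLinearMap
      (D.cop b)))
  counit_eq : ∀ b, counit (R := k) (i b) = D.cou b
  antipode_eq : ∀ b, antipode k (i b) = LinearMap.mul' k P (TensorProduct.map
    (i.toLinearMap ∘ₗ D.anti) ((j : H →ₗ[k] P) ∘ₗ antipode k) (D.coact b))

end Braided

/-! ### The extension of a quantum group by a central group-like element -/

section Extension

variable {k : Type*} [Field k] {A : Type*} [Ring A] [HopfAlgebra k A]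

/-- The Hopf algebra `Ã`, the tensor product of `A` with the group algebra of `ℤ`, the latter
being written as `k[T;T⁻¹]`. -/
abbrev Ext (k A : Type*) [Field k] [Ring A] [HopfAlgebra k A] : Type _ := A ⊗[k] k[T;T⁻¹]

/-- The adjoined central group-like element `g` of `Ã`. -/
def gExt (k A : Type*) [Field k] [Ring A] [HopfAlgebra k A] : Ext k A :=
  1 ⊗ₜ[k] LaurentPolynomial.T 1

/-- The form on the group algebra of `ℤ` with `(gᵃ, gᵇ) ↦ lam ^ (-ab)`. -/
def laurentForm (lam : k) : LinearMap.BilinForm k k[T;T⁻¹] :=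
  (AddMonoidAlgebra.basis ℤ k).constr k fun a =>
    (AddMonoidAlgebra.basis ℤ k).constr k fun b => lam ^ (-(a * b))

/-- The tensor product form on `Ã`. -/
def extForm (r : LinearMap.BilinForm k A) (lam : k) : LinearMap.BilinForm k (Ext k A) :=
  TensorProduct.curry (TensorProduct.lid k k ∘ₗ
    TensorProduct.map (TensorProduct.lift r) (TensorProduct.lift (laurentForm lam)) ∘ₗ
      (TensorProduct.tensorTensorTensorComm k A k[T;T⁻¹] A k[T;T⁻¹]).toLinearMap)

end Extension

/-! ### Matrix quantum groups and the bosonization of braided covectors -/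

section MatrixQuantumGroup

variable {ι : Type} [Fintype ι] [DecidableEq ι] {A : Type*} [Ring A] [HopfAlgebra ℂ A]

/-- `A`, with matrix of generators `t`, is an `R`-matrix quantum group: a dual quasitriangular Hopf
algebra generated by a matrix coalgebra `t`, with `r(t₁ ⊗ t₂) = lam R`. (The relations
`R t₁ t₂ = t₂ t₁ R` follow.) -/
structure IsMatrixQuantumGroup (R : Matrix (ι × ι) (ι × ι) ℂ) (lam : ℂ) (t : Matrix ι ι A)
    (r : LinearMap.BilinForm ℂ A) : Prop where
  comul_t : ∀ i j, comul (R := ℂ) (t i j) = ∑ a, t i a ⊗ₜ[ℂ] t a j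
  counit_t : ∀ i j, counit (R := ℂ) (t i j) = (1 : Matrix ι ι ℂ) i j
  adjoin_t : Algebra.adjoin ℂ (Set.range fun p : ι × ι => t p.1 p.2) = ⊤
  dualQuasitriangular : IsDualQuasitriangular r
  form_t : ∀ i j k l, r (t i j) (t k l) = lam * R (i, k) (j, l)

/-- The braided Hopf algebra structure `D` on `V*(R')` over `Ã` is the one of the braided
covectors: coaction `x ↦ x t g`, braiding `Ψ(x₁ ⊗ x₂) = x₂ ⊗ x₁ R₁₂`, and linear coproduct. -/
structure IsCovectorStructure (R R' : Matrix (ι × ι) (ι × ι) ℂ) (lam : ℂ) (t : Matrix ι ι A)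
    (r : LinearMap.BilinForm ℂ A) (D : BraidedHopfAlgebra (extForm r lam) (Covector R')) :
    Prop where
  coact_gen : ∀ j, D.coact (Covector.gen R' j) =
    ∑ a, Covector.gen R' a ⊗ₜ[ℂ] ((t a j ⊗ₜ[ℂ] 1) * gExt ℂ A : Ext ℂ A)
  braiding_gen : ∀ j l, braiding (extForm r lam) D.coact.toLinearMap
      (Covector.gen R' j ⊗ₜ[ℂ] Covector.gen R' l) =
    ∑ a, ∑ b, R (a, b) (j, l) • (Covector.gen R' b ⊗ₜ[ℂ] Covector.gen R' a)
  cop_gen : ∀ j, D.cop (Covector.gen R' j) =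
    Covector.gen R' j ⊗ₜ[ℂ] 1 + 1 ⊗ₜ[ℂ] Covector.gen R' j
  cou_gen : ∀ j, D.cou (Covector.gen R' j) = 0
  anti_gen : ∀ j, D.anti (Covector.gen R' j) = -Covector.gen R' j

/-- The cross relations `p g = lam⁻¹ g p` and `p₁ t₂ = lam t₂ p₁ R₁₂` in an algebra `C` that
receives maps from `V*(R')` (with generators `p_i`) and from `Ã`. -/
structure CrossRelations (R R' : Matrix (ι × ι) (ι × ι) ℂ) (lam : ℂ) (t : Matrix ι ι A)
    {C : Type*} [Ring C] [Algebra ℂ C] (i : Covector R' →ₐ[ℂ] C) (j : Ext ℂ A →ₐ[ℂ] C) :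
    Prop where
  p_g : ∀ a, i (Covector.gen R' a) * j (gExt ℂ A) =
    lam⁻¹ • (j (gExt ℂ A) * i (Covector.gen R' a))
  p_t : ∀ a c d, i (Covector.gen R' a) * j (t c d ⊗ₜ[ℂ] 1) =
    lam • ∑ b, ∑ m, R (b, m) (a, d) • (j (t c m ⊗ₜ[ℂ] 1) * i (Covector.gen R' b))

/-- The Hopf algebra `P`, with the maps `i : V*(R') → P` and `j : Ã → P`, has the explicit form of
the semidirect product and coproduct of `V*(R')` and `Ã`: these are subalgebras, `P` is presented
by them and the cross relations, and the coproduct is given on generators as stated. -/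
structure IsExplicitSemidirect {A : Type u} [Ring A] [HopfAlgebra ℂ A]
    (R R' : Matrix (ι × ι) (ι × ι) ℂ) (lam : ℂ) (t : Matrix ι ι A)
    {P : Type u} [Ring P] [HopfAlgebra ℂ P] (i : Covector R' →ₐ[ℂ] P) (j : Ext ℂ A →ₐc[ℂ] P) :
    Prop where
  injective_i : Function.Injective i
  injective_j : Function.Injective j
  cross : CrossRelations R R' lam t i (j : Ext ℂ A →ₐ[ℂ] P)
  presented : ∀ (C : Type u) [Ring C] [Algebra ℂ C] (i' : Covector R' →ₐ[ℂ] C)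
    (j' : Ext ℂ A →ₐ[ℂ] C), CrossRelations R R' lam t i' j' →
      ∃! F : P →ₐ[ℂ] C, F.comp i = i' ∧ F.comp (j : Ext ℂ A →ₐ[ℂ] P) = j'
  comul_p : ∀ a, comul (R := ℂ) (i (Covector.gen R' a)) =
    ∑ b, i (Covector.gen R' b) ⊗ₜ[ℂ] (j (t b a ⊗ₜ[ℂ] 1) * j (gExt ℂ A)) +
      1 ⊗ₜ[ℂ] i (Covector.gen R' a)
  comul_t : ∀ a b, comul (R := ℂ) (j (t a b ⊗ₜ[ℂ] 1)) =
    ∑ c, j (t a c ⊗ₜ[ℂ] 1) ⊗ₜ[ℂ] j (t c b ⊗ₜ[ℂ] 1)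
  comul_g : comul (R := ℂ) (j (gExt ℂ A)) = j (gExt ℂ A) ⊗ₜ[ℂ] j (gExt ℂ A)

/-- `Ã` is dual quasitriangular, `V*(R')` is a braided Hopf algebra in its category of right
comodules, with the structure of the braided covectors, and its bosonization is an ordinary Hopf
algebra, of the explicit form above. -/
def HasCovectorBosonization {A : Type u} [Ring A] [HopfAlgebra ℂ A]
    (R R' : Matrix (ι × ι) (ι × ι) ℂ) (lam : ℂ) (t : Matrix ι ι A)
    (r : LinearMap.BilinForm ℂ A) : Prop :=
  IsDualQuasitriangular (extForm r lam) ∧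
  ∃ D : BraidedHopfAlgebra (extForm r lam) (Covector R'),
    IsCovectorStructure R R' lam t r D ∧
    ∃ (P : Type u) (_ : Ring P) (_ : HopfAlgebra ℂ P)
      (i : Covector R' →ₐ[ℂ] P) (j : Ext ℂ A →ₐc[ℂ] P),
      IsBosonization D i j ∧ IsExplicitSemidirect R R' lam t i j

end MatrixQuantumGroup

/-! ### The `q`-Lorentz group and braided Minkowski space -/

section Lorentz

/-- The standard `R`-matrix of `SL_q(2)`, normalized so that `(P R - q)(P R + q⁻¹) = 0`:
`R^0_0^0_0 = R^1_1^1_1 = q`, `R^0_0^1_1 = R^1_1^0_0 = 1`, `R^0_1^1_0 = q - q⁻¹`, and all the other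
components vanish. -/
def slR (q : ℂ) : Matrix (Fin 2 × Fin 2) (Fin 2 × Fin 2) ℂ :=
  fun x y =>
    if x = y then (if x.1 = x.2 then q else 1)
    else if x = (0, 1) ∧ y = (1, 0) then q - q⁻¹ else 0

/-- The generators of the `q`-Lorentz spin group: the entries `t^i_j` of the spinor matrix and the
entries `s^i_j` of the conjugate spinor matrix. -/
inductive SpinGen
  | t (i j : Fin 2)
  | s (i j : Fin 2)

/-- The left side of the component `(i, k), (j, l)` of `R u₁ v₂ = v₂ u₁ R`. -/
def exchangeLeft (q : ℂ) (u v : Fin 2 → Fin 2 → SpinGen) (i k j l : Fin 2) :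
    FreeAlgebra ℂ SpinGen :=
  ∑ a, ∑ b, slR q (i, k) (a, b) • (FreeAlgebra.ι ℂ (u a j) * FreeAlgebra.ι ℂ (v b l))

/-- The right side of the component `(i, k), (j, l)` of `R u₁ v₂ = v₂ u₁ R`. -/
def exchangeRight (q : ℂ) (u v : Fin 2 → Fin 2 → SpinGen) (i k j l : Fin 2) :
    FreeAlgebra ℂ SpinGen :=
  ∑ a, ∑ b, slR q (a, b) (j, l) • (FreeAlgebra.ι ℂ (v k b) * FreeAlgebra.ι ℂ (u i a))

/-- The `q`-determinant `u^0_0 u^1_1 - q⁻¹ u^0_1 u^1_0`. -/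
def qdet (q : ℂ) (u : Fin 2 → Fin 2 → SpinGen) : FreeAlgebra ℂ SpinGen :=
  FreeAlgebra.ι ℂ (u 0 0) * FreeAlgebra.ι ℂ (u 1 1) -
    q⁻¹ • (FreeAlgebra.ι ℂ (u 0 1) * FreeAlgebra.ι ℂ (u 1 0))

/-- The relations of the `q`-Lorentz spin group: two copies of `SL_q(2)`, with generators `t` and
`s`, and the cross relations `R s₁ t₂ = t₂ s₁ R`. -/
inductive SpinRel (q : ℂ) : FreeAlgebra ℂ SpinGen → FreeAlgebra ℂ SpinGen → Prop
  | tt (i k j l) : SpinRel q (exchangeLeft q .t .t i k j l) (exchangeRight q .t .t i k j l)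
  | ss (i k j l) : SpinRel q (exchangeLeft q .s .s i k j l) (exchangeRight q .s .s i k j l)
  | st (i k j l) : SpinRel q (exchangeLeft q .s .t i k j l) (exchangeRight q .s .t i k j l)
  | det_t : SpinRel q (qdet q .t) 1
  | det_s : SpinRel q (qdet q .s) 1

/-- The algebra `SL_q(2) ⋈ SL_q(2)` of the `q`-Lorentz spin group. -/
abbrev SpinLorentz (q : ℂ) : Type := RingQuot (SpinRel q)

/-- The vector matrix `Λ^{(i₀,i₁)}_{(j₀,j₁)} = t^{i₀}_{j₀} s^{i₁}_{j₁}`. -/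
def lorentzMatrix (q : ℂ) : Matrix (Fin 2 × Fin 2) (Fin 2 × Fin 2) (SpinLorentz q) :=
  fun I J => RingQuot.mkAlgHom ℂ (SpinRel q)
    (FreeAlgebra.ι ℂ (SpinGen.t I.1 J.1) * FreeAlgebra.ι ℂ (SpinGen.s I.2 J.2))

/-- The algebra `SO_q(1,3)`: the subalgebra generated by the vector matrix. -/
def LorentzSO (q : ℂ) : Subalgebra ℂ (SpinLorentz q) :=
  Algebra.adjoin ℂ (Set.range fun p : (Fin 2 × Fin 2) × (Fin 2 × Fin 2) =>
    lorentzMatrix q p.1 p.2)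

/-- The four spinor indices of a pair of vector indices. -/
def spinorIndices (I : (Fin 2 × Fin 2) × (Fin 2 × Fin 2)) : Fin 4 → Fin 2 :=
  ![I.1.1, I.1.2, I.2.1, I.2.2]

/-- The `R`-matrix of the vector representation of `SO_q(1,3)`, composed of four copies of that of
`SL_q(2)` as `R₄₁⁻¹ R₁₃ R₂₄ R₂₃`, where `(1, 2)` and `(3, 4)` are the spinor and the conjugate
spinor index of the first and of the second vector index. It satisfies
`(P R + 1)(P R - q⁻²)(P R - q²) = 0`. -/
def lorentzR (q : ℂ) :
    Matrix ((Fin 2 × Fin 2) × (Fin 2 × Fin 2)) ((Fin 2 × Fin 2) × (Fin 2 × Fin 2)) ℂ :=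
  (leg (3 : Fin 4) 0 (slR q)⁻¹ * leg 0 2 (slR q) * leg 1 3 (slR q) * leg 1 2 (slR q)).submatrix
    spinorIndices spinorIndices

/-- The matrix `R' = P + μ P (P R - q⁻²)(P R - q²)` defining braided Minkowski space. -/
def minkowskiR' (q μ : ℂ) :
    Matrix ((Fin 2 × Fin 2) × (Fin 2 × Fin 2)) ((Fin 2 × Fin 2) × (Fin 2 × Fin 2)) ℂ :=
  perm ℂ (Fin 2 × Fin 2) + μ • (perm ℂ (Fin 2 × Fin 2) *
    ((perm ℂ (Fin 2 × Fin 2) * lorentzR q - (q ^ 2)⁻¹ • 1) *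
      (perm ℂ (Fin 2 × Fin 2) * lorentzR q - q ^ 2 • 1)))

end Lorentz

end

end BraidedMomentum

open BraidedMomentum

namespace BraidedMomentum

noncomputable section

section Comatrix

variable {k : Type*} [Field k] {C : Type*} [AddCommGroup C] [Module k C] [Coalgebra k C]

/-- A matrix of elements of a coalgebra with `Δ c = c ⊗ c` and `ε c = 1`. -/
structure IsComatrix (k : Type*) [Field k] {C : Type*} [AddCommGroup C] [Module k C]
    [Coalgebra k C] {κ : Type*} [Fintype κ] [DecidableEq κ] (c : Matrix κ κ C) : Prop where
  comul_eq : ∀ i j, comul (R := k) (c i j) = ∑ l, c i l ⊗ₜ[k] c l j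
  counit_eq : ∀ i j, counit (R := k) (c i j) = (1 : Matrix κ κ k) i j

variable {V : Type*} [AddCommGroup V] [Module k V]

theorem eq_of_sum_basis_tmul {M W : Type*} [AddCommGroup M] [Module k M] [AddCommGroup W]
    [Module k W] {κ : Type*} [Fintype κ] [DecidableEq κ] (b : Module.Basis κ k W) (f g : κ → M)
    (h : ∑ i, b i ⊗ₜ[k] f i = ∑ i, b i ⊗ₜ[k] g i) (i : κ) : f i = g i := by
  have := congrArg (fun z => TensorProduct.lid k M ((b.coord i).rTensor M z)) h
  simpa [map_sum, Finsupp.single_apply, ite_smul] using this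

/-- A finite family of elements of a comodule that spans a subcomodule, with its matrix of
coefficients. -/
structure IsSubcomodule (β : V →ₗ[k] V ⊗[k] C) {κ : Type*} [Fintype κ] [DecidableEq κ] (w : κ → V)
    (c : Matrix κ κ C) : Prop where
  comatrix : IsComatrix k c
  coact : ∀ p, β (w p) = ∑ q, w q ⊗ₜ[k] c q p

/-- Local finiteness of comodules. -/
theorem exists_isSubcomodule (β : V →ₗ[k] V ⊗[k] C)
    (hβ : ∀ v, TensorProduct.assoc k V C C (β.rTensor C (β v)) =
      (comul (R := k) (A := C)).lTensor V (β v))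
    (hε : ∀ v, TensorProduct.rid k V ((counit (R := k) (A := C)).lTensor V (β v)) = v) (v : V) :
    ∃ (n : ℕ) (w : Fin n → V) (c : Matrix (Fin n) (Fin n) C), IsSubcomodule β w c ∧
      v ∈ Submodule.span k (Set.range w) := by
  classical
  obtain ⟨I, e⟩ : Σ I : Type _, Module.Basis I k C := ⟨_, Module.Free.chooseBasis k C⟩
  let φ := TensorProduct.equivFinsuppOfBasisRight (M := V) e
  set f := φ (β v) with hf
  have hsum : β v = ∑ x ∈ f.support, f x ⊗ₜ[k] e x := by
    rw [← φ.symm_apply_apply (β v), TensorProduct.equivFinsuppOfBasisRight_symm_apply]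
    rfl
  let W : Submodule k V := Submodule.span k (f.support.image f : Finset V)
  have hfW : ∀ x, f x ∈ W := fun x => by
    by_cases hx : x ∈ f.support
    · exact Submodule.subset_span (by simpa using ⟨x, by simpa using hx, rfl⟩)
    · rw [Finsupp.notMem_support_iff.mp hx]; exact W.zero_mem
  have hvW : v ∈ W := by
    rw [← hε v, hsum]
    simp only [map_sum, LinearMap.lTensor_tmul, TensorProduct.rid_tmul]
    exact W.sum_mem fun x _ => W.smul_mem _ (hfW x)
  have : FiniteDimensional k W := FiniteDimensional.span_finset k _
  have hβW : ∀ w ∈ W, β w ∈ LinearMap.range (W.subtype.rTensor C) := by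
    intro w hw
    refine Submodule.span_induction (p := fun w _ => β w ∈ LinearMap.range (W.subtype.rTensor C))
      ?_ (by simp) (fun x y _ _ hx hy => by rw [map_add]; exact Submodule.add_mem _ hx hy)
      (fun a x _ hx => by rw [map_smul]; exact Submodule.smul_mem _ _ hx) hw
    intro y hy
    obtain ⟨l, -, rfl⟩ := by simpa using hy
    have key := congrArg (fun z => (TensorProduct.rid k C).toLinearMap.lTensor V
      (((e.coord l).lTensor C).lTensor V z)) (hβ v)
    simp only [hsum, map_sum, LinearMap.rTensor_tmul, LinearMap.lTensor_tmul] at key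
    have h1 : ∀ (z : V ⊗[k] C) (a : C), (TensorProduct.rid k C).toLinearMap.lTensor V
        (((e.coord l).lTensor C).lTensor V (TensorProduct.assoc k V C C (z ⊗ₜ a))) =
          e.coord l a • z := by
      intro z a
      induction z with
      | zero => simp
      | tmul x y => simp
      | add x y hx hy => simp only [TensorProduct.add_tmul, map_add, hx, hy, smul_add]
    simp only [h1] at key
    have h2 : ∑ x ∈ f.support, (e.coord l) (e x) • β (f x) = β (f l) := by
      simp only [Module.Basis.coord_apply, Module.Basis.repr_self, Finsupp.single_apply, ite_smul,
        one_smul, zero_smul, Finset.sum_ite_eq', Finsupp.mem_support_iff]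
      split_ifs with h
      · rfl
      · rw [not_not.mp h, map_zero]
    rw [← h2, key]
    exact Submodule.sum_mem _ fun x _ => ⟨⟨f x, hfW x⟩ ⊗ₜ _, by simp; rfl⟩
  let b := Module.finBasis k W
  have hc : ∀ p, ∃ g : Fin (Module.finrank k W) → C, β (b p : V) = ∑ q, (b q : V) ⊗ₜ[k] g q := by
    intro p
    obtain ⟨z, hz⟩ := hβW _ (b p).2
    obtain ⟨g, hg⟩ : ∃ g : Fin (Module.finrank k W) → C, z = ∑ q, b q ⊗ₜ[k] g q := by
      refine ⟨TensorProduct.equivFinsuppOfBasisLeft (N := C) b z, ?_⟩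
      have := TensorProduct.equivFinsuppOfBasisLeft_symm (N := C) b
      have h2 := congrArg (fun g => g (TensorProduct.equivFinsuppOfBasisLeft (N := C) b z)) this
      simp only [LinearEquiv.coe_coe, LinearEquiv.symm_apply_apply] at h2
      rw [Finsupp.lsum_apply, Finsupp.sum_fintype _ _ (by simp)] at h2
      simpa using h2
    exact ⟨g, by rw [← hz, hg]; simp⟩
  choose g hg using hc
  have hinj : Function.Injective (W.subtype.rTensor C) :=
    Module.Flat.rTensor_preserves_injective_linearMap _ W.injective_subtype
  have hinj2 : Function.Injective (W.subtype.rTensor (C ⊗[k] C)) :=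
    Module.Flat.rTensor_preserves_injective_linearMap _ W.injective_subtype
  refine ⟨_, fun p => (b p : V), fun q p => g p q, ⟨⟨?_, ?_⟩, hg⟩, ?_⟩
  · intro i j
    refine eq_of_sum_basis_tmul b (fun i => comul (R := k) (g j i))
      (fun i => ∑ l, g l i ⊗ₜ[k] g j l) (hinj2 ?_) i
    have := hβ (b j : V)
    simp only [hg, map_sum, LinearMap.rTensor_tmul, LinearMap.lTensor_tmul, TensorProduct.sum_tmul,
      TensorProduct.assoc_tmul] at this
    simp only [map_sum, LinearMap.rTensor_tmul, Submodule.subtype_apply, TensorProduct.tmul_sum]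
    rw [← this, Finset.sum_comm]
  · intro i j
    refine eq_of_sum_basis_tmul (M := k) b (fun i => counit (R := k) (g j i))
      (fun i => (1 : Matrix _ _ k) i j) ((TensorProduct.rid k W).injective ?_) i
    have := hε (b j : V)
    simp only [hg, map_sum, LinearMap.lTensor_tmul, TensorProduct.rid_tmul] at this
    simp only [map_sum, TensorProduct.rid_tmul]
    apply Subtype.ext
    simp [this, Matrix.one_apply, ite_smul]
  · have := b.mem_span ⟨v, hvW⟩
    have h2 := Submodule.mem_map_of_mem (f := W.subtype) this
    rw [Submodule.map_span, ← Set.range_comp] at h2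
    exact h2

/-- To prove a linear statement for all elements of a comodule it suffices to do so for the
members of finite families spanning a subcomodule. -/
theorem comodule_induction (β : V →ₗ[k] V ⊗[k] C)
    (hβ : ∀ v, TensorProduct.assoc k V C C (β.rTensor C (β v)) =
      (comul (R := k) (A := C)).lTensor V (β v))
    (hε : ∀ v, TensorProduct.rid k V ((counit (R := k) (A := C)).lTensor V (β v)) = v)
    {p : V → Prop} (add : ∀ x y, p x → p y → p (x + y)) (smul : ∀ (a : k) x, p x → p (a • x))
    (zero : p 0)
    (base : ∀ (n : ℕ) (w : Fin n → V) (c : Matrix (Fin n) (Fin n) C), IsSubcomodule β w c →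
      ∀ i, p (w i)) (v : V) : p v := by
  obtain ⟨n, w, c, h, hv⟩ := exists_isSubcomodule β hβ hε v
  refine Submodule.span_induction (p := fun x _ => p x) ?_ zero (fun x y _ _ => add x y)
    (fun a x _ => smul a x) hv
  rintro _ ⟨i, rfl⟩
  exact base n w c h i

/-- To prove a linear statement for all elements of a coalgebra it suffices to do so for the
entries of comatrices. -/
theorem comatrix_induction (k : Type*) [Field k] {C : Type*} [AddCommGroup C] [Module k C]
    [Coalgebra k C]
    {p : C → Prop} (add : ∀ x y, p x → p y → p (x + y)) (smul : ∀ (a : k) x, p x → p (a • x))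
    (zero : p 0)
    (base : ∀ (n : ℕ) (c : Matrix (Fin n) (Fin n) C), IsComatrix k c → ∀ i j, p (c i j))
    (v : C) : p v := by
  refine comodule_induction (k := k) (comul (R := k) (A := C)) Coalgebra.coassoc_apply
    (fun v => by simp) add smul zero (fun n w c h i => ?_) v
  have h1 : w i = ∑ q, counit (R := k) (w q) • c q i := by
    have := congrArg (fun z => TensorProduct.lid k C ((counit (R := k)).rTensor C z)) (h.coact i)
    simpa using this
  rw [h1]
  exact Finset.sum_induction _ p add zero fun q _ => smul _ _ (base n c h.comatrix q i)

theorem linearMap_ext_of_comatrix {M : Type*} [AddCommGroup M] [Module k M] {f g : C →ₗ[k] M}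
    (h : ∀ (n : ℕ) (c : Matrix (Fin n) (Fin n) C), IsComatrix k c → ∀ i j,
      f (c i j) = g (c i j)) : f = g :=
  LinearMap.ext fun v => comatrix_induction k (p := fun v => f v = g v)
    (fun x y hx hy => by simp only [map_add, hx, hy])
    (fun a x hx => by simp only [map_smul, hx]) (by simp) h v

end Comatrix

section Products

variable {k : Type*} [Field k] {H : Type*} [Ring H]

theorem IsComatrix.kronecker [Bialgebra k H] {κ κ' : Type*} [Fintype κ] [DecidableEq κ]
    [Fintype κ'] [DecidableEq κ'] {c : Matrix κ κ H} {d : Matrix κ' κ' H}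
    (hc : IsComatrix k c) (hd : IsComatrix k d) :
    IsComatrix k (fun x y : κ × κ' => c x.1 y.1 * d x.2 y.2) where
  comul_eq x y := by
    rw [Bialgebra.comul_mul, hc.comul_eq, hd.comul_eq, Finset.sum_mul_sum, Fintype.sum_prod_type]
    simp
  counit_eq x y := by
    rw [Bialgebra.counit_mul, hc.counit_eq, hd.counit_eq]
    simp only [Matrix.one_apply, Prod.ext_iff]
    split_ifs <;> simp_all

variable [HopfAlgebra k H] {κ : Type*} [Fintype κ] [DecidableEq κ] {c : Matrix κ κ H}

theorem IsComatrix.sum_antipode_mul (hc : IsComatrix k c) (i j : κ) :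
    ∑ l, antipode k (c i l) * c l j = (1 : Matrix κ κ H) i j := by
  have := HopfAlgebra.mul_antipode_rTensor_comul_apply (R := k) (c i j)
  rw [hc.comul_eq, hc.counit_eq] at this
  simp only [map_sum, LinearMap.rTensor_tmul, LinearMap.mul'_apply] at this
  rw [this, Matrix.one_apply, Matrix.one_apply]
  split_ifs <;> simp

theorem IsComatrix.sum_mul_antipode (hc : IsComatrix k c) (i j : κ) :
    ∑ l, c i l * antipode k (c l j) = (1 : Matrix κ κ H) i j := by
  have := HopfAlgebra.mul_antipode_lTensor_comul_apply (R := k) (c i j)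
  rw [hc.comul_eq, hc.counit_eq] at this
  simp only [map_sum, LinearMap.lTensor_tmul, LinearMap.mul'_apply] at this
  rw [this, Matrix.one_apply, Matrix.one_apply]
  split_ifs <;> simp

theorem IsComatrix.comul_antipode_eq (hc : IsComatrix k c) (i j : κ) :
    comul (R := k) (antipode k (c i j)) = ∑ l, antipode k (c l j) ⊗ₜ[k] antipode k (c i l) := by
  let D := Bialgebra.comulAlgHom k H
  let X : Matrix κ κ (H ⊗[k] H) := fun i j => comul (R := k) (c i j)
  let Z : Matrix κ κ (H ⊗[k] H) := fun i j => comul (R := k) (antipode k (c i j))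
  let Y : Matrix κ κ (H ⊗[k] H) := fun i j => ∑ l, antipode k (c l j) ⊗ₜ[k] antipode k (c i l)
  have hXZ : X * Z = 1 := by
    ext i j
    have := congrArg D (hc.sum_mul_antipode i j)
    rw [map_sum] at this
    simp only [map_mul] at this
    rw [Matrix.mul_apply]
    refine this.trans ?_
    rw [Matrix.one_apply, Matrix.one_apply]
    split_ifs <;> simp
  have hYX : Y * X = 1 := by
    ext i j
    rw [Matrix.mul_apply]
    simp only [Y, X, hc.comul_eq, Finset.sum_mul_sum, Algebra.TensorProduct.tmul_mul_tmul]
    have : ∀ a b, ∑ l, (antipode k (c a l) * c l b) ⊗ₜ[k] (antipode k (c i a) * c b j) =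
        (1 : Matrix κ κ H) a b ⊗ₜ (antipode k (c i a) * c b j) := fun a b => by
      rw [← TensorProduct.sum_tmul, hc.sum_antipode_mul]
    calc _ = ∑ a, ∑ b, ∑ l, (antipode k (c a l) * c l b) ⊗ₜ[k] (antipode k (c i a) * c b j) := by
          rw [Finset.sum_comm]
          exact Finset.sum_congr rfl fun a _ => Finset.sum_comm
      _ = ∑ a, (1 : H) ⊗ₜ[k] (antipode k (c i a) * c a j) := by
          simp [this, Matrix.one_apply, TensorProduct.ite_tmul]
      _ = (1 : Matrix κ κ (H ⊗[k] H)) i j := by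
          rw [← TensorProduct.tmul_sum, hc.sum_antipode_mul, Matrix.one_apply, Matrix.one_apply]
          split_ifs <;> simp [Algebra.TensorProduct.one_def]
  have := left_inv_eq_right_inv hYX hXZ
  exact (congrFun (congrFun this i) j).symm

end Products

section DualQuasitriangularComatrix

variable {k : Type*} [Field k] {H : Type*} [Ring H] [HopfAlgebra k H] {r : LinearMap.BilinForm k H}
  {κ κ' : Type*} [Fintype κ] [DecidableEq κ] [Fintype κ'] [DecidableEq κ']
  {c : Matrix κ κ H} {d : Matrix κ' κ' H}

theorem IsDualQuasitriangular.mul_left_comatrix (hr : IsDualQuasitriangular r)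
    (hc : IsComatrix k c) (a b : H) (i j : κ) :
    r (a * b) (c i j) = ∑ l, r a (c i l) * r b (c l j) := by
  rw [hr.mul_left, hc.comul_eq]
  simp

theorem IsDualQuasitriangular.mul_right_comatrix (hr : IsDualQuasitriangular r)
    (hc : IsComatrix k c) (a b : H) (i j : κ) :
    r (c i j) (a * b) = ∑ l, r (c i l) b * r (c l j) a := by
  rw [hr.mul_right, hc.comul_eq]
  simp

theorem comul_comatrix_tmul (hc : IsComatrix k c) (hd : IsComatrix k d) (i j : κ) (p l : κ') :
    comul (R := k) (c i j ⊗ₜ[k] d p l) =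
      ∑ q, ∑ m, (c i q ⊗ₜ[k] d p m) ⊗ₜ[k] (c q j ⊗ₜ[k] d m l) := by
  rw [TensorProduct.comul_tmul, hc.comul_eq, hd.comul_eq]
  simp [TensorProduct.sum_tmul, TensorProduct.tmul_sum]
  exact Finset.sum_comm

theorem IsDualQuasitriangular.quasicomm_comatrix (hr : IsDualQuasitriangular r)
    (hc : IsComatrix k c) (hd : IsComatrix k d) (i j : κ) (p l : κ') :
    ∑ q, ∑ m, r (c q j) (d m l) • (d p m * c i q) =
      ∑ q, ∑ m, r (c i q) (d p m) • (c q j * d m l) := by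
  have := hr.quasicomm (c i j) (d p l)
  rw [comul_comatrix_tmul hc hd] at this
  simpa using this

end DualQuasitriangularComatrix

section SmashProduct

/-- A right module algebra structure on the algebra `B` over the bialgebra `H`. -/
structure RightModuleAlgebra (k H B : Type*) [Field k] [Ring H] [HopfAlgebra k H] [Ring B]
    [Algebra k B] where
  /-- The action. -/
  act : B →ₗ[k] H →ₗ[k] B
  act_one_right : ∀ b, act b 1 = b
  act_mul_right : ∀ b g h, act b (g * h) = act (act b g) h
  act_one : ∀ h, act 1 h = counit (R := k) h • 1
  act_mul : ∀ b b' h, act (b * b') h =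
    LinearMap.mul' k B (TensorProduct.map (act b) (act b') (comul (R := k) h))

variable {k H B : Type*} [Field k] [Ring H] [HopfAlgebra k H] [Ring B] [Algebra k B]

theorem RightModuleAlgebra.act_mul_comatrix (M : RightModuleAlgebra k H B) {κ : Type*} [Fintype κ]
    [DecidableEq κ] {c : Matrix κ κ H} (hc : IsComatrix k c) (b b' : B) (i j : κ) :
    M.act (b * b') (c i j) = ∑ l, M.act b (c i l) * M.act b' (c l j) := by
  rw [M.act_mul, hc.comul_eq]
  simp

/-- The smash product of `H` with a right module algebra, on the vector space `H ⊗ B`. -/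
def Smash (_ : RightModuleAlgebra k H B) : Type _ := H ⊗[k] B

namespace Smash

variable (M : RightModuleAlgebra k H B)

instance : AddCommGroup (Smash M) := inferInstanceAs (AddCommGroup (H ⊗[k] B))
instance : Module k (Smash M) := inferInstanceAs (Module k (H ⊗[k] B))

/-- The element `h ⊗ b`. -/
def mk : H →ₗ[k] B →ₗ[k] Smash M := TensorProduct.mk k H B

variable {M}

theorem induction {p : Smash M → Prop} (zero : p 0) (mk : ∀ h b, p (mk M h b))
    (add : ∀ x y, p x → p y → p (x + y)) (x : Smash M) : p x :=
  TensorProduct.induction_on (motive := p) x zero mk add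

variable (M)

/-- The exchange map `b ⊗ h ↦ h₁ ⊗ b ◁ h₂`. -/
def swap : B →ₗ[k] H →ₗ[k] H ⊗[k] B :=
  LinearMap.lcomp k (H ⊗[k] B) (comul (R := k) (A := H)) ∘ₗ LinearMap.lTensorHom H ∘ₗ M.act

variable {κ κ' : Type*} [Fintype κ] [DecidableEq κ] [Fintype κ'] [DecidableEq κ']
  {c : Matrix κ κ H} {d : Matrix κ' κ' H}

theorem swap_comatrix (hc : IsComatrix k c) (b : B) (i j : κ) :
    swap M b (c i j) = ∑ l, c i l ⊗ₜ[k] M.act b (c l j) := by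
  simp [swap, hc.comul_eq]

/-- The product `(h ⊗ b)(h' ⊗ b') = h h'₁ ⊗ (b ◁ h'₂) b'`. -/
def mulMap : (H ⊗[k] B) ⊗[k] (H ⊗[k] B) →ₗ[k] H ⊗[k] B :=
  TensorProduct.map (LinearMap.mul' k H) (LinearMap.mul' k B) ∘ₗ
    (TensorProduct.tensorTensorTensorAssoc k H H B B).symm.toLinearMap ∘ₗ
      (((TensorProduct.lift (swap M)).lTensor H).rTensor B) ∘ₗ
        (TensorProduct.tensorTensorTensorAssoc k H B H B).toLinearMap

/-- The product of the smash product as a bilinear map. -/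
def mulBilin : Smash M →ₗ[k] Smash M →ₗ[k] Smash M := TensorProduct.curry (mulMap M)

instance : Mul (Smash M) := ⟨fun x y => mulBilin M x y⟩
instance : One (Smash M) := ⟨mk M 1 1⟩

theorem one_def : (1 : Smash M) = mk M 1 1 := rfl

theorem mul_def (x y : Smash M) : x * y = mulBilin M x y := rfl

instance : NonUnitalNonAssocRing (Smash M) :=
  { (inferInstance : AddCommGroup (Smash M)) with
    mul := (· * ·)
    left_distrib := fun x y z => by simp only [mul_def, map_add]
    right_distrib := fun x y z => by simp only [mul_def, map_add, LinearMap.add_apply]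
    zero_mul := fun x => by simp only [mul_def, map_zero, LinearMap.zero_apply]
    mul_zero := fun x => by simp only [mul_def, map_zero] }

theorem smul_mul (a : k) (x y : Smash M) : (a • x) * y = a • (x * y) := by
  simp only [mul_def, map_smul, LinearMap.smul_apply]

theorem mul_smul' (a : k) (x y : Smash M) : x * (a • y) = a • (x * y) := by
  simp only [mul_def, map_smul]

variable {M}

theorem mk_mul_mk_comatrix (hc : IsComatrix k c) (h : H) (b b' : B) (i j : κ) :
    mk M h b * mk M (c i j) b' = ∑ l, mk M (h * c i l) (M.act b (c l j) * b') := by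
  have : mk M h b * mk M (c i j) b' = mulMap M ((h ⊗ₜ b) ⊗ₜ (c i j ⊗ₜ b')) := rfl
  rw [this, mulMap]
  simp [swap_comatrix M hc, TensorProduct.tmul_sum, TensorProduct.sum_tmul]
  rfl

theorem mk_mul_mk_one (h : H) (b b' : B) : mk M h b * mk M 1 b' = mk M h (b * b') := by
  have : IsComatrix k (fun _ _ : Unit => (1 : H)) :=
    ⟨fun _ _ => by simp [Algebra.TensorProduct.one_def], fun _ _ => by simp⟩
  rw [mk_mul_mk_comatrix this h b b' () ()]
  simp [M.act_one_right]

theorem mk_one_mul_mk (h h' : H) (b' : B) : mk M h 1 * mk M h' b' = mk M (h * h') b' := by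
  induction h' using (@comatrix_induction k _ H _ _ _) with
  | add x y hx hy => simp only [map_add, LinearMap.add_apply, mul_add, hx, hy]
  | smul a x hx => simp only [map_smul, LinearMap.smul_apply, mul_smul', mul_smul_comm, hx]
  | zero => simp
  | base n c hc i j =>
    rw [mk_mul_mk_comatrix hc]
    simp [M.act_one, hc.counit_eq, Matrix.one_apply, ite_mul, apply_ite]

theorem mk_mul_assoc (h h' h'' : H) (b b' b'' : B) :
    mk M h b * mk M h' b' * mk M h'' b'' = mk M h b * (mk M h' b' * mk M h'' b'') := by
  induction h' using (@comatrix_induction k _ H _ _ _) with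
  | add x y hx hy => simp only [map_add, LinearMap.add_apply, mul_add, add_mul, hx, hy]
  | smul a x hx => simp only [map_smul, LinearMap.smul_apply, mul_smul', smul_mul, hx]
  | zero => simp
  | base n c hc i j =>
    induction h'' using (@comatrix_induction k _ H _ _ _) with
    | add x y hx hy => simp only [map_add, LinearMap.add_apply, mul_add, hx, hy]
    | smul a x hx => simp only [map_smul, LinearMap.smul_apply, mul_smul', hx]
    | zero => simp
    | base m d hd p q =>
      have key : ∀ x y b1, mk M h b * mk M (c i j * d x y) b1 =
          ∑ l, ∑ s, mk M (h * (c i l * d x s)) (M.act b (c l j * d s y) * b1) := fun x y b1 => by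
        rw [mk_mul_mk_comatrix (hc.kronecker hd) h b b1 (i, x) (j, y), Fintype.sum_prod_type]
      simp only [mk_mul_mk_comatrix hc, mk_mul_mk_comatrix hd, Finset.sum_mul, Finset.mul_sum, key,
        M.act_mul_comatrix hd, map_sum, M.act_mul_right, mul_assoc]
      rw [Finset.sum_comm (s := (Finset.univ : Finset (Fin m)))]
      exact Finset.sum_congr rfl fun _ _ => Finset.sum_comm

instance : Ring (Smash M) :=
  { (inferInstance : NonUnitalNonAssocRing (Smash M)) with
    one := 1
    mul_assoc := fun x y z => by
      induction x using Smash.induction with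
      | zero => simp
      | add x x' hx hx' => simp only [add_mul, hx, hx']
      | mk h b =>
        induction y using Smash.induction with
        | zero => simp
        | add x x' hx hx' => simp only [add_mul, mul_add, hx, hx']
        | mk h' b' =>
          induction z using Smash.induction with
          | zero => simp
          | add x x' hx hx' => simp only [mul_add, hx, hx']
          | mk h'' b'' => exact mk_mul_assoc h h' h'' b b' b''
    one_mul := fun x => by
      induction x using Smash.induction with
      | zero => simp
      | add x x' hx hx' => simp only [mul_add, hx, hx']
      | mk h b => rw [one_def, mk_one_mul_mk, one_mul]
    mul_one := fun x => by
      induction x using Smash.induction with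
      | zero => simp
      | add x x' hx hx' => simp only [add_mul, hx, hx']
      | mk h b => rw [one_def, mk_mul_mk_one, mul_one] }

instance : Algebra k (Smash M) := Algebra.ofModule (smul_mul M) (fun a x y => mul_smul' M a x y)

variable (M)

/-- The inclusion of `B`. -/
def inl : B →ₐ[k] Smash M := AlgHom.ofLinearMap (mk M 1) rfl fun x y => (mk_mul_mk_one 1 x y).symm

/-- The inclusion of `H`. -/
def inr : H →ₐ[k] Smash M := AlgHom.ofLinearMap ((mk M).flip 1) rfl
  fun x y => (mk_one_mul_mk x y 1).symm

theorem inr_mul_inl (h : H) (b : B) : inr M h * inl M b = mk M h b := by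
  change mk M h 1 * mk M 1 b = _
  rw [mk_mul_mk_one, one_mul]

theorem inl_mul_inr (hc : IsComatrix k c) (b : B) (i j : κ) :
    inl M b * inr M (c i j) = ∑ l, inr M (c i l) * inl M (M.act b (c l j)) := by
  change mk M 1 b * mk M (c i j) 1 = _
  simp [mk_mul_mk_comatrix hc, inr_mul_inl]

variable {M}

/-- The universal property of the smash product. -/
def lift {Q : Type*} [Ring Q] [Algebra k Q] (f : B →ₐ[k] Q) (g : H →ₐ[k] Q)
    (hfg : ∀ (n : ℕ) (c : Matrix (Fin n) (Fin n) H), IsComatrix k c → ∀ b i j,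
      f b * g (c i j) = ∑ l, g (c i l) * f (M.act b (c l j))) : Smash M →ₐ[k] Q :=
  AlgHom.ofLinearMap (LinearMap.mul' k Q ∘ₗ TensorProduct.map g.toLinearMap f.toLinearMap :
      H ⊗[k] B →ₗ[k] Q)
    (by
      change LinearMap.mul' k Q (TensorProduct.map g.toLinearMap f.toLinearMap (1 ⊗ₜ 1)) = 1
      simp)
    (fun x y => by
      set F : Smash M →ₗ[k] Q := LinearMap.mul' k Q ∘ₗ TensorProduct.map g.toLinearMap f.toLinearMap
      have hF : ∀ h b, F (mk M h b) = g h * f b := fun h b => rfl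
      change F (x * y) = F x * F y
      induction x using Smash.induction with
      | zero => simp
      | add x x' hx hx' => simp only [add_mul, map_add, hx, hx']
      | mk h b =>
        induction y using Smash.induction with
        | zero => simp
        | add x x' hx hx' => simp only [mul_add, map_add, hx, hx']
        | mk h' b' =>
          induction h' using (@comatrix_induction k _ H _ _ _) with
          | add x y hx hy => simp only [map_add, LinearMap.add_apply, mul_add, hx, hy]
          | smul a x hx => simp only [map_smul, LinearMap.smul_apply, mul_smul_comm, hx]
          | zero => simp
          | base n c hc i j =>
            rw [mk_mul_mk_comatrix hc, map_sum]
            simp only [hF, map_mul]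
            rw [mul_assoc, ← mul_assoc (f b), hfg n c hc]
            simp only [Finset.sum_mul, Finset.mul_sum, mul_assoc])

section Lift

variable {Q : Type*} [Ring Q] [Algebra k Q] (f : B →ₐ[k] Q) (g : H →ₐ[k] Q)
    (hfg : ∀ (n : ℕ) (c : Matrix (Fin n) (Fin n) H), IsComatrix k c → ∀ b i j,
      f b * g (c i j) = ∑ l, g (c i l) * f (M.act b (c l j)))

@[simp] theorem lift_inl (b : B) : lift f g hfg (inl M b) = f b := by
  change g 1 * f b = f b
  simp

@[simp] theorem lift_inr (h : H) : lift f g hfg (inr M h) = g h := by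
  change g h * f 1 = g h
  simp

end Lift

theorem algHom_ext {Q : Type*} [Ring Q] [Algebra k Q] {F G : Smash M →ₐ[k] Q}
    (hl : ∀ b, F (inl M b) = G (inl M b)) (hr : ∀ h, F (inr M h) = G (inr M h)) : F = G := by
  ext x
  induction x using Smash.induction with
  | zero => simp
  | add x y hx hy => simp only [map_add, hx, hy]
  | mk h b => rw [← inr_mul_inl, map_mul, map_mul, hl, hr]

theorem bijective_orderedProduct :
    Function.Bijective (orderedProduct (inl M).toLinearMap (inr M).toLinearMap) := by
  have : orderedProduct (inl M).toLinearMap (inr M).toLinearMap =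
      ((TensorProduct.comm k B H).toLinearMap : _ →ₗ[k] Smash M) := by
    refine TensorProduct.ext' fun b h => ?_
    exact inr_mul_inl M h b
  rw [this]
  exact (TensorProduct.comm k B H).bijective

end Smash
end SmashProduct

section CoactionToAction

variable {k : Type*} [Field k] {H : Type*} [Ring H] [HopfAlgebra k H] {r : LinearMap.BilinForm k H}
  {B : Type*} [Ring B] [Algebra k B] {κ : Type*} [Fintype κ] [DecidableEq κ]

theorem rightAction_of_isSubcomodule (r : LinearMap.BilinForm k H) {β : B →ₗ[k] B ⊗[k] H}
    {w : κ → B} {c : Matrix κ κ H}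
    (hβ : ∀ p, β (w p) = ∑ q, w q ⊗ₜ[k] c q p) (p : κ) (h : H) :
    rightAction r β (w p ⊗ₜ h) = ∑ q, r (c q p) h • w q := by
  simp [rightAction, hβ, TensorProduct.sum_tmul]

theorem braiding_of_isSubcomodule {κ' : Type*} [Fintype κ'] [DecidableEq κ']
    (r : LinearMap.BilinForm k H) {β : B →ₗ[k] B ⊗[k] H} {w : κ → B} {c : Matrix κ κ H}
    {w' : κ' → B} {c' : Matrix κ' κ' H} (hβ : ∀ p, β (w p) = ∑ q, w q ⊗ₜ[k] c q p)
    (hβ' : ∀ p, β (w' p) = ∑ q, w' q ⊗ₜ[k] c' q p) (p : κ) (p' : κ') :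
    braiding r β (w p ⊗ₜ w' p') = ∑ q, ∑ q', r (c q p) (c' q' p') • (w' q' ⊗ₜ[k] w q) := by
  simp [braiding, hβ, hβ', TensorProduct.sum_tmul, TensorProduct.tmul_sum]
  exact Finset.sum_comm

/-- The module algebra structure obtained from a comodule algebra structure by means of a dual
quasitriangular structure. -/
def RightModuleAlgebra.ofCoaction (hr : IsDualQuasitriangular r) (β : B →ₐ[k] B ⊗[k] H)
    (hβ : ∀ b, TensorProduct.assoc k B H H (β.toLinearMap.rTensor H (β b)) =
      (comul (R := k) (A := H)).lTensor B (β b))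
    (hε : ∀ b, TensorProduct.rid k B ((counit (R := k) (A := H)).lTensor B (β b)) = b) :
    RightModuleAlgebra k H B where
  act := TensorProduct.curry (rightAction r β.toLinearMap)
  act_one_right b := by
    induction b using comodule_induction β.toLinearMap hβ hε with
    | add x y hx hy => simp only [map_add, LinearMap.add_apply, hx, hy]
    | smul a x hx => simp only [map_smul, LinearMap.smul_apply, hx]
    | zero => simp
    | base n w c h i =>
      simp [rightAction_of_isSubcomodule r h.coact, hr.one_right, h.comatrix.counit_eq,
        Matrix.one_apply]
  act_mul_right b g h := by
    induction b using comodule_induction β.toLinearMap hβ hε with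
    | add x y hx hy => simp only [map_add, LinearMap.add_apply, hx, hy]
    | smul a x hx => simp only [map_smul, LinearMap.smul_apply, hx]
    | zero => simp
    | base n w c hc i =>
      simp only [TensorProduct.curry_apply, rightAction_of_isSubcomodule r hc.coact, map_sum,
        LinearMap.sum_apply, map_smul, LinearMap.smul_apply,
        hr.mul_right_comatrix hc.comatrix, Finset.sum_smul, Finset.smul_sum, smul_smul]
      rw [Finset.sum_comm]
      exact Finset.sum_congr rfl fun _ _ => Finset.sum_congr rfl fun _ _ => by rw [mul_comm]
  act_one h := by
    simp [rightAction, Algebra.TensorProduct.one_def, hr.one_left]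
  act_mul b b' h := by
    induction b using comodule_induction β.toLinearMap hβ hε with
    | add x y hx hy =>
      simp only [map_add, LinearMap.add_apply, hx, hy, add_mul, TensorProduct.map_add_left]
    | smul a x hx =>
      simp only [map_smul, LinearMap.smul_apply, hx, smul_mul_assoc, TensorProduct.map_smul_left]
    | zero => simp
    | base n w c hc i =>
      induction b' using comodule_induction β.toLinearMap hβ hε with
      | add x y hx hy =>
        simp only [map_add, LinearMap.add_apply, hx, hy, mul_add, TensorProduct.map_add_right]
      | smul a x hx =>
        simp only [map_smul, LinearMap.smul_apply, hx, mul_smul_comm, TensorProduct.map_smul_right]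
      | zero => simp
      | base n' w' c' hc' i' =>
        induction h using (@comatrix_induction k _ H _ _ _) with
        | add x y hx hy => simp only [map_add, hx, hy]
        | smul a x hx => simp only [map_smul, hx]
        | zero => simp
        | base m d hd p q =>
          have h1 : ∀ p : Fin n × Fin n', β.toLinearMap (w p.1 * w' p.2) =
              ∑ q : Fin n × Fin n', (w q.1 * w' q.2) ⊗ₜ[k] (c q.1 p.1 * c' q.2 p.2) := by
            intro p
            have e1 := hc.coact p.1
            have e2 := hc'.coact p.2
            simp only [AlgHom.toLinearMap_apply] at e1 e2 ⊢
            rw [map_mul, e1, e2, Finset.sum_mul_sum, Fintype.sum_prod_type]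
            simp
          rw [TensorProduct.curry_apply,
            rightAction_of_isSubcomodule r (w := fun q : Fin n × Fin n' => w q.1 * w' q.2)
              (c := fun q p => c q.1 p.1 * c' q.2 p.2) h1 (i, i')]
          simp only [hd.comul_eq, map_sum, TensorProduct.map_tmul, TensorProduct.curry_apply,
            rightAction_of_isSubcomodule r hc.coact, rightAction_of_isSubcomodule r hc'.coact,
            LinearMap.mul'_apply, Finset.sum_mul_sum, hr.mul_left_comatrix hd,
            Fintype.sum_prod_type, Finset.sum_smul, smul_mul_smul_comm]
          symm
          rw [Finset.sum_comm]
          exact Finset.sum_congr rfl fun _ _ => Finset.sum_comm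

end CoactionToAction

section BraidForm

variable {k : Type*} [Field k] {ι : Type*} [Fintype ι] [DecidableEq ι]

theorem perm_mul_apply (R : Matrix (ι × ι) (ι × ι) k) (m n : ι) (y : ι × ι) :
    (perm k ι * R) (m, n) y = R (n, m) y := by
  rw [Matrix.mul_apply, Fintype.sum_eq_single (n, m)]
  · simp [perm]
  · rintro ⟨a, b⟩ h
    have : ¬ (m = b ∧ n = a) := fun ⟨h1, h2⟩ => h (by rw [h1, h2])
    simp [perm, this]

variable {Q : Type*} [Ring Q] [Algebra k Q]

/-- The matrix `P M`, with entries regarded as scalars in an algebra. -/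
def braid (Q : Type*) [Ring Q] [Algebra k Q] (M : Matrix (ι × ι) (ι × ι) k) :
    Matrix (ι × ι) (ι × ι) Q :=
  (perm k ι * M).map (algebraMap k Q)

/-- The matrix `u₁ v₂` of products of entries. -/
def matMul (u v : Matrix ι ι Q) : Matrix (ι × ι) (ι × ι) Q := fun x y => u x.1 y.1 * v x.2 y.2

/-- The row `x₁ y₂` of products of entries. -/
def rowMul (x y : ι → Q) : ι × ι → Q := fun p => x p.1 * y p.2

theorem braid_apply (M : Matrix (ι × ι) (ι × ι) k) (m n : ι) (y : ι × ι) :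
    braid Q M (m, n) y = algebraMap k Q (M (n, m) y) := by
  rw [braid, Matrix.map_apply, perm_mul_apply]

theorem exchange_iff (M : Matrix (ι × ι) (ι × ι) k) (u v : Matrix ι ι Q) :
    Exchange M u v ↔ braid Q M * matMul u v = matMul v u * braid Q M := by
  have h1 : ∀ i k' j l, (braid Q M * matMul u v) (k', i) (j, l) =
      ∑ a, ∑ b, M (i, k') (a, b) • (u a j * v b l) := fun i k' j l => by
    simp only [Matrix.mul_apply, Fintype.sum_prod_type, braid_apply, matMul, Algebra.smul_def]
  have h2 : ∀ i k' j l, (matMul v u * braid Q M) (k', i) (j, l) =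
      ∑ a, ∑ b, M (a, b) (j, l) • (v k' b * u i a) := fun i k' j l => by
    simp only [Matrix.mul_apply, Fintype.sum_prod_type, braid_apply, matMul, Algebra.smul_def]
    rw [Finset.sum_comm]
    exact Finset.sum_congr rfl fun _ _ => Finset.sum_congr rfl fun _ _ =>
      (Algebra.commutes _ _).symm
  constructor
  · intro h
    ext ⟨k', i⟩ ⟨j, l⟩
    rw [h1, h2, h]
  · intro h i k' j l
    rw [← h1, ← h2, h]

/-- A row of elements of an algebra that satisfies the relations of the braided covectors. -/
def IsCovectorRow (M : Matrix (ι × ι) (ι × ι) k) (x : ι → Q) : Prop :=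
  Matrix.vecMul (rowMul x x) (braid Q M) = rowMul x x

theorem isCovectorRow_iff {M : Matrix (ι × ι) (ι × ι) k} {x : ι → Q} :
    IsCovectorRow M x ↔ ∀ j l, x j * x l = ∑ a, ∑ c, M (a, c) (j, l) • (x c * x a) := by
  have : ∀ j l, Matrix.vecMul (rowMul x x) (braid Q M) (j, l) =
      ∑ a, ∑ c, M (a, c) (j, l) • (x c * x a) := fun j l => by
    simp only [Matrix.vecMul, dotProduct, Fintype.sum_prod_type, braid_apply, rowMul,
      Algebra.smul_def]
    rw [Finset.sum_comm]
    exact Finset.sum_congr rfl fun _ _ => Finset.sum_congr rfl fun _ _ =>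
      (Algebra.commutes _ _).symm
  constructor
  · intro h j l
    rw [← this, h]
    rfl
  · intro h
    ext ⟨j, l⟩
    rw [this, ← h]
    rfl

namespace Covector

variable {R' : Matrix (ι × ι) (ι × ι) k}

theorem isCovectorRow_gen (R' : Matrix (ι × ι) (ι × ι) k) : IsCovectorRow R' (gen R') := by
  refine isCovectorRow_iff.mpr fun j l => ?_
  have := RingQuot.mkAlgHom_rel k (CovectorRel.rel (R' := R') j l)
  simp only [map_mul, map_sum, map_smul] at this
  exact this

/-- The algebra map from the braided covectors given by a covector row. -/
def lift {x : ι → Q} (hx : IsCovectorRow R' x) : Covector R' →ₐ[k] Q :=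
  RingQuot.liftAlgHom k ⟨FreeAlgebra.lift k x, by
    rintro _ _ ⟨j, l⟩
    simpa using isCovectorRow_iff.mp hx j l⟩

@[simp] theorem lift_gen {x : ι → Q} (hx : IsCovectorRow R' x) (j : ι) :
    lift hx (gen R' j) = x j := by
  simp [lift, gen]

theorem algHom_ext {f g : Covector R' →ₐ[k] Q} (h : ∀ j, f (gen R' j) = g (gen R' j)) : f = g := by
  apply RingQuot.ringQuot_ext'
  apply FreeAlgebra.hom_ext
  funext j
  exact h j

theorem adjoin_gen : Algebra.adjoin k (Set.range (gen R')) = ⊤ := by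
  rw [eq_top_iff]
  have h1 := FreeAlgebra.adjoin_range_ι k ι
  have h2 := congrArg (Subalgebra.map (RingQuot.mkAlgHom k (CovectorRel R'))) h1
  rw [AlgHom.map_adjoin, ← Set.range_comp, Algebra.map_top,
    (AlgHom.range_eq_top _).mpr (RingQuot.mkAlgHom_surjective k _)] at h2
  exact h2.ge

theorem induction {p : Covector R' → Prop} (one : p 1) (gen : ∀ j, p (gen R' j))
    (add : ∀ x y, p x → p y → p (x + y)) (smul : ∀ (a : k) x, p x → p (a • x))
    (mul : ∀ x y, p x → p y → p (x * y)) (b : Covector R') : p b := by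
  have hb : b ∈ Algebra.adjoin k (Set.range (Covector.gen R')) := by
    rw [adjoin_gen]; exact Algebra.mem_top
  refine Algebra.adjoin_induction (p := fun x _ => p x) ?_ (fun a => ?_)
    (fun x y _ _ => add x y) (fun x y _ _ => mul x y) hb
  · rintro _ ⟨j, rfl⟩
    exact gen j
  · rw [Algebra.algebraMap_eq_smul_one]
    exact smul _ _ one

end Covector

theorem rowMul_sum_mul {x : ι → Q} {u : Matrix ι ι Q} (h : ∀ i j l, x i * u j l = u j l * x i) :
    rowMul (fun j => ∑ a, x a * u a j) (fun j => ∑ a, x a * u a j) =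
      Matrix.vecMul (rowMul x x) (matMul u u) := by
  ext ⟨j, l⟩
  simp only [rowMul, Matrix.vecMul, dotProduct, matMul, Fintype.sum_prod_type, Finset.sum_mul_sum]
  refine Finset.sum_congr rfl fun a _ => Finset.sum_congr rfl fun b _ => ?_
  rw [mul_assoc, ← mul_assoc (u a j), ← h, mul_assoc, mul_assoc]

theorem IsCovectorRow.mul_matrix {M : Matrix (ι × ι) (ι × ι) k} {x : ι → Q}
    (hx : IsCovectorRow M x) {u : Matrix ι ι Q} (hu : Exchange M u u)
    (h : ∀ i j l, x i * u j l = u j l * x i) : IsCovectorRow M (fun j => ∑ a, x a * u a j) := by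
  unfold IsCovectorRow
  rw [rowMul_sum_mul h, Matrix.vecMul_vecMul, ← (exchange_iff M u u).mp hu, ← Matrix.vecMul_vecMul,
    hx]

theorem braid_mul_braid (R R' : Matrix (ι × ι) (ι × ι) k) :
    braid Q R * braid Q R' = ((perm k ι * R) * (perm k ι * R')).map (algebraMap k Q) :=
  (Matrix.map_mul (f := algebraMap k Q)).symm

theorem IsCovectorPair.braid_linear {R R' : Matrix (ι × ι) (ι × ι) k} (h : IsCovectorPair R R') :
    (1 + braid Q R) * braid Q R' = 1 + braid Q R := by
  have := congrArg (fun X => X.map (algebraMap k Q)) h.linear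
  have h2 : (perm k ι * R + 1) * (perm k ι * R') = perm k ι * R + 1 := by
    have h3 := h.linear
    rw [mul_sub, mul_one, sub_eq_zero] at h3
    exact h3
  have h3 := congrArg (fun X => X.map (algebraMap k Q)) h2
  have h1 : (perm k ι * R + 1).map (algebraMap k Q) = 1 + braid Q R := by
    rw [Matrix.map_add _ (map_add _), Matrix.map_one _ (map_zero _) (map_one _), add_comm]
    rfl
  rw [Matrix.map_mul, h1] at h3
  exact h3

theorem perm_mul_perm : perm k ι * perm k ι = 1 := by
  ext ⟨m, n⟩ ⟨a, b⟩
  rw [perm_mul_apply]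
  simp [perm, Matrix.one_apply, and_comm]

theorem perm_mul_mul_perm (R : Matrix (ι × ι) (ι × ι) k) :
    perm k ι * R * perm k ι = flipLegs R := by
  ext ⟨m, n⟩ ⟨a, b⟩
  rw [Matrix.mul_apply, Fintype.sum_eq_single (b, a)]
  · rw [perm_mul_apply]
    simp [perm, flipLegs]
  · rintro ⟨c, d⟩ h
    have : ¬ (c = b ∧ d = a) := fun ⟨h1, h2⟩ => h (by rw [h1, h2])
    simp [perm, this]

theorem IsCovectorPair.braid_commute {R R' : Matrix (ι × ι) (ι × ι) k} (h : IsCovectorPair R R') :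
    braid Q R * braid Q R' = braid Q R' * braid Q R := by
  rw [braid_mul_braid, braid_mul_braid, ← mul_assoc, ← mul_assoc, perm_mul_mul_perm,
    perm_mul_mul_perm, h.flip]

theorem IsCovectorRow.add {R R' : Matrix (ι × ι) (ι × ι) k} (h : IsCovectorPair R R')
    {x y : ι → Q} (hx : IsCovectorRow R' x) (hy : IsCovectorRow R' y)
    (hxy : rowMul y x = Matrix.vecMul (rowMul x y) (braid Q R)) : IsCovectorRow R' (x + y) := by
  have key : rowMul (x + y) (x + y) =
      rowMul x x + Matrix.vecMul (rowMul x y) (1 + braid Q R) + rowMul y y := by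
    rw [Matrix.vecMul_add, Matrix.vecMul_one, ← hxy]
    ext p
    simp only [rowMul, Pi.add_apply]
    noncomm_ring
  unfold IsCovectorRow
  rw [key, Matrix.add_vecMul, Matrix.add_vecMul, hx, hy, Matrix.vecMul_vecMul, h.braid_linear]

end BraidForm

section CovectorBosonization

variable {k : Type*} [Field k] {ι : Type*} [Fintype ι] [DecidableEq ι]
  {H : Type*} [Ring H] [HopfAlgebra k H]

/-- A comatrix `u` of a dual quasitriangular Hopf algebra with `r(u₁ ⊗ u₂) = R` that satisfies the
relations making the braided covectors a comodule algebra. -/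
structure IsCovectorSymmetry (R R' : Matrix (ι × ι) (ι × ι) k) (r : LinearMap.BilinForm k H)
    (u : Matrix ι ι H) : Prop where
  pair : IsCovectorPair R R'
  dual : IsDualQuasitriangular r
  comatrix : IsComatrix k u
  form : ∀ i j p l, r (u i j) (u p l) = R (i, p) (j, l)
  exchange : Exchange R' u u

variable {R R' : Matrix (ι × ι) (ι × ι) k} {r : LinearMap.BilinForm k H} {u : Matrix ι ι H}

theorem Exchange.map {Q Q' : Type*} [Ring Q] [Algebra k Q] [Ring Q'] [Algebra k Q']
    {M : Matrix (ι × ι) (ι × ι) k} {v w : Matrix ι ι Q} (h : Exchange M v w) (f : Q →ₐ[k] Q') :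
    Exchange M (v.map f) (w.map f) := fun i p j l => by
  have := congrArg f (h i p j l)
  simpa using this

theorem IsCovectorRow.map {Q Q' : Type*} [Ring Q] [Algebra k Q] [Ring Q'] [Algebra k Q']
    {M : Matrix (ι × ι) (ι × ι) k} {x : ι → Q} (h : IsCovectorRow M x) (f : Q →ₐ[k] Q') :
    IsCovectorRow M (fun j => f (x j)) := by
  rw [isCovectorRow_iff] at h ⊢
  intro j l
  have := congrArg f (h j l)
  simpa only [map_mul, map_sum, map_smul] using this

namespace IsCovectorSymmetry

variable (S : IsCovectorSymmetry R R' r u)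
include S

theorem isCovectorRow_coact :
    IsCovectorRow R' (fun j => ∑ a, Covector.gen R' a ⊗ₜ[k] u a j) := by
  have h1 := (Covector.isCovectorRow_gen R').map (Q' := Covector R' ⊗[k] H)
    (Algebra.TensorProduct.includeLeft : Covector R' →ₐ[k] Covector R' ⊗[k] H)
  have h2 := S.exchange.map (Q' := Covector R' ⊗[k] H)
    (Algebra.TensorProduct.includeRight : H →ₐ[k] Covector R' ⊗[k] H)
  have h3 := h1.mul_matrix h2 fun i j l => by simp
  simpa using h3

/-- The coaction `x ↦ x u`. -/
def coact : Covector R' →ₐ[k] Covector R' ⊗[k] H := Covector.lift S.isCovectorRow_coact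

@[simp] theorem coact_gen (j : ι) :
    S.coact (Covector.gen R' j) = ∑ a, Covector.gen R' a ⊗ₜ[k] u a j := by
  rw [coact, Covector.lift_gen]

theorem coact_coassoc (b : Covector R') :
    TensorProduct.assoc k _ H H (S.coact.toLinearMap.rTensor H (S.coact b)) =
      (comul (R := k) (A := H)).lTensor _ (S.coact b) := by
  have : (Algebra.TensorProduct.assoc k k k (Covector R') H H).toAlgHom.comp
      ((Algebra.TensorProduct.map S.coact (AlgHom.id k H)).comp S.coact) =
      (Algebra.TensorProduct.map (AlgHom.id k (Covector R')) (Bialgebra.comulAlgHom k H)).comp S.coact := by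
    refine Covector.algHom_ext (Q := Covector R' ⊗[k] (H ⊗[k] H)) fun j => ?_
    simp [TensorProduct.sum_tmul, TensorProduct.tmul_sum, S.comatrix.comul_eq]
    exact Finset.sum_comm
  exact DFunLike.congr_fun this b

theorem coact_counit (b : Covector R') :
    TensorProduct.rid k _ ((counit (R := k) (A := H)).lTensor _ (S.coact b)) = b := by
  have : (Algebra.TensorProduct.rid k k (Covector R')).toAlgHom.comp
      ((Algebra.TensorProduct.map (AlgHom.id k (Covector R')) (Bialgebra.counitAlgHom k H)).comp S.coact) =
      AlgHom.id k (Covector R') := by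
    refine Covector.algHom_ext fun j => ?_
    simp [S.comatrix.counit_eq, Matrix.one_apply]
  exact DFunLike.congr_fun this b

/-- The right action of `H` on the braided covectors. -/
def moduleAlgebra : RightModuleAlgebra k H (Covector R') :=
  RightModuleAlgebra.ofCoaction S.dual S.coact S.coact_coassoc S.coact_counit

theorem act_gen (j : ι) (h : H) :
    S.moduleAlgebra.act (Covector.gen R' j) h = ∑ a, r (u a j) h • Covector.gen R' a :=
  rightAction_of_isSubcomodule r (β := S.coact.toLinearMap) (w := Covector.gen R') (c := u)
    (S.coact_gen) j h

/-- The semidirect product of the braided covectors and `H`. -/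
abbrev Semidirect : Type _ := Smash S.moduleAlgebra

variable {Q : Type*} [Ring Q] [Algebra k Q]

/-- The cross relations `x h = h₁ (x ◁ h₂)` of the semidirect product, imposed on a row `x` and an
algebra map from `H`. -/
def CrossRow (_ : IsCovectorSymmetry R R' r u) (x : ι → Q) (g : H →ₐ[k] Q) : Prop :=
  ∀ (n : ℕ) (c : Matrix (Fin n) (Fin n) H), IsComatrix k c → ∀ a i j,
    x a * g (c i j) = ∑ l, ∑ b, r (u b a) (c l j) • (g (c i l) * x b)

theorem cross_of_crossRow {f : Covector R' →ₐ[k] Q} {g : H →ₐ[k] Q}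
    (h : S.CrossRow (fun j => f (Covector.gen R' j)) g) (n : ℕ) (c : Matrix (Fin n) (Fin n) H)
    (hc : IsComatrix k c) (b : Covector R') (i j : Fin n) :
    f b * g (c i j) = ∑ l, g (c i l) * f (S.moduleAlgebra.act b (c l j)) := by
  induction b using Covector.induction generalizing i j with
  | one =>
    simp [S.moduleAlgebra.act_one, hc.counit_eq, Matrix.one_apply, apply_ite, ite_smul]
  | gen a =>
    rw [h n c hc]
    simp [S.act_gen, Finset.mul_sum]
  | add x y hx hy => simp only [map_add, add_mul, hx, hy, LinearMap.add_apply, mul_add,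
      Finset.sum_add_distrib]
  | smul a x hx => simp only [map_smul, smul_mul_assoc, hx, LinearMap.smul_apply, mul_smul_comm,
      Finset.smul_sum]
  | mul x y hx hy =>
    rw [map_mul, mul_assoc, hy]
    simp only [Finset.mul_sum, ← mul_assoc, hx, Finset.sum_mul,
      S.moduleAlgebra.act_mul_comatrix hc, map_sum, map_mul]
    exact Finset.sum_comm

/-- The algebra map from the semidirect product given by a covector row and an algebra map from `H`
that satisfy the cross relations. -/
def lift {x : ι → Q} (hx : IsCovectorRow R' x) (g : H →ₐ[k] Q) (h : S.CrossRow x g) :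
    S.Semidirect →ₐ[k] Q :=
  Smash.lift (Covector.lift hx) g fun n c hc b i j =>
    S.cross_of_crossRow (f := Covector.lift hx) (g := g) (by simpa using h) n c hc b i j

/-- The inclusion of the braided covectors in the semidirect product. -/
def inl : Covector R' →ₐ[k] S.Semidirect := Smash.inl S.moduleAlgebra

/-- The inclusion of `H` in the semidirect product. -/
def inr : H →ₐ[k] S.Semidirect := Smash.inr S.moduleAlgebra

/-- The generators of the braided covectors, in the semidirect product. -/
def p (j : ι) : S.Semidirect := S.inl (Covector.gen R' j)

@[simp] theorem lift_p {x : ι → Q} (hx : IsCovectorRow R' x) (g : H →ₐ[k] Q) (h : S.CrossRow x g)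
    (j : ι) : S.lift hx g h (S.p j) = x j := by
  rw [lift, p, inl, Smash.lift_inl, Covector.lift_gen]

@[simp] theorem lift_inr {x : ι → Q} (hx : IsCovectorRow R' x) (g : H →ₐ[k] Q)
    (h : S.CrossRow x g) (a : H) : S.lift hx g h (S.inr a) = g a := by
  rw [lift, inr, Smash.lift_inr]

theorem algHom_ext {F G : S.Semidirect →ₐ[k] Q} (hp : ∀ j, F (S.p j) = G (S.p j))
    (hr : ∀ h, F (S.inr h) = G (S.inr h)) : F = G := by
  refine Smash.algHom_ext (fun b => ?_) hr
  have : F.comp S.inl = G.comp S.inl := Covector.algHom_ext hp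
  exact DFunLike.congr_fun this b

theorem isCovectorRow_p : IsCovectorRow R' S.p := (Covector.isCovectorRow_gen R').map S.inl

theorem p_mul_inr {κ : Type*} [Fintype κ] [DecidableEq κ] {c : Matrix κ κ H} (hc : IsComatrix k c)
    (a : ι) (i j : κ) :
    S.p a * S.inr (c i j) = ∑ l, ∑ b, r (u b a) (c l j) • (S.inr (c i l) * S.p b) := by
  have := Smash.inl_mul_inr S.moduleAlgebra hc (Covector.gen R' a) i j
  refine this.trans (Finset.sum_congr rfl fun l _ => ?_)
  rw [S.act_gen, map_sum, Finset.mul_sum]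
  exact Finset.sum_congr rfl fun b _ => by rw [map_smul, mul_smul_comm]; rfl

theorem p_mul_inr_u (a i j : ι) :
    S.p a * S.inr (u i j) = ∑ l, ∑ b, R (b, l) (a, j) • (S.inr (u i l) * S.p b) := by
  rw [S.p_mul_inr S.comatrix]
  simp only [S.form]

end IsCovectorSymmetry
end CovectorBosonization

section AntipodeAxiom

variable {k : Type*} [Field k] {P : Type*} [Ring P] [Algebra k P]

theorem mul_antihom_rTensor_mul (s : P →ₐ[k] Pᵐᵒᵖ) {z : P ⊗[k] P} {e : k}
    (hz : LinearMap.mul' k P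
      (((MulOpposite.opLinearEquiv k).symm.toLinearMap ∘ₗ s.toLinearMap).rTensor P z) =
        algebraMap k P e) (w : P ⊗[k] P) :
    LinearMap.mul' k P
      (((MulOpposite.opLinearEquiv k).symm.toLinearMap ∘ₗ s.toLinearMap).rTensor P (z * w)) =
      e • LinearMap.mul' k P
        (((MulOpposite.opLinearEquiv k).symm.toLinearMap ∘ₗ s.toLinearMap).rTensor P w) := by
  induction w with
  | zero => simp
  | add x y hx hy => simp only [mul_add, map_add, hx, hy, smul_add]
  | tmul a b =>
    have : ∀ z : P ⊗[k] P, LinearMap.mul' k P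
        (((MulOpposite.opLinearEquiv k).symm.toLinearMap ∘ₗ s.toLinearMap).rTensor P
          (z * a ⊗ₜ[k] b)) = (s a).unop * LinearMap.mul' k P
        (((MulOpposite.opLinearEquiv k).symm.toLinearMap ∘ₗ s.toLinearMap).rTensor P z) * b := by
      intro z
      induction z with
      | zero => simp
      | add x y hx hy => simp only [add_mul, mul_add, map_add, hx, hy]
      | tmul x y => simp [mul_assoc]
    rw [this, hz, ← Algebra.commutes, mul_assoc, ← Algebra.smul_def]
    simp

theorem mul_antihom_lTensor_mul (s : P →ₐ[k] Pᵐᵒᵖ) {w : P ⊗[k] P} {e : k}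
    (hw : LinearMap.mul' k P
      (((MulOpposite.opLinearEquiv k).symm.toLinearMap ∘ₗ s.toLinearMap).lTensor P w) =
        algebraMap k P e) (z : P ⊗[k] P) :
    LinearMap.mul' k P
      (((MulOpposite.opLinearEquiv k).symm.toLinearMap ∘ₗ s.toLinearMap).lTensor P (z * w)) =
      e • LinearMap.mul' k P
        (((MulOpposite.opLinearEquiv k).symm.toLinearMap ∘ₗ s.toLinearMap).lTensor P z) := by
  induction z with
  | zero => simp
  | add x y hx hy => simp only [add_mul, map_add, hx, hy, smul_add]
  | tmul a b =>
    have : ∀ w : P ⊗[k] P, LinearMap.mul' k P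
        (((MulOpposite.opLinearEquiv k).symm.toLinearMap ∘ₗ s.toLinearMap).lTensor P
          (a ⊗ₜ[k] b * w)) = a * LinearMap.mul' k P
        (((MulOpposite.opLinearEquiv k).symm.toLinearMap ∘ₗ s.toLinearMap).lTensor P w) *
          (s b).unop := by
      intro z
      induction z with
      | zero => simp
      | add x y hx hy => simp only [add_mul, mul_add, map_add, hx, hy]
      | tmul x y => simp [mul_assoc]
    rw [this, hw, ← Algebra.commutes, mul_assoc, ← Algebra.smul_def]
    simp

end AntipodeAxiom

section AntipodeOfAntihom

variable {k : Type*} [Field k] {P : Type*} [Ring P] [Bialgebra k P]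

/-- The elements on which an antihomomorphism satisfies the axioms of an antipode. -/
def antipodeSubalgebra (s : P →ₐ[k] Pᵐᵒᵖ) : Subalgebra k P where
  carrier := {x | LinearMap.mul' k P (((MulOpposite.opLinearEquiv k).symm.toLinearMap ∘ₗ
      s.toLinearMap).rTensor P (comul (R := k) x)) = algebraMap k P (counit (R := k) x) ∧
    LinearMap.mul' k P (((MulOpposite.opLinearEquiv k).symm.toLinearMap ∘ₗ
      s.toLinearMap).lTensor P (comul (R := k) x)) = algebraMap k P (counit (R := k) x)}
  mul_mem' {x y} hx hy := by
    refine ⟨?_, ?_⟩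
    · rw [Bialgebra.comul_mul, mul_antihom_rTensor_mul s hx.1, hy.1, Bialgebra.counit_mul, map_mul,
        Algebra.smul_def]
    · rw [Bialgebra.comul_mul, mul_antihom_lTensor_mul s hy.2, hx.2, Bialgebra.counit_mul, mul_comm,
        map_mul, Algebra.smul_def]
  add_mem' {x y} hx hy := ⟨by simp only [map_add, hx.1, hy.1], by simp only [map_add, hx.2, hy.2]⟩
  algebraMap_mem' a := by
    constructor <;> simp [Algebra.TensorProduct.algebraMap_apply]

/-- A bialgebra with an antihomomorphism that satisfies the axioms of an antipode on generators is
a Hopf algebra. -/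
abbrev hopfAlgebraOfAntihom (s : P →ₐ[k] Pᵐᵒᵖ) (h : antipodeSubalgebra s = ⊤) :
    HopfAlgebra k P where
  antipode := (MulOpposite.opLinearEquiv k).symm.toLinearMap ∘ₗ s.toLinearMap
  mul_antipode_rTensor_comul := LinearMap.ext fun x =>
    (h.ge (Algebra.mem_top (x := x)) : x ∈ antipodeSubalgebra s).1
  mul_antipode_lTensor_comul := LinearMap.ext fun x =>
    (h.ge (Algebra.mem_top (x := x)) : x ∈ antipodeSubalgebra s).2

end AntipodeOfAntihom

section SumRotation

variable {M : Type*} [AddCommMonoid M] {α β γ δ : Type*} [Fintype α] [Fintype β] [Fintype γ]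
  [Fintype δ]

theorem sum_rotate₃ (f : α → β → γ → M) :
    ∑ a, ∑ b, ∑ c, f a b c = ∑ c, ∑ a, ∑ b, f a b c := by
  rw [Finset.sum_congr rfl fun a _ => Finset.sum_comm, Finset.sum_comm]

theorem sum_rotate₄ (f : α → β → γ → δ → M) :
    ∑ a, ∑ b, ∑ c, ∑ d, f a b c d = ∑ d, ∑ a, ∑ b, ∑ c, f a b c d := by
  rw [Finset.sum_congr rfl fun a _ => sum_rotate₃ _, Finset.sum_comm]

end SumRotation

section CovectorBosonization

variable {k : Type*} [Field k] {ι : Type*} [Fintype ι] [DecidableEq ι]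
  {H : Type*} [Ring H] [HopfAlgebra k H]
  {R R' : Matrix (ι × ι) (ι × ι) k} {r : LinearMap.BilinForm k H} {u : Matrix ι ι H}

theorem vecMul_braid_apply {Q : Type*} [Ring Q] [Algebra k Q] (M : Matrix (ι × ι) (ι × ι) k)
    (F : ι × ι → Q) (j l : ι) :
    Matrix.vecMul F (braid Q M) (j, l) = ∑ a, ∑ c, M (a, c) (j, l) • F (c, a) := by
  simp only [Matrix.vecMul, dotProduct, Fintype.sum_prod_type, braid_apply, Algebra.smul_def]
  rw [Finset.sum_comm]
  exact Finset.sum_congr rfl fun _ _ => Finset.sum_congr rfl fun _ _ =>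
    (Algebra.commutes _ _).symm

namespace IsCovectorSymmetry

variable (S : IsCovectorSymmetry R R' r u)
include S

/-- The coproducts of the generators of the braided covectors. -/
def comulRow (j : ι) : S.Semidirect ⊗[k] S.Semidirect :=
  ∑ a, S.p a ⊗ₜ[k] S.inr (u a j) + 1 ⊗ₜ[k] S.p j

theorem isCovectorRow_coaction {Q : Type*} [Ring Q] [Algebra k Q] {x : ι → Q}
    (hx : IsCovectorRow R' x) :
    IsCovectorRow R' fun j => ∑ a, x a ⊗ₜ[k] S.inr (u a j) + (1 : Q) ⊗ₜ[k] S.p j := by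
  have h1 := hx.map (Q' := Q ⊗[k] S.Semidirect) Algebra.TensorProduct.includeLeft
  have h2 := (S.exchange.map S.inr).map (Q' := Q ⊗[k] S.Semidirect)
    Algebra.TensorProduct.includeRight
  have h3 := h1.mul_matrix h2 fun i j l => by simp
  have h4 := S.isCovectorRow_p.map (Q' := Q ⊗[k] S.Semidirect)
    Algebra.TensorProduct.includeRight
  have h5 := h3.add S.pair h4 (by
    ext ⟨j, l⟩
    rw [vecMul_braid_apply]
    simp only [rowMul, Algebra.TensorProduct.includeLeft_apply, Matrix.map_apply,
      Algebra.TensorProduct.includeRight_apply, Algebra.TensorProduct.tmul_mul_tmul, one_mul,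
      mul_one, Finset.mul_sum, Finset.sum_mul, S.p_mul_inr_u, TensorProduct.tmul_sum,
      Finset.smul_sum, TensorProduct.tmul_smul]
    rw [sum_rotate₃]
    exact Finset.sum_congr rfl fun _ _ => Finset.sum_comm)
  simpa [Pi.add_def] using! h5

theorem isCovectorRow_comulRow : IsCovectorRow R' S.comulRow :=
  S.isCovectorRow_coaction S.isCovectorRow_p

theorem quasicomm_u {κ : Type*} [Fintype κ] [DecidableEq κ] {c : Matrix κ κ H}
    (hc : IsComatrix k c) (e a : ι) (p l : κ) :
    ∑ q, ∑ m, r (u q a) (c m l) • (c p m * u e q) =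
      ∑ q, ∑ m, r (u e q) (c p m) • (u q a * c m l) :=
  S.dual.quasicomm_comatrix S.comatrix hc e a p l

theorem crossRow_comulRow : S.CrossRow S.comulRow
    ((Algebra.TensorProduct.map S.inr S.inr).comp (Bialgebra.comulAlgHom k H)) := by
  intro n c hc a i j
  have hG : ∀ i j, ((Algebra.TensorProduct.map S.inr S.inr).comp (Bialgebra.comulAlgHom k H))
      (c i j) = ∑ l, S.inr (c i l) ⊗ₜ[k] S.inr (c l j) := fun i j => by
    simp [hc.comul_eq]
  simp only [hG, comulRow, add_mul, mul_add, Finset.sum_add_distrib, smul_add]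
  congr 1
  · have h1 : ∀ e l, (∑ q, ∑ m, r (u e q) (c l m) • (S.inr (u q a) * S.inr (c m j))) =
        ∑ q, ∑ m, r (u q a) (c m j) • (S.inr (c l m) * S.inr (u e q)) := fun e l => by
      have := congrArg S.inr (S.quasicomm_u hc e a l j).symm
      simpa using this
    trans ∑ e, ∑ l, (S.inr (c i l) * S.p e) ⊗ₜ[k]
        ∑ q, ∑ m, r (u e q) (c l m) • (S.inr (u q a) * S.inr (c m j))
    · simp only [Finset.sum_mul, Finset.mul_sum, Algebra.TensorProduct.tmul_mul_tmul,
        S.p_mul_inr hc, TensorProduct.sum_tmul, TensorProduct.tmul_sum]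
      simp only [← TensorProduct.smul_tmul', TensorProduct.tmul_smul]
      rw [sum_rotate₄]
      refine Finset.sum_congr rfl fun _ _ => ?_
      rw [sum_rotate₃]
      exact Finset.sum_congr rfl fun _ _ => Finset.sum_comm
    · simp only [h1, Finset.sum_mul, Finset.mul_sum, Algebra.TensorProduct.tmul_mul_tmul,
        TensorProduct.tmul_sum, TensorProduct.tmul_smul, Finset.smul_sum]
      rw [sum_rotate₄]
      exact Finset.sum_congr rfl fun _ _ => sum_rotate₃ _
  · simp only [Finset.sum_mul, Finset.mul_sum, Algebra.TensorProduct.tmul_mul_tmul, one_mul, mul_one,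
      S.p_mul_inr hc, TensorProduct.tmul_sum, TensorProduct.tmul_smul, Finset.smul_sum]
    exact (sum_rotate₃ _).symm

/-- The coproduct of the semidirect product. -/
def comulHom : S.Semidirect →ₐ[k] S.Semidirect ⊗[k] S.Semidirect :=
  S.lift S.isCovectorRow_comulRow _ S.crossRow_comulRow

theorem comulHom_p (j : ι) :
    S.comulHom (S.p j) = ∑ a, S.p a ⊗ₜ[k] S.inr (u a j) + 1 ⊗ₜ[k] S.p j := S.lift_p _ _ _ j

theorem comulHom_inr (h : H) :
    S.comulHom (S.inr h) = TensorProduct.map S.inr.toLinearMap S.inr.toLinearMap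
      (comul (R := k) h) := S.lift_inr _ _ _ h

theorem comulHom_inr_comatrix {κ : Type*} [Fintype κ] [DecidableEq κ] {c : Matrix κ κ H}
    (hc : IsComatrix k c) (i j : κ) :
    S.comulHom (S.inr (c i j)) = ∑ l, S.inr (c i l) ⊗ₜ[k] S.inr (c l j) := by
  rw [comulHom_inr, hc.comul_eq]
  simp

/-- The counit of the semidirect product. -/
def counitHom : S.Semidirect →ₐ[k] k :=
  S.lift (x := fun _ => 0) (isCovectorRow_iff.mpr fun _ _ => by simp) (Bialgebra.counitAlgHom k H)
    fun n c hc a i j => by simp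

@[simp] theorem counitHom_p (j : ι) : S.counitHom (S.p j) = 0 := S.lift_p _ _ _ j

@[simp] theorem counitHom_inr (h : H) : S.counitHom (S.inr h) = counit (R := k) h :=
  S.lift_inr _ _ _ h

theorem algHom_ext_comatrix {Q : Type*} [Ring Q] [Algebra k Q] {F G : S.Semidirect →ₐ[k] Q}
    (hp : ∀ j, F (S.p j) = G (S.p j))
    (hr : ∀ (n : ℕ) (c : Matrix (Fin n) (Fin n) H), IsComatrix k c → ∀ i j,
      F (S.inr (c i j)) = G (S.inr (c i j))) : F = G := by
  refine S.algHom_ext hp fun h => ?_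
  have : F.toLinearMap ∘ₗ S.inr.toLinearMap = G.toLinearMap ∘ₗ S.inr.toLinearMap :=
    linearMap_ext_of_comatrix hr
  exact DFunLike.congr_fun this h

instance : Bialgebra k S.Semidirect :=
  Bialgebra.ofAlgHom S.comulHom S.counitHom
    (by
      refine S.algHom_ext_comatrix (Q := S.Semidirect ⊗[k] (S.Semidirect ⊗[k] S.Semidirect))
        (fun j => ?_) fun n c hc i j => ?_
      · simp [comulHom_p, S.comulHom_inr_comatrix S.comatrix, TensorProduct.sum_tmul,
          TensorProduct.tmul_sum, TensorProduct.add_tmul, TensorProduct.tmul_add,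
          Algebra.TensorProduct.one_def, Finset.sum_add_distrib, add_assoc]
        exact Finset.sum_comm
      · simp [S.comulHom_inr_comatrix hc, TensorProduct.sum_tmul, TensorProduct.tmul_sum]
        exact Finset.sum_comm)
    (by
      refine S.algHom_ext_comatrix (Q := k ⊗[k] S.Semidirect)
        (fun j => ?_) fun n c hc i j => ?_
      · simp [comulHom_p]
      · simp [S.comulHom_inr_comatrix hc, hc.counit_eq, Matrix.one_apply, TensorProduct.ite_tmul])
    (by
      refine S.algHom_ext_comatrix (Q := S.Semidirect ⊗[k] k)
        (fun j => ?_) fun n c hc i j => ?_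
      · simp [comulHom_p, S.comatrix.counit_eq, Matrix.one_apply, TensorProduct.tmul_ite]
      · simp [S.comulHom_inr_comatrix hc, hc.counit_eq, Matrix.one_apply, TensorProduct.tmul_ite])

theorem comul_def (x : S.Semidirect) : comul (R := k) x = S.comulHom x := rfl

theorem counit_def (x : S.Semidirect) : counit (R := k) x = S.counitHom x := rfl

theorem antipode_inr_mul_p {κ : Type*} [Fintype κ] [DecidableEq κ] {c : Matrix κ κ H}
    (hc : IsComatrix k c) (a : ι) (i j : κ) :
    S.inr (antipode k (c i j)) * S.p a =
      ∑ m, ∑ b, r (u b a) (c i m) • (S.p b * S.inr (antipode k (c m j))) := by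
  have h1 : ∀ l j, ∑ s, S.inr (c l s) * S.inr (antipode k (c s j)) =
      (1 : Matrix κ κ S.Semidirect) l j := fun l j => by
    have := congrArg S.inr (hc.sum_mul_antipode l j)
    simpa [Matrix.one_apply, apply_ite] using this
  have h2 : ∀ l j, ∑ s, S.inr (antipode k (c l s)) * S.inr (c s j) =
      (1 : Matrix κ κ S.Semidirect) l j := fun l j => by
    have := congrArg S.inr (hc.sum_antipode_mul l j)
    simpa [Matrix.one_apply, apply_ite] using this
  calc S.inr (antipode k (c i j)) * S.p a
      = ∑ l, S.inr (antipode k (c i l)) * S.p a * (1 : Matrix κ κ S.Semidirect) l j := by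
        simp [Matrix.one_apply]
    _ = ∑ s, ∑ l, S.inr (antipode k (c i l)) * (S.p a * S.inr (c l s)) *
          S.inr (antipode k (c s j)) := by
        simp only [← h1, Finset.mul_sum, mul_assoc]
        exact Finset.sum_comm
    _ = ∑ s, ∑ m, ∑ b, r (u b a) (c m s) • ((∑ l, S.inr (antipode k (c i l)) * S.inr (c l m)) *
          S.p b * S.inr (antipode k (c s j))) := by
        refine Finset.sum_congr rfl fun s _ => ?_
        simp only [S.p_mul_inr hc, Finset.mul_sum, Finset.sum_mul, Finset.smul_sum,
          mul_smul_comm, smul_mul_assoc, mul_assoc]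
        rw [sum_rotate₃, sum_rotate₃]
    _ = _ := by
        simp [h2, Matrix.one_apply, ite_mul]

/-- The images of the generators under the antipode, in the opposite algebra. -/
def antipodeRow (j : ι) : S.Semidirectᵐᵒᵖ :=
  MulOpposite.op (-∑ a, S.p a * S.inr (antipode k (u a j)))

theorem isCovectorRow_antipodeRow : IsCovectorRow R' S.antipodeRow := by
  let ψ : H →ₗ[k] S.Semidirect := S.inr.toLinearMap ∘ₗ antipode k
  let V : Matrix (ι × ι) (ι × ι) S.Semidirect := (matMul u u).map ψ
  let F : ι × ι → S.Semidirect := Matrix.vecMul (rowMul S.p S.p) (braid S.Semidirect R * V)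
  have hV : braid S.Semidirect R' * V = V * braid S.Semidirect R' := by
    have h := (exchange_iff R' u u).mp S.exchange
    ext ⟨m, n⟩ ⟨x, y⟩
    have h2 := congrArg (fun X => ψ (X (m, n) (x, y))) h
    simp only [Matrix.mul_apply, Fintype.sum_prod_type, map_sum, braid_apply] at h2
    simp only [V, Matrix.mul_apply, Fintype.sum_prod_type, braid_apply, Matrix.map_apply]
    have e1 : ∀ (a : k) (h : H), ψ (algebraMap k H a * h) = algebraMap k _ a * ψ h := fun a h => by
      rw [← Algebra.smul_def, map_smul, Algebra.smul_def]
    have e2 : ∀ (a : k) (h : H), ψ (h * algebraMap k H a) = ψ h * algebraMap k _ a := fun a h => by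
      rw [← Algebra.commutes, e1, Algebra.commutes]
    simp only [e1, e2] at h2
    exact h2
  have hF : Matrix.vecMul F (braid S.Semidirect R') = F := by
    simp only [F, Matrix.vecMul_vecMul]
    rw [mul_assoc, ← hV, ← mul_assoc, S.pair.braid_commute, mul_assoc, ← Matrix.vecMul_vecMul,
      S.isCovectorRow_p]
  have key : ∀ j l, S.antipodeRow j * S.antipodeRow l = MulOpposite.op (F (j, l)) := by
    intro j l
    rw [antipodeRow, antipodeRow, ← MulOpposite.op_mul, neg_mul_neg]
    congr 1
    have hψ : ∀ a b c d, ψ (matMul u u (a, b) (c, d)) =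
        S.inr (antipode k (u b d)) * S.inr (antipode k (u a c)) := fun a b c d => by
      rw [matMul, ← map_mul, ← HopfAlgebra.antipode_mul_antidistrib]
      rfl
    rw [Finset.sum_mul_sum]
    simp only [F, Matrix.vecMul, dotProduct, Matrix.mul_apply, Fintype.sum_prod_type, braid_apply,
      rowMul, V, Matrix.map_apply, hψ, Finset.mul_sum]
    have : ∀ a b, S.p a * S.inr (antipode k (u a l)) * (S.p b * S.inr (antipode k (u b j))) =
        ∑ m, ∑ c, R (c, a) (b, m) • (S.p a * S.p c * (S.inr (antipode k (u m l)) *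
          S.inr (antipode k (u b j)))) := fun a b => by
      rw [mul_assoc, ← mul_assoc _ (S.p b), S.antipode_inr_mul_p S.comatrix]
      simp only [S.form, Finset.sum_mul, Finset.mul_sum, smul_mul_assoc, mul_smul_comm, mul_assoc]
    simp only [this]
    refine Finset.sum_congr rfl fun a _ => ?_
    rw [sum_rotate₃]
    refine Finset.sum_congr rfl fun c _ => Finset.sum_congr rfl fun b _ =>
      Finset.sum_congr rfl fun m _ => ?_
    rw [← Algebra.smul_def, mul_smul_comm]
  rw [isCovectorRow_iff]
  intro j l
  simp only [key]
  rw [← hF, vecMul_braid_apply, hF]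
  simp

theorem crossRow_antipodeRow : S.CrossRow S.antipodeRow
    ((AlgHom.op S.inr).comp (HopfAlgebra.antipodeAlgHomOp k H)) := by
  intro n c hc a i j
  have hg : ∀ h, ((AlgHom.op S.inr).comp (HopfAlgebra.antipodeAlgHomOp k H)) h =
      MulOpposite.op (S.inr (antipode k h)) := fun h => rfl
  simp only [hg, antipodeRow, ← MulOpposite.op_mul, ← MulOpposite.op_smul, ← Finset.op_sum]
  congr 1
  have h1 : ∀ e, ∑ q, ∑ m, r (u e q) (c i m) • (S.inr (antipode k (c m j)) *
      S.inr (antipode k (u q a))) = ∑ q, ∑ m, r (u q a) (c m j) • (S.inr (antipode k (u e q)) *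
      S.inr (antipode k (c i m))) := fun e => by
    have := congrArg (fun x => S.inr (antipode k x)) (S.quasicomm_u hc e a i j).symm
    simpa [HopfAlgebra.antipode_mul_antidistrib] using this
  trans -∑ e, S.p e * ∑ q, ∑ m, r (u e q) (c i m) • (S.inr (antipode k (c m j)) *
      S.inr (antipode k (u q a)))
  · simp only [mul_neg, Finset.mul_sum, ← mul_assoc, S.antipode_inr_mul_p hc, Finset.sum_mul,
      smul_mul_assoc, mul_smul_comm]
    rw [sum_rotate₃]
  · simp only [h1, neg_mul, Finset.sum_mul, Finset.mul_sum, mul_smul_comm, smul_neg,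
      Finset.smul_sum, mul_assoc, Finset.sum_neg_distrib]
    rw [sum_rotate₃]
    exact congrArg _ (Finset.sum_congr rfl fun _ _ => Finset.sum_comm)

/-- The antipode of the semidirect product, as a map to the opposite algebra. -/
def antipodeHom : S.Semidirect →ₐ[k] S.Semidirectᵐᵒᵖ :=
  S.lift S.isCovectorRow_antipodeRow _ S.crossRow_antipodeRow

theorem antipodeHom_p (j : ι) :
    (S.antipodeHom (S.p j)).unop = -∑ a, S.p a * S.inr (antipode k (u a j)) :=
  congrArg MulOpposite.unop (S.lift_p _ _ _ j)

theorem antipodeHom_inr (h : H) :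
    (S.antipodeHom (S.inr h)).unop = S.inr (antipode k h) :=
  congrArg MulOpposite.unop (S.lift_inr _ _ _ h)

theorem subalgebra_eq_top (T : Subalgebra k S.Semidirect) (hp : ∀ j, S.p j ∈ T)
    (hr : ∀ (n : ℕ) (c : Matrix (Fin n) (Fin n) H), IsComatrix k c → ∀ i j, S.inr (c i j) ∈ T) :
    T = ⊤ := by
  refine eq_top_iff.mpr fun x hx => ?_
  clear hx
  induction x using Smash.induction with
  | zero => exact T.zero_mem
  | add x y hx hy => exact T.add_mem hx hy
  | mk h b =>
    rw [← Smash.inr_mul_inl]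
    refine T.mul_mem ?_ ?_
    · induction h using (@comatrix_induction k _ H _ _ _) with
      | add x y hx hy => rw [map_add]; exact T.add_mem hx hy
      | smul a x hx => rw [map_smul]; exact T.smul_mem hx a
      | zero => rw [map_zero]; exact T.zero_mem
      | base n c hc i j => exact hr n c hc i j
    · induction b using Covector.induction with
      | one => rw [map_one]; exact T.one_mem
      | gen j => exact hp j
      | add x y hx hy => rw [map_add]; exact T.add_mem hx hy
      | smul a x hx => rw [map_smul]; exact T.smul_mem hx a
      | mul x y hx hy => rw [map_mul]; exact T.mul_mem hx hy

theorem antipodeSubalgebra_eq_top : antipodeSubalgebra S.antipodeHom = ⊤ := by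
  refine S.subalgebra_eq_top _ (fun j => ⟨?_, ?_⟩) fun n c hc i j => ⟨?_, ?_⟩
  · have h : ∀ b, ∑ a, S.inr (antipode k (u b a)) * S.inr (u a j) =
        (1 : Matrix ι ι S.Semidirect) b j := fun b => by
      have := congrArg S.inr (S.comatrix.sum_antipode_mul b j)
      simpa [Matrix.one_apply, apply_ite] using this
    rw [comul_def, counit_def, comulHom_p, counitHom_p]
    simp only [map_add, map_sum, LinearMap.rTensor_tmul, LinearMap.mul'_apply, LinearMap.comp_apply,
      AlgHom.toLinearMap_apply, LinearEquiv.coe_coe, MulOpposite.coe_opLinearEquiv_symm,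
      antipodeHom_p, neg_mul, Finset.sum_mul, Finset.sum_neg_distrib, map_one, mul_assoc, map_zero]
    rw [Finset.sum_comm]
    simp [← Finset.mul_sum, h, Matrix.one_apply]
  · rw [comul_def, counit_def, comulHom_p, counitHom_p]
    simp [antipodeHom_p, antipodeHom_inr]
  · have h := congrArg S.inr (hc.sum_antipode_mul i j)
    rw [comul_def, counit_def, S.comulHom_inr_comatrix hc, counitHom_inr]
    simp only [map_sum, map_mul] at h
    simp only [map_sum, LinearMap.rTensor_tmul, LinearMap.mul'_apply,
      LinearMap.comp_apply, AlgHom.toLinearMap_apply, LinearEquiv.coe_coe,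
      MulOpposite.coe_opLinearEquiv_symm, antipodeHom_inr, h, hc.counit_eq, Matrix.one_apply]
    split_ifs <;> simp
  · have h := congrArg S.inr (hc.sum_mul_antipode i j)
    rw [comul_def, counit_def, S.comulHom_inr_comatrix hc, counitHom_inr]
    simp only [map_sum, map_mul] at h
    simp only [map_sum, LinearMap.lTensor_tmul, LinearMap.mul'_apply,
      LinearMap.comp_apply, AlgHom.toLinearMap_apply, LinearEquiv.coe_coe,
      MulOpposite.coe_opLinearEquiv_symm, antipodeHom_inr, h, hc.counit_eq, Matrix.one_apply]
    split_ifs <;> simp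

instance : HopfAlgebra k S.Semidirect :=
  hopfAlgebraOfAntihom S.antipodeHom S.antipodeSubalgebra_eq_top

theorem antipode_p (j : ι) :
    antipode k (S.p j) = -∑ a, S.p a * S.inr (antipode k (u a j)) := S.antipodeHom_p j

theorem comul_p (j : ι) : comul (R := k) (S.p j) =
    ∑ a, S.p a ⊗ₜ[k] S.inr (u a j) + 1 ⊗ₜ[k] S.p j := S.comulHom_p j

theorem counit_p (j : ι) : counit (R := k) (S.p j) = 0 := S.counitHom_p j

/-- The inclusion of `H` in the semidirect product, as a map of bialgebras. -/
def inrBialgHom : H →ₐc[k] S.Semidirect :=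
  BialgHom.ofAlgHom S.inr
    (AlgHom.ext fun h => S.counitHom_inr h)
    (AlgHom.ext fun h => (S.comulHom_inr h).symm)

end IsCovectorSymmetry
end CovectorBosonization

section BraidedStructure

variable {k : Type*} [Field k] {ι : Type*} [Fintype ι] [DecidableEq ι]
  {H : Type*} [Ring H] [HopfAlgebra k H]
  {R R' : Matrix (ι × ι) (ι × ι) k} {r : LinearMap.BilinForm k H} {u : Matrix ι ι H}

theorem Covector.induction_mul_gen {p : Covector R' → Prop} (one : p 1)
    (add : ∀ x y, p x → p y → p (x + y)) (smul : ∀ (a : k) x, p x → p (a • x))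
    (mul_gen : ∀ x j, p x → p (x * Covector.gen R' j)) (b : Covector R') : p b := by
  have key : ∀ c x, p x → p (x * c) := fun c => by
    induction c using Covector.induction with
    | one => intro x hx; rwa [mul_one]
    | gen j => exact fun x hx => mul_gen x j hx
    | add c d hc hd => intro x hx; rw [mul_add]; exact add _ _ (hc x hx) (hd x hx)
    | smul a c hc => intro x hx; rw [mul_smul_comm]; exact smul _ _ (hc x hx)
    | mul c d hc hd => intro x hx; rw [← mul_assoc]; exact hd _ (hc x hx)
  simpa using key b 1 one

namespace IsCovectorSymmetry

variable (S : IsCovectorSymmetry R R' r u)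
include S

/-- The projection of the semidirect product to the braided covectors. -/
def proj : S.Semidirect →ₗ[k] Covector R' :=
  (TensorProduct.lid k (Covector R')).toLinearMap ∘ₗ
    ((counit (R := k) (A := H)).rTensor (Covector R') : H ⊗[k] Covector R' →ₗ[k] _)

theorem proj_mk (h : H) (b : Covector R') :
    S.proj (Smash.mk _ h b) = counit (R := k) h • b := rfl

theorem mk_eq (h : H) (b : Covector R') :
    Smash.mk S.moduleAlgebra h b = S.inr h * S.inl b := (Smash.inr_mul_inl _ h b).symm

theorem proj_inr_mul (h : H) (x : S.Semidirect) :
    S.proj (S.inr h * x) = counit (R := k) h • S.proj x := by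
  induction x using Smash.induction with
  | zero => simp
  | add x y hx hy => rw [mul_add, map_add, hx, hy, map_add, smul_add]
  | mk g b =>
    have : S.inr h * Smash.mk _ g b = Smash.mk _ (h * g) b := Smash.mk_one_mul_mk h g b
    rw [this, proj_mk, proj_mk, Bialgebra.counit_mul, mul_smul]

theorem proj_mul_inl (x : S.Semidirect) (b : Covector R') :
    S.proj (x * S.inl b) = S.proj x * b := by
  induction x using Smash.induction with
  | zero => simp
  | add x y hx hy => rw [add_mul, map_add, hx, hy, map_add, add_mul]
  | mk g c =>
    have : Smash.mk _ g c * S.inl b = Smash.mk _ g (c * b) := Smash.mk_mul_mk_one g c b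
    rw [this, proj_mk, proj_mk, smul_mul_assoc]

@[simp] theorem proj_inl (b : Covector R') : S.proj (S.inl b) = b := by
  have : S.inl b = Smash.mk S.moduleAlgebra 1 b := rfl
  rw [this, proj_mk, Bialgebra.counit_one, one_smul]

theorem proj_one : S.proj 1 = 1 := by
  rw [← map_one S.inl, proj_inl]

theorem inl_injective : Function.Injective S.inl := Function.LeftInverse.injective S.proj_inl

/-- The projection of the semidirect product to `H`. -/
def toH : S.Semidirect →ₐ[k] H :=
  S.lift (x := fun _ => 0) (isCovectorRow_iff.mpr fun _ _ => by simp) (AlgHom.id k H)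
    fun n c hc a i j => by simp

@[simp] theorem toH_p (j : ι) : S.toH (S.p j) = 0 := S.lift_p _ _ _ j

@[simp] theorem toH_inr (h : H) : S.toH (S.inr h) = h := S.lift_inr _ _ _ h

theorem inr_injective : Function.Injective S.inr := Function.LeftInverse.injective S.toH_inr

/-- The braided counit. -/
def cou (_ : IsCovectorSymmetry R R' r u) : Covector R' →ₐ[k] k :=
  Covector.lift (x := fun _ => 0) (isCovectorRow_iff.mpr fun _ _ => by simp)

@[simp] theorem cou_gen (j : ι) : S.cou (Covector.gen R' j) = 0 := Covector.lift_gen _ j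

theorem counitHom_inl (b : Covector R') : counit (R := k) (S.inl b) = S.cou b := by
  have : S.counitHom.comp S.inl = S.cou := Covector.algHom_ext fun j => by
    rw [cou_gen]; exact S.counitHom_p j
  exact DFunLike.congr_fun this b

theorem toH_inl (b : Covector R') : S.toH (S.inl b) = algebraMap k H (S.cou b) := by
  have : S.toH.comp S.inl = (Algebra.ofId k H).comp S.cou := Covector.algHom_ext fun j => by
    rw [AlgHom.comp_apply, AlgHom.comp_apply, cou_gen, map_zero]; exact S.toH_p j
  exact DFunLike.congr_fun this b

theorem isCovectorRow_halfComul :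
    IsCovectorRow R' fun j => ∑ a, Covector.gen R' a ⊗ₜ[k] S.inr (u a j) +
      (1 : Covector R') ⊗ₜ[k] S.p j :=
  S.isCovectorRow_coaction (Covector.isCovectorRow_gen R')

/-- The coproduct of the semidirect product, restricted to the braided covectors; its first leg
stays in the braided covectors. -/
def halfComul : Covector R' →ₐ[k] Covector R' ⊗[k] S.Semidirect :=
  Covector.lift S.isCovectorRow_halfComul

theorem halfComul_gen (j : ι) : S.halfComul (Covector.gen R' j) =
    ∑ a, Covector.gen R' a ⊗ₜ[k] S.inr (u a j) + (1 : Covector R') ⊗ₜ[k] S.p j :=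
  Covector.lift_gen _ j

theorem comul_inl (b : Covector R') :
    comul (R := k) (S.inl b) = S.inl.toLinearMap.rTensor S.Semidirect (S.halfComul b) := by
  have : S.comulHom.comp S.inl =
      (Algebra.TensorProduct.map S.inl (AlgHom.id k S.Semidirect)).comp S.halfComul := by
    refine Covector.algHom_ext (Q := S.Semidirect ⊗[k] S.Semidirect) fun j => ?_
    rw [AlgHom.comp_apply, AlgHom.comp_apply, halfComul_gen]
    refine (S.comul_p j).trans ?_
    simp [p]
  exact DFunLike.congr_fun this b

theorem lTensor_toH_halfComul (b : Covector R') :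
    S.toH.toLinearMap.lTensor (Covector R') (S.halfComul b) = S.coact b := by
  have : (Algebra.TensorProduct.map (AlgHom.id k (Covector R')) S.toH).comp S.halfComul =
      S.coact := by
    refine Covector.algHom_ext (Q := Covector R' ⊗[k] H) fun j => ?_
    rw [AlgHom.comp_apply, halfComul_gen, coact_gen]
    simp
  exact DFunLike.congr_fun this b

theorem rTensor_halfComul_halfComul (b : Covector R') :
    TensorProduct.assoc k (Covector R') S.Semidirect S.Semidirect
        (S.halfComul.toLinearMap.rTensor S.Semidirect (S.halfComul b)) =
      (comul (R := k) (A := S.Semidirect)).lTensor (Covector R') (S.halfComul b) := by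
  have : (Algebra.TensorProduct.assoc k k k (Covector R') S.Semidirect S.Semidirect).toAlgHom.comp
      ((Algebra.TensorProduct.map S.halfComul (AlgHom.id k S.Semidirect)).comp S.halfComul) =
      (Algebra.TensorProduct.map (AlgHom.id k (Covector R'))
        (Bialgebra.comulAlgHom k S.Semidirect)).comp S.halfComul := by
    refine Covector.algHom_ext (Q := Covector R' ⊗[k] (S.Semidirect ⊗[k] S.Semidirect)) fun j => ?_
    have h : ∀ i j, comul (R := k) (S.inr (u i j)) = ∑ l, S.inr (u i l) ⊗ₜ[k] S.inr (u l j) :=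
      fun i j => S.comulHom_inr_comatrix S.comatrix i j
    simp [halfComul_gen, h, comul_p, TensorProduct.sum_tmul, TensorProduct.tmul_sum,
      TensorProduct.add_tmul, TensorProduct.tmul_add, Algebra.TensorProduct.one_def,
      Finset.sum_add_distrib, add_assoc]
    exact congrArg (· + _) Finset.sum_comm
  exact DFunLike.congr_fun this b

theorem rTensor_cou_halfComul (b : Covector R') :
    TensorProduct.lid k S.Semidirect (S.cou.toLinearMap.rTensor S.Semidirect (S.halfComul b)) = S.inl b := by
  have : (Algebra.TensorProduct.lid k S.Semidirect).toAlgHom.comp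
      ((Algebra.TensorProduct.map S.cou (AlgHom.id k S.Semidirect)).comp S.halfComul) =
      S.inl := by
    refine Covector.algHom_ext (Q := S.Semidirect) fun j => ?_
    simp [halfComul_gen, p]
  exact DFunLike.congr_fun this b

theorem lTensor_counit_halfComul (b : Covector R') :
    TensorProduct.rid k (Covector R') ((counit (R := k) (A := S.Semidirect)).lTensor (Covector R') (S.halfComul b)) =
      b := by
  have : (Algebra.TensorProduct.rid k k (Covector R')).toAlgHom.comp
      ((Algebra.TensorProduct.map (AlgHom.id k (Covector R'))
        (Bialgebra.counitAlgHom k S.Semidirect)).comp S.halfComul) =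
      AlgHom.id k (Covector R') := by
    refine Covector.algHom_ext (Q := Covector R') fun j => ?_
    have h : ∀ i j, counit (R := k) (S.inr (u i j)) = (1 : Matrix ι ι k) i j :=
      fun i j => (S.counitHom_inr _).trans (S.comatrix.counit_eq i j)
    simp [halfComul_gen, h, counit_p, Matrix.one_apply]
  exact DFunLike.congr_fun this b

theorem comul_mk {κ : Type*} [Fintype κ] [DecidableEq κ] {c : Matrix κ κ H} (hc : IsComatrix k c)
    (i j : κ) (b : Covector R') : comul (R := k) (Smash.mk S.moduleAlgebra (c i j) b) =
      ∑ l, S.inr (c i l) ⊗ₜ[k] S.inr (c l j) *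
        S.inl.toLinearMap.rTensor S.Semidirect (S.halfComul b) := by
  rw [mk_eq, Bialgebra.comul_mul, comul_inl, comul_def, S.comulHom_inr_comatrix hc, Finset.sum_mul]

/-- To prove a linear statement for all elements of the semidirect product it suffices to do so for
products of entries of comatrices and braided covectors. -/
theorem induction_mk {q : S.Semidirect → Prop} (add : ∀ x y, q x → q y → q (x + y))
    (smul : ∀ (a : k) x, q x → q (a • x)) (zero : q 0)
    (mk : ∀ (n : ℕ) (c : Matrix (Fin n) (Fin n) H), IsComatrix k c → ∀ i j b,
      q (Smash.mk S.moduleAlgebra (c i j) b)) (x : S.Semidirect) : q x := by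
  induction x using Smash.induction with
  | zero => exact zero
  | add x y hx hy => exact add x y hx hy
  | mk h b =>
    induction h using (@comatrix_induction k _ H _ _ _) with
    | add x y hx hy => rw [map_add]; exact add _ _ hx hy
    | smul a x hx => rw [map_smul]; exact smul _ _ hx
    | zero => rw [map_zero]; exact zero
    | base n c hc i j => exact mk n c hc i j b

end IsCovectorSymmetry
end BraidedStructure

section BraidedStructure

variable {k : Type*} [Field k] {ι : Type*} [Fintype ι] [DecidableEq ι]
  {H : Type*} [Ring H] [HopfAlgebra k H]
  {R R' : Matrix (ι × ι) (ι × ι) k} {r : LinearMap.BilinForm k H} {u : Matrix ι ι H}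

namespace IsCovectorSymmetry

variable (S : IsCovectorSymmetry R R' r u)
include S

theorem coact_induction {q : Covector R' → Prop} (add : ∀ x y, q x → q y → q (x + y))
    (smul : ∀ (a : k) x, q x → q (a • x)) (zero : q 0)
    (base : ∀ (n : ℕ) (w : Fin n → Covector R') (c : Matrix (Fin n) (Fin n) H), IsComatrix k c →
      (∀ i, S.coact (w i) = ∑ j, w j ⊗ₜ[k] c j i) → ∀ i, q (w i)) (b : Covector R') : q b :=
  comodule_induction S.coact.toLinearMap S.coact_coassoc S.coact_counit add smul zero
    (fun n w c h => base n w c h.comatrix h.coact) b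

/-- The braided coproduct. -/
def cop : Covector R' →ₗ[k] Covector R' ⊗[k] Covector R' :=
  S.proj.lTensor (Covector R') ∘ₗ S.halfComul.toLinearMap

theorem cop_apply (b : Covector R') : S.cop b = S.proj.lTensor (Covector R') (S.halfComul b) := rfl

/-- The map `b ⊗ c ↦ b¹ ⊗ b² c`. -/
def half : Covector R' ⊗[k] Covector R' →ₗ[k] Covector R' ⊗[k] S.Semidirect :=
  (LinearMap.mul' k S.Semidirect ∘ₗ
    TensorProduct.map S.inr.toLinearMap S.inl.toLinearMap).lTensor (Covector R') ∘ₗ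
      (TensorProduct.assoc k (Covector R') H (Covector R')).toLinearMap ∘ₗ
        S.coact.toLinearMap.rTensor (Covector R')

theorem half_tmul {n : ℕ} {w : Fin n → Covector R'} {c : Matrix (Fin n) (Fin n) H}
    (hw : ∀ i, S.coact (w i) = ∑ j, w j ⊗ₜ[k] c j i) (i : Fin n) (b : Covector R') :
    S.half (w i ⊗ₜ b) = ∑ j, w j ⊗ₜ[k] (S.inr (c j i) * S.inl b) := by
  simp [half, hw, TensorProduct.sum_tmul]

theorem mul_toH_proj_comul (x : S.Semidirect) :
    LinearMap.mul' k S.Semidirect (TensorProduct.map (S.inr.toLinearMap ∘ₗ S.toH.toLinearMap)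
      (S.inl.toLinearMap ∘ₗ S.proj) (comul (R := k) x)) = x := by
  induction x using S.induction_mk with
  | add x y hx hy => simp only [map_add, hx, hy]
  | smul a x hx => simp only [map_smul, hx]
  | zero => simp
  | mk n c hc i j b =>
    have key : ∀ (g h : H) (y : Covector R' ⊗[k] S.Semidirect), LinearMap.mul' k S.Semidirect
        (TensorProduct.map (S.inr.toLinearMap ∘ₗ S.toH.toLinearMap) (S.inl.toLinearMap ∘ₗ S.proj)
          (S.inr g ⊗ₜ[k] S.inr h * S.inl.toLinearMap.rTensor S.Semidirect y)) =
        counit (R := k) h • (S.inr g * S.inl (S.proj (TensorProduct.lid k S.Semidirect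
          (S.cou.toLinearMap.rTensor S.Semidirect y)))) := by
      intro g h y
      induction y with
      | zero => simp
      | add x y hx hy => simp only [map_add, mul_add, hx, hy, smul_add]
      | tmul e w =>
        simp only [LinearMap.rTensor_tmul, Algebra.TensorProduct.tmul_mul_tmul,
          TensorProduct.map_tmul, LinearMap.comp_apply, AlgHom.toLinearMap_apply, map_mul, toH_inr,
          toH_inl, LinearMap.mul'_apply, proj_inr_mul, map_smul, TensorProduct.lid_tmul,
          AlgHom.commutes, ← Algebra.commutes, mul_smul_comm]
        rw [← Algebra.smul_def, smul_mul_assoc]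
    rw [S.comul_mk hc, map_sum, map_sum]
    simp only [key, rTensor_cou_halfComul, proj_inl, mk_eq, hc.counit_eq]
    simp [Matrix.one_apply, ite_smul]

theorem halfComul_eq_half_cop (b : Covector R') : S.halfComul b = S.half (S.cop b) := by
  have h1 : ∀ y : Covector R' ⊗[k] S.Semidirect, (LinearMap.mul' k S.Semidirect ∘ₗ
      TensorProduct.map (S.inr.toLinearMap ∘ₗ S.toH.toLinearMap)
      (S.inl.toLinearMap ∘ₗ S.proj)).lTensor (Covector R')
        ((comul (R := k) (A := S.Semidirect)).lTensor (Covector R') y) = y := by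
    intro y
    induction y with
    | zero => simp
    | add x y hx hy => simp only [map_add, hx, hy]
    | tmul e w =>
      simp only [LinearMap.lTensor_tmul]
      exact congrArg _ (S.mul_toH_proj_comul w)
  have h2 : ∀ y : Covector R' ⊗[k] S.Semidirect, (LinearMap.mul' k S.Semidirect ∘ₗ
      TensorProduct.map (S.inr.toLinearMap ∘ₗ S.toH.toLinearMap)
      (S.inl.toLinearMap ∘ₗ S.proj)).lTensor (Covector R')
        (TensorProduct.assoc k (Covector R') S.Semidirect S.Semidirect
        (S.halfComul.toLinearMap.rTensor S.Semidirect y)) =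
      S.half (S.proj.lTensor (Covector R') y) := by
    intro y
    induction y with
    | zero => simp only [LinearMap.map_zero, LinearEquiv.map_zero]
    | add x y hx hy => simp only [map_add, hx, hy]
    | tmul e w =>
      simp only [LinearMap.rTensor_tmul, LinearMap.lTensor_tmul, half, LinearMap.comp_apply,
        AlgHom.toLinearMap_apply, ← S.lTensor_toH_halfComul e, LinearEquiv.coe_coe]
      generalize S.halfComul e = z
      induction z with
    | zero => simp only [LinearMap.map_zero, TensorProduct.zero_tmul, LinearEquiv.map_zero]
      | add x y hx hy => simp only [map_add, TensorProduct.add_tmul, hx, hy]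
      | tmul a x => simp
  rw [cop_apply, ← h2, rTensor_halfComul_halfComul, h1]

theorem map_proj_inr_mul (g h : H) (y : Covector R' ⊗[k] S.Semidirect) :
    TensorProduct.map S.proj S.proj
      (S.inr g ⊗ₜ[k] S.inr h * S.inl.toLinearMap.rTensor S.Semidirect y) =
      (counit (R := k) g * counit (R := k) h) • S.proj.lTensor (Covector R') y := by
  induction y with
  | zero => simp
  | add x y hx hy => simp only [map_add, mul_add, hx, hy, smul_add]
  | tmul e w =>
    simp [proj_inr_mul]
    rw [← TensorProduct.smul_tmul', smul_smul, mul_comm]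

theorem map_proj_comul (x : S.Semidirect) :
    TensorProduct.map S.proj S.proj (comul (R := k) x) = S.cop (S.proj x) := by
  induction x using S.induction_mk with
  | add x y hx hy => simp only [map_add, hx, hy]
  | smul a x hx => simp only [map_smul, hx]
  | zero => simp
  | mk n c hc i j b =>
    rw [S.comul_mk hc, map_sum]
    simp only [map_proj_inr_mul, proj_mk, hc.counit_eq, map_smul, ← cop_apply]
    rw [← Finset.sum_smul]
    congr 1
    simp [Matrix.one_apply]

theorem cop_coassoc (b : Covector R') :
    TensorProduct.assoc k (Covector R') (Covector R') (Covector R')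
      (S.cop.rTensor (Covector R') (S.cop b)) = S.cop.lTensor (Covector R') (S.cop b) := by
  have h1 : ∀ y : Covector R' ⊗[k] S.Semidirect,
      TensorProduct.assoc k (Covector R') (Covector R') (Covector R')
        (S.cop.rTensor (Covector R') (S.proj.lTensor (Covector R') y)) =
      (TensorProduct.map S.proj S.proj).lTensor (Covector R')
        (TensorProduct.assoc k (Covector R') S.Semidirect S.Semidirect
        (S.halfComul.toLinearMap.rTensor S.Semidirect y)) := by
    intro y
    induction y with
    | zero => simp only [LinearMap.map_zero, LinearEquiv.map_zero]
    | add x y hx hy => simp only [map_add, hx, hy]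
    | tmul e w =>
      simp only [LinearMap.rTensor_tmul, LinearMap.lTensor_tmul, cop_apply,
        AlgHom.toLinearMap_apply]
      generalize S.halfComul e = z
      induction z with
    | zero => simp only [LinearMap.map_zero, TensorProduct.zero_tmul, LinearEquiv.map_zero]
      | add x y hx hy => simp only [map_add, TensorProduct.add_tmul, hx, hy]
      | tmul a x => simp
  have h2 : ∀ y : Covector R' ⊗[k] S.Semidirect,
      (TensorProduct.map S.proj S.proj).lTensor (Covector R')
        ((comul (R := k) (A := S.Semidirect)).lTensor (Covector R') y) =
      S.cop.lTensor (Covector R') (S.proj.lTensor (Covector R') y) := by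
    intro y
    induction y with
    | zero => simp
    | add x y hx hy => simp only [map_add, hx, hy]
    | tmul e w => simp only [LinearMap.lTensor_tmul, map_proj_comul]
  rw [cop_apply, h1, rTensor_halfComul_halfComul, h2]

theorem cou_cop (b : Covector R') :
    TensorProduct.lid k (Covector R') (S.cou.toLinearMap.rTensor (Covector R') (S.cop b)) = b := by
  have h : ∀ y : Covector R' ⊗[k] S.Semidirect, TensorProduct.lid k (Covector R')
      (S.cou.toLinearMap.rTensor (Covector R') (S.proj.lTensor (Covector R') y)) =
      S.proj (TensorProduct.lid k S.Semidirect (S.cou.toLinearMap.rTensor S.Semidirect y)) := by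
    intro y
    induction y with
    | zero => simp
    | add x y hx hy => simp only [map_add, hx, hy]
    | tmul e w => simp
  rw [cop_apply, h, rTensor_cou_halfComul, proj_inl]

theorem cou_proj (x : S.Semidirect) : S.cou (S.proj x) = counit (R := k) x := by
  induction x using Smash.induction with
  | zero => simp
  | add x y hx hy => simp only [map_add, hx, hy]
  | mk h b =>
    rw [proj_mk, mk_eq, Bialgebra.counit_mul, counitHom_inl, map_smul, smul_eq_mul]
    congr 1
    exact (S.counitHom_inr h).symm

theorem cop_cou (b : Covector R') :
    TensorProduct.rid k (Covector R') (S.cou.toLinearMap.lTensor (Covector R') (S.cop b)) = b := by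
  have h : ∀ y : Covector R' ⊗[k] S.Semidirect, TensorProduct.rid k (Covector R')
      (S.cou.toLinearMap.lTensor (Covector R') (S.proj.lTensor (Covector R') y)) =
      TensorProduct.rid k (Covector R')
        ((counit (R := k) (A := S.Semidirect)).lTensor (Covector R') y) := by
    intro y
    induction y with
    | zero => simp
    | add x y hx hy => simp only [map_add, hx, hy]
    | tmul e w => simp [cou_proj]
  rw [cop_apply, h, lTensor_counit_halfComul]

theorem cop_one : S.cop 1 = 1 ⊗ₜ[k] 1 := by
  rw [cop_apply, map_one, Algebra.TensorProduct.one_def, LinearMap.lTensor_tmul, proj_one]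

theorem cop_gen (j : ι) : S.cop (Covector.gen R' j) =
    Covector.gen R' j ⊗ₜ[k] 1 + 1 ⊗ₜ[k] Covector.gen R' j := by
  have h : ∀ a, S.proj (S.inr (u a j)) = (1 : Matrix ι ι (Covector R')) a j := fun a => by
    have := S.proj_inr_mul (u a j) 1
    rw [mul_one, proj_one, S.comatrix.counit_eq] at this
    rw [this, Matrix.one_apply, Matrix.one_apply]
    split_ifs <;> simp
  rw [cop_apply, halfComul_gen]
  simp [h, Matrix.one_apply, TensorProduct.tmul_ite, p]

theorem proj_inl_mul {κ : Type*} [Fintype κ] [DecidableEq κ] {c : Matrix κ κ H}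
    (hc : IsComatrix k c) (b b' : Covector R') (i j : κ) :
    S.proj (S.inl b * (S.inr (c i j) * S.inl b')) = S.moduleAlgebra.act b (c i j) * b' := by
  have := Smash.inl_mul_inr S.moduleAlgebra hc b i j
  rw [← mul_assoc, proj_mul_inl]
  congr 1
  refine (congrArg S.proj this).trans ?_
  rw [map_sum]
  refine (Finset.sum_congr rfl fun l _ => S.proj_inr_mul _ (S.inl _)).trans ?_
  simp [hc.counit_eq, Matrix.one_apply, ite_smul]

theorem lTensor_proj_half_mul_half (y z : Covector R' ⊗[k] Covector R') :
    S.proj.lTensor (Covector R') (S.half y * S.half z) =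
      braidedMul r S.coact.toLinearMap (y ⊗ₜ[k] z) := by
  induction y with
  | zero => simp
  | add x y hx hy => simp only [map_add, add_mul, TensorProduct.add_tmul, hx, hy]
  | tmul b b' =>
    induction z with
    | zero => simp
    | add x y hx hy => simp only [map_add, mul_add, TensorProduct.tmul_add, hx, hy]
    | tmul d d' =>
      induction b using S.coact_induction with
      | add x y hx hy => simp only [map_add, add_mul, TensorProduct.add_tmul, hx, hy]
      | smul a x hx => simp only [map_smul, ← TensorProduct.smul_tmul', smul_mul_assoc, hx]
      | zero => simp
      | base n w c hc hw i =>
        induction d using S.coact_induction with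
        | add x y hx hy => simp only [map_add, mul_add, TensorProduct.tmul_add,
            TensorProduct.add_tmul, hx, hy]
        | smul a x hx => simp only [map_smul, ← TensorProduct.smul_tmul', TensorProduct.tmul_smul,
            mul_smul_comm, hx]
        | zero => simp
        | base m v e he hv j =>
          induction b' using S.coact_induction with
          | add x y hx hy => simp only [map_add, add_mul, TensorProduct.tmul_add,
              TensorProduct.add_tmul, hx, hy]
          | smul a x hx => simp only [map_smul, ← TensorProduct.smul_tmul', TensorProduct.tmul_smul,
              smul_mul_assoc, hx]
          | zero => simp
          | base m' v' e' he' hv' j' =>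
            have h1 : ∀ h, S.moduleAlgebra.act (v' j') h = ∑ q, r (e' q j') h • v' q :=
              rightAction_of_isSubcomodule r (β := S.coact.toLinearMap) hv' j'
            simp only [S.half_tmul hw, S.half_tmul hv, Finset.sum_mul, Finset.mul_sum,
              Algebra.TensorProduct.tmul_mul_tmul, map_sum, LinearMap.lTensor_tmul, mul_assoc,
              S.proj_inr_mul, S.proj_inl_mul he, hc.counit_eq, h1]
            simp [braidedMul, braiding_of_isSubcomodule r (β := S.coact.toLinearMap) hv' hv,
              TensorProduct.sum_tmul, TensorProduct.tmul_sum, TensorProduct.tmul_smul,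
              Matrix.one_apply, ite_smul, TensorProduct.tmul_ite]
            rw [Finset.sum_comm]
            refine Finset.sum_congr rfl fun x _ => Finset.sum_congr rfl fun y _ => ?_
            rw [← TensorProduct.smul_tmul', LinearEquiv.map_smul, LinearMap.map_smul]
            simp

theorem cop_mul (b c : Covector R') :
    S.cop (b * c) = braidedMul r S.coact.toLinearMap (S.cop b ⊗ₜ[k] S.cop c) := by
  rw [cop_apply, map_mul, halfComul_eq_half_cop, halfComul_eq_half_cop, lTensor_proj_half_mul_half]

end IsCovectorSymmetry
end BraidedStructure

section BraidedStructure

variable {k : Type*} [Field k] {ι : Type*} [Fintype ι] [DecidableEq ι]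
  {H : Type*} [Ring H] [HopfAlgebra k H]
  {R R' : Matrix (ι × ι) (ι × ι) k} {r : LinearMap.BilinForm k H} {u : Matrix ι ι H}

namespace IsCovectorSymmetry

variable (S : IsCovectorSymmetry R R' r u)
include S

/-- The map `b ↦ S(b¹) b²` to the semidirect product, which takes values in the covectors. -/
def twistedAntipode : Covector R' →ₗ[k] S.Semidirect :=
  LinearMap.mul' k S.Semidirect ∘ₗ
    TensorProduct.map (antipode k ∘ₗ S.inl.toLinearMap) S.inr.toLinearMap ∘ₗ S.coact.toLinearMap

theorem twistedAntipode_apply {n : ℕ} {w : Fin n → Covector R'} {c : Matrix (Fin n) (Fin n) H}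
    (hw : ∀ i, S.coact (w i) = ∑ j, w j ⊗ₜ[k] c j i) (i : Fin n) :
    S.twistedAntipode (w i) = ∑ j, antipode k (S.inl (w j)) * S.inr (c j i) := by
  simp [twistedAntipode, hw]

theorem twistedAntipode_one : S.twistedAntipode 1 = 1 := by
  simp [twistedAntipode, Algebra.TensorProduct.one_def]

theorem antipode_p_mul_mul_inr_u (b : Covector R') (s : ι) :
    ∑ t, antipode k (S.p t) * S.inl b * S.inr (u t s) =
      -∑ a, S.p a * S.inl (S.moduleAlgebra.act b (u a s)) := by
  have h : ∀ a l, ∑ t, S.inr (antipode k (u a t)) * S.inr (u t l) =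
      (1 : Matrix ι ι S.Semidirect) a l := fun a l => by
    have := congrArg S.inr (S.comatrix.sum_antipode_mul a l)
    simpa [Matrix.one_apply, apply_ite] using this
  have h2 : ∀ t, S.inl b * S.inr (u t s) =
      ∑ l, S.inr (u t l) * S.inl (S.moduleAlgebra.act b (u l s)) := fun t =>
    Smash.inl_mul_inr S.moduleAlgebra S.comatrix b t s
  simp only [antipode_p, neg_mul, Finset.sum_mul, Finset.sum_neg_distrib, mul_assoc, h2,
    Finset.mul_sum]
  congr 1
  rw [Finset.sum_comm]
  refine Finset.sum_congr rfl fun a _ => ?_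
  rw [Finset.sum_comm]
  simp only [← mul_assoc (S.inr _), ← Finset.sum_mul, ← Finset.mul_sum, h]
  simp [Matrix.one_apply]

theorem twistedAntipode_mul_gen (b : Covector R') (s : ι) :
    S.twistedAntipode (b * Covector.gen R' s) =
      ∑ t, antipode k (S.p t) * S.twistedAntipode b * S.inr (u t s) := by
  induction b using S.coact_induction with
  | add x y hx hy => simp only [add_mul, map_add, hx, hy, mul_add, Finset.sum_add_distrib]
  | smul a x hx => simp only [smul_mul_assoc, map_smul, hx, mul_smul_comm, Finset.smul_sum]
  | zero => simp
  | base n w c hc hw i =>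
    rw [S.twistedAntipode_apply hw]
    simp only [twistedAntipode, LinearMap.comp_apply, AlgHom.toLinearMap_apply, map_mul, hw,
      coact_gen, Algebra.TensorProduct.tmul_mul_tmul, map_sum,
      TensorProduct.map_tmul, LinearMap.mul'_apply, HopfAlgebra.antipode_mul_antidistrib,
      Finset.mul_sum, Finset.sum_mul, mul_assoc]
    rfl

/-- The braided antipode. -/
def anti : Covector R' →ₗ[k] Covector R' := S.proj ∘ₗ S.twistedAntipode

theorem inl_anti (b : Covector R') : S.inl (S.anti b) = S.twistedAntipode b := by
  have : ∃ c, S.twistedAntipode b = S.inl c := by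
    induction b using Covector.induction_mul_gen with
    | one => exact ⟨1, by rw [twistedAntipode_one, map_one]⟩
    | add x y hx hy =>
      obtain ⟨c, hc⟩ := hx
      obtain ⟨d, hd⟩ := hy
      exact ⟨c + d, by rw [map_add, map_add, hc, hd]⟩
    | smul a x hx =>
      obtain ⟨c, hc⟩ := hx
      exact ⟨a • c, by rw [map_smul, map_smul, hc]⟩
    | mul_gen x s hx =>
      obtain ⟨c, hc⟩ := hx
      refine ⟨-∑ a, Covector.gen R' a * S.moduleAlgebra.act c (u a s), ?_⟩
      rw [twistedAntipode_mul_gen, hc, antipode_p_mul_mul_inr_u]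
      simp [p]
  obtain ⟨c, hc⟩ := this
  rw [anti, LinearMap.comp_apply, hc, proj_inl]

theorem anti_gen (j : ι) : S.anti (Covector.gen R' j) = -Covector.gen R' j := by
  apply S.inl_injective
  have h1 := S.twistedAntipode_mul_gen 1 j
  have h2 := S.antipode_p_mul_mul_inr_u 1 j
  rw [twistedAntipode_one, one_mul] at h1
  rw [map_one] at h2
  rw [inl_anti, h1, h2]
  simp [S.moduleAlgebra.act_one, S.comatrix.counit_eq, Matrix.one_apply, ite_smul, p, apply_ite]

theorem anti_mul (b : Covector R') :
    LinearMap.mul' k (Covector R') (S.anti.rTensor (Covector R') (S.cop b)) =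
      algebraMap k (Covector R') (S.cou b) := by
  have h : ∀ y : Covector R' ⊗[k] Covector R',
      S.inl (LinearMap.mul' k (Covector R') (S.anti.rTensor (Covector R') y)) =
      LinearMap.mul' k S.Semidirect ((antipode k).rTensor S.Semidirect
        (S.inl.toLinearMap.rTensor S.Semidirect (S.half y))) := by
    intro y
    induction y with
    | zero => simp
    | add x y hx hy => simp only [map_add, hx, hy]
    | tmul b d =>
      induction b using S.coact_induction with
      | add x y hx hy => simp only [map_add, TensorProduct.add_tmul, hx, hy]
      | smul a x hx => simp only [map_smul, ← TensorProduct.smul_tmul', hx]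
      | zero => simp
      | base n w c hc hw i =>
        rw [S.half_tmul hw]
        simp [inl_anti, S.twistedAntipode_apply hw, Finset.sum_mul, mul_assoc]
  apply S.inl_injective
  rw [h, ← halfComul_eq_half_cop, ← comul_inl, HopfAlgebra.mul_antipode_rTensor_comul_apply,
    counitHom_inl, AlgHom.commutes]

/-- The map `x ↦ S(x₁) π(x₂)`, where `π` is the projection to `H`. -/
def antipodeToH : S.Semidirect →ₗ[k] S.Semidirect :=
  LinearMap.mul' k S.Semidirect ∘ₗ
    TensorProduct.map (antipode k) (S.inr.toLinearMap ∘ₗ S.toH.toLinearMap) ∘ₗ comul (R := k)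

theorem twistedAntipode_proj (x : S.Semidirect) : S.twistedAntipode (S.proj x) =
    S.antipodeToH x := by
  induction x using S.induction_mk with
  | add x y hx hy => simp only [map_add, hx, hy]
  | smul a x hx => simp only [map_smul, hx]
  | zero => simp
  | mk n c hc i j b =>
    have key : ∀ (g h : H) (y : Covector R' ⊗[k] S.Semidirect), LinearMap.mul' k S.Semidirect
        (TensorProduct.map (antipode k) (S.inr.toLinearMap ∘ₗ S.toH.toLinearMap)
          (S.inr g ⊗ₜ[k] S.inr h * S.inl.toLinearMap.rTensor S.Semidirect y)) =
        LinearMap.mul' k S.Semidirect (TensorProduct.map (LinearMap.mulRight k (S.inr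
          (antipode k g * h)) ∘ₗ antipode k ∘ₗ S.inl.toLinearMap) S.inr.toLinearMap
          (S.toH.toLinearMap.lTensor (Covector R') y)) := by
      intro g h y
      induction y with
      | zero => simp
      | add x y hx hy => simp only [map_add, mul_add, hx, hy]
      | tmul e w =>
        have : antipode k (S.inr g) = S.inr (antipode k g) := S.antipodeHom_inr g
        simp [HopfAlgebra.antipode_mul_antidistrib, this, mul_assoc]
    have key2 : ∀ z : Covector R' ⊗[k] H, ∑ l, LinearMap.mul' k S.Semidirect (TensorProduct.map
          (LinearMap.mulRight k (S.inr (antipode k (c i l) * c l j)) ∘ₗ antipode k ∘ₗ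
            S.inl.toLinearMap) S.inr.toLinearMap z) =
        (1 : Matrix (Fin n) (Fin n) k) i j • LinearMap.mul' k S.Semidirect (TensorProduct.map
          (antipode k ∘ₗ S.inl.toLinearMap) S.inr.toLinearMap z) := by
      intro z
      induction z with
      | zero => simp
      | add x y hx hy => simp only [map_add, Finset.sum_add_distrib, hx, hy, smul_add]
      | tmul e w =>
        have := hc.sum_antipode_mul i j
        simp only [TensorProduct.map_tmul, LinearMap.comp_apply, LinearMap.mulRight_apply,
          LinearMap.mul'_apply, mul_assoc, ← Finset.mul_sum, ← Finset.sum_mul, ← map_sum, this]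
        simp only [Matrix.one_apply]
        split_ifs <;> simp
    rw [antipodeToH, LinearMap.comp_apply, LinearMap.comp_apply, S.comul_mk hc, map_sum, map_sum]
    simp only [key, lTensor_toH_halfComul, key2]
    rw [proj_mk, hc.counit_eq, map_smul]
    rfl

theorem mul_antipodeToH (x : S.Semidirect) : LinearMap.mul' k S.Semidirect
    (S.antipodeToH.lTensor S.Semidirect (comul (R := k) x)) = S.inr (S.toH x) := by
  induction x using (@comatrix_induction k _ S.Semidirect _ _ _) with
  | add x y hx hy => simp only [map_add, hx, hy]
  | smul a x hx => simp only [map_smul, hx]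
  | zero => simp
  | base n c hc i j =>
    simp only [hc.comul_eq, map_sum, LinearMap.lTensor_tmul, LinearMap.mul'_apply, antipodeToH,
      LinearMap.comp_apply, TensorProduct.map_tmul, Finset.mul_sum, AlgHom.toLinearMap_apply]
    rw [Finset.sum_comm]
    simp only [← mul_assoc, ← Finset.sum_mul, hc.sum_mul_antipode]
    simp [Matrix.one_apply]

theorem mul_anti (b : Covector R') :
    LinearMap.mul' k (Covector R') (S.anti.lTensor (Covector R') (S.cop b)) =
      algebraMap k (Covector R') (S.cou b) := by
  have h : ∀ y : Covector R' ⊗[k] S.Semidirect,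
      S.inl (LinearMap.mul' k (Covector R') (S.anti.lTensor (Covector R')
        (S.proj.lTensor (Covector R') y))) =
      LinearMap.mul' k S.Semidirect (S.antipodeToH.lTensor S.Semidirect
        (S.inl.toLinearMap.rTensor S.Semidirect y)) := by
    intro y
    induction y with
    | zero => simp
    | add x y hx hy => simp only [map_add, hx, hy]
    | tmul b d => simp [inl_anti, twistedAntipode_proj]
  apply S.inl_injective
  rw [cop_apply, h, ← comul_inl, mul_antipodeToH, toH_inl, AlgHom.commutes, AlgHom.commutes]

theorem cop_covariant (b : Covector R') :
    tensorCoact S.coact.toLinearMap (S.cop b) = S.cop.rTensor H (S.coact b) := by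
  let T : S.Semidirect →ₗ[k] Covector R' ⊗[k] H :=
    TensorProduct.map S.proj S.toH.toLinearMap ∘ₗ comul (R := k)
  have h1 : ∀ y : Covector R' ⊗[k] S.Semidirect,
      TensorProduct.assoc k (Covector R') (Covector R') H
        (S.cop.rTensor H (S.toH.toLinearMap.lTensor (Covector R') y)) =
      (TensorProduct.map S.proj S.toH.toLinearMap).lTensor (Covector R')
        (TensorProduct.assoc k (Covector R') S.Semidirect S.Semidirect
        (S.halfComul.toLinearMap.rTensor S.Semidirect y)) := by
    intro y
    induction y with
    | zero => simp only [LinearMap.map_zero, LinearEquiv.map_zero]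
    | add x y hx hy => simp only [map_add, hx, hy]
    | tmul e w =>
      simp only [LinearMap.rTensor_tmul, LinearMap.lTensor_tmul, cop_apply,
        AlgHom.toLinearMap_apply]
      generalize S.halfComul e = z
      induction z with
      | zero => simp only [LinearMap.map_zero, TensorProduct.zero_tmul, LinearEquiv.map_zero]
      | add x y hx hy => simp only [map_add, TensorProduct.add_tmul, hx, hy]
      | tmul a x => simp
  have h2 : ∀ (g h : H) (y : Covector R' ⊗[k] S.Semidirect),
      TensorProduct.map S.proj S.toH.toLinearMap
        (S.inr g ⊗ₜ[k] S.inr h * S.inl.toLinearMap.rTensor S.Semidirect y) =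
      counit (R := k) g • ((1 : Covector R') ⊗ₜ[k] h *
        S.toH.toLinearMap.lTensor (Covector R') y) := by
    intro g h y
    induction y with
    | zero => simp
    | add x y hx hy => simp only [map_add, mul_add, hx, hy, smul_add]
    | tmul e w => simp [proj_inr_mul, TensorProduct.smul_tmul']
  have h3 : ∀ {n : ℕ} {c : Matrix (Fin n) (Fin n) H}, IsComatrix k c → ∀ i j (e : Covector R'),
      T (S.inr (c i j) * S.inl e) = (1 : Covector R') ⊗ₜ[k] c i j * S.coact e := by
    intro n c hc i j e
    rw [← mk_eq]
    simp only [T, LinearMap.comp_apply]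
    rw [S.comul_mk hc, map_sum]
    simp only [h2, lTensor_toH_halfComul, hc.counit_eq]
    simp [Matrix.one_apply, ite_smul]
  have h4 : ∀ y : Covector R' ⊗[k] Covector R', T.lTensor (Covector R') (S.half y) =
      TensorProduct.assoc k (Covector R') (Covector R') H
        (tensorCoact S.coact.toLinearMap y) := by
    intro y
    induction y with
    | zero => simp only [LinearMap.map_zero, LinearEquiv.map_zero]
    | add x y hx hy => simp only [map_add, hx, hy]
    | tmul b d =>
      induction b using S.coact_induction with
      | add x y hx hy => simp only [map_add, TensorProduct.add_tmul, hx, hy]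
      | smul a x hx => simp only [map_smul, ← TensorProduct.smul_tmul', hx]
      | zero => simp
      | base n w c hc hw i =>
        rw [S.half_tmul hw]
        simp only [map_sum, LinearMap.lTensor_tmul, h3 hc, tensorCoact, LinearMap.comp_apply,
          TensorProduct.map_tmul, AlgHom.toLinearMap_apply, hw, TensorProduct.sum_tmul]
        refine Finset.sum_congr rfl fun j _ => ?_
        generalize S.coact d = z
        induction z with
        | zero => simp
        | add x y hx hy => simp only [map_add, mul_add, TensorProduct.tmul_add, hx, hy]
        | tmul e w => simp
  apply (TensorProduct.assoc k (Covector R') (Covector R') H).injective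
  rw [← h4, ← halfComul_eq_half_cop, ← lTensor_toH_halfComul, h1, rTensor_halfComul_halfComul,
    LinearMap.lTensor_comp, LinearMap.comp_apply]

theorem cou_covariant (b : Covector R') :
    TensorProduct.lid k H (S.cou.toLinearMap.rTensor H (S.coact b)) =
      algebraMap k H (S.cou b) := by
  have : (Algebra.TensorProduct.lid k H).toAlgHom.comp
      ((Algebra.TensorProduct.map S.cou (AlgHom.id k H)).comp S.coact) =
      (Algebra.ofId k H).comp S.cou := Covector.algHom_ext fun j => by simp
  exact DFunLike.congr_fun this b

/-- The coaction of `H` on the semidirect product obtained from the projection to `H`. -/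
def coactSemidirect : S.Semidirect →ₐ[k] S.Semidirect ⊗[k] H :=
  (Algebra.TensorProduct.map (AlgHom.id k S.Semidirect) S.toH).comp
    (Bialgebra.comulAlgHom k S.Semidirect)

theorem coactSemidirect_apply (x : S.Semidirect) : S.coactSemidirect x =
    S.toH.toLinearMap.lTensor S.Semidirect (comul (R := k) x) := rfl

theorem coactSemidirect_inl (b : Covector R') :
    S.coactSemidirect (S.inl b) = S.inl.toLinearMap.rTensor H (S.coact b) := by
  rw [coactSemidirect_apply, comul_inl, ← lTensor_toH_halfComul, ← LinearMap.comp_apply,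
    ← LinearMap.comp_apply, LinearMap.lTensor_comp_rTensor, LinearMap.rTensor_comp_lTensor]

theorem coactSemidirect_inr {κ : Type*} [Fintype κ] [DecidableEq κ] {c : Matrix κ κ H}
    (hc : IsComatrix k c) (i j : κ) :
    S.coactSemidirect (S.inr (c i j)) = ∑ l, S.inr (c i l) ⊗ₜ[k] c l j := by
  rw [coactSemidirect_apply, comul_def, S.comulHom_inr_comatrix hc]
  simp

theorem coactSemidirect_antipode_inl (b : Covector R') :
    S.coactSemidirect (antipode k (S.inl b)) = antipode k (S.inl b) ⊗ₜ[k] 1 := by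
  induction b using Covector.induction with
  | one => simp [Algebra.TensorProduct.one_def]
  | gen j =>
    have h := S.antipode_p j
    rw [p] at h
    have h2 : ∀ a, S.coactSemidirect (S.inr (antipode k (u a j))) =
        ∑ m, S.inr (antipode k (u m j)) ⊗ₜ[k] antipode k (u a m) := fun a => by
      have := S.comatrix.comul_antipode_eq a j
      rw [coactSemidirect_apply, comul_def, comulHom_inr, this]
      simp
    have h3 : ∀ e m, ∑ a, u e a * antipode k (u a m) = (1 : Matrix ι ι H) e m :=
      fun e m => S.comatrix.sum_mul_antipode e m
    have h4 : ∀ a, S.coactSemidirect (S.p a) = ∑ e, S.p e ⊗ₜ[k] u e a := fun a => by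
      rw [p, coactSemidirect_inl, coact_gen]
      simp [p]
    rw [h]
    simp only [map_neg, map_sum, map_mul, h4, h2, Finset.sum_mul_sum,
      Algebra.TensorProduct.tmul_mul_tmul]
    rw [TensorProduct.neg_tmul, TensorProduct.sum_tmul, sum_rotate₃, sum_rotate₃]
    simp only [← TensorProduct.tmul_sum, h3]
    simp [Matrix.one_apply, TensorProduct.tmul_ite]
  | add x y hx hy => simp only [map_add, hx, hy, TensorProduct.add_tmul]
  | smul a x hx => simp only [map_smul, hx, TensorProduct.smul_tmul']
  | mul x y hx hy =>
    simp only [map_mul, HopfAlgebra.antipode_mul_antidistrib, hx, hy,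
      Algebra.TensorProduct.tmul_mul_tmul, mul_one]

theorem anti_covariant (b : Covector R') : S.coact (S.anti b) = S.anti.rTensor H (S.coact b) := by
  have hinj : Function.Injective (S.inl.toLinearMap.rTensor H) := by
    refine Function.LeftInverse.injective (g := S.proj.rTensor H) fun y => ?_
    rw [← LinearMap.comp_apply, ← LinearMap.rTensor_comp]
    have : S.proj ∘ₗ S.inl.toLinearMap = LinearMap.id := LinearMap.ext S.proj_inl
    rw [this, LinearMap.rTensor_id, LinearMap.id_apply]
  apply hinj
  rw [← coactSemidirect_inl, inl_anti]
  induction b using S.coact_induction with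
  | add x y hx hy => simp only [map_add, hx, hy]
  | smul a x hx => simp only [map_smul, hx]
  | zero => simp
  | base n w c hc hw i =>
    rw [S.twistedAntipode_apply hw, hw]
    simp only [map_sum, map_mul, coactSemidirect_antipode_inl, S.coactSemidirect_inr hc,
      LinearMap.rTensor_tmul, AlgHom.toLinearMap_apply, inl_anti, S.twistedAntipode_apply hw,
      TensorProduct.sum_tmul, Finset.mul_sum, Algebra.TensorProduct.tmul_mul_tmul, one_mul]
    exact Finset.sum_comm

/-- The braided covectors as a Hopf algebra in the braided category of right `H`-comodules. -/
def braidedHopfAlgebra : BraidedHopfAlgebra r (Covector R') where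
  coact := S.coact
  coact_coassoc := S.coact_coassoc
  coact_counit := S.coact_counit
  cop := S.cop
  cou := S.cou
  anti := S.anti
  cop_coassoc := S.cop_coassoc
  cou_cop := S.cou_cop
  cop_cou := S.cop_cou
  cop_one := S.cop_one
  cop_mul := S.cop_mul
  anti_mul := S.anti_mul
  mul_anti := S.mul_anti
  cop_covariant := S.cop_covariant
  cou_covariant := S.cou_covariant
  anti_covariant := S.anti_covariant

theorem isBosonization : IsBosonization S.braidedHopfAlgebra S.inl S.inrBialgHom where
  bijective := Smash.bijective_orderedProduct
  cross b h := by
    induction h using (@comatrix_induction k _ H _ _ _) with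
    | add x y hx hy => simp only [map_add, mul_add, hx, hy]
    | smul a x hx => simp only [map_smul, mul_smul_comm, hx]
    | zero => simp
    | base n c hc i j =>
      have h := Smash.inl_mul_inr S.moduleAlgebra hc b i j
      rw [hc.comul_eq, map_sum, map_sum]
      exact h
  comul_eq b := by
    have key : ∀ y : Covector R' ⊗[k] Covector R',
        S.inl.toLinearMap.rTensor S.Semidirect (S.half y) =
        (LinearMap.mul' k S.Semidirect).lTensor S.Semidirect
          (TensorProduct.assoc k S.Semidirect S.Semidirect S.Semidirect (TensorProduct.map
            (TensorProduct.map S.inl.toLinearMap S.inr.toLinearMap ∘ₗ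
              S.coact.toLinearMap) S.inl.toLinearMap y)) := by
      intro y
      induction y with
      | zero => simp only [LinearMap.map_zero, LinearEquiv.map_zero]
      | add x y hx hy => simp only [map_add, hx, hy]
      | tmul b d =>
        induction b using S.coact_induction with
        | add x y hx hy => simp only [map_add, TensorProduct.add_tmul, hx, hy]
        | smul a x hx => simp only [map_smul, ← TensorProduct.smul_tmul', hx]
        | zero => simp only [LinearMap.map_zero, TensorProduct.zero_tmul, LinearEquiv.map_zero]
        | base n w c hc hw i =>
          rw [S.half_tmul hw]
          simp [hw, TensorProduct.sum_tmul]
    rw [comul_inl, halfComul_eq_half_cop, key]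
    rfl
  counit_eq := S.counitHom_inl
  antipode_eq b := by
    have key : LinearMap.mul' k S.Semidirect (TensorProduct.map (S.inl.toLinearMap ∘ₗ S.anti)
        (S.inr.toLinearMap ∘ₗ antipode k) (S.coact b)) = antipode k (S.inl b) := by
      induction b using S.coact_induction with
      | add x y hx hy => simp only [map_add, hx, hy]
      | smul a x hx => simp only [map_smul, hx]
      | zero => simp
      | base n w c hc hw i =>
        have h : ∀ j, ∑ l, S.inr (c j l) * S.inr (antipode k (c l i)) =
            (1 : Matrix (Fin n) (Fin n) S.Semidirect) j i := fun j => by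
          have := congrArg S.inr (hc.sum_mul_antipode j i)
          simpa [Matrix.one_apply, apply_ite] using this
        simp only [hw, map_sum, TensorProduct.map_tmul, LinearMap.mul'_apply, LinearMap.comp_apply,
          AlgHom.toLinearMap_apply, inl_anti, S.twistedAntipode_apply hw, Finset.sum_mul,
          mul_assoc]
        rw [Finset.sum_comm]
        simp only [← Finset.mul_sum, h]
        simp [Matrix.one_apply]
    exact key.symm

end IsCovectorSymmetry
end BraidedStructure

section ExtensionDual

variable {k : Type*} [Field k] {A : Type*} [Ring A] [HopfAlgebra k A]

open LaurentPolynomial (T)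

theorem laurentForm_T (lam : k) (a b : ℤ) : laurentForm lam (T a) (T b) = lam ^ (-(a * b)) := by
  have h : ∀ n : ℤ, (T n : k[T;T⁻¹]) = AddMonoidAlgebra.basis ℤ k n :=
    fun n => (AddMonoidAlgebra.basis_apply k n).symm
  rw [laurentForm, h, h, Module.Basis.constr_basis, Module.Basis.constr_basis]

theorem extForm_tmul (r : LinearMap.BilinForm k A) (lam : k) (a b : A) (x y : k[T;T⁻¹]) :
    extForm r lam (a ⊗ₜ x) (b ⊗ₜ y) = r a b * laurentForm lam x y := by
  simp [extForm]

theorem extForm_tmul_T (r : LinearMap.BilinForm k A) (lam : k) (a b : A) (m n : ℤ) :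
    extForm r lam (a ⊗ₜ T m) (b ⊗ₜ T n) = r a b * lam ^ (-(m * n)) := by
  rw [extForm_tmul, laurentForm_T]

/-- The comatrix of `Ã` obtained from a comatrix of `A` and a power of the group-like element. -/
def shiftComatrix {κ : Type*} (c : Matrix κ κ A) (m : ℤ) : Matrix κ κ (Ext k A) :=
  c.map fun a => a ⊗ₜ[k] T m

@[simp] theorem shiftComatrix_apply {κ : Type*} (c : Matrix κ κ A) (m : ℤ) (i j : κ) :
    shiftComatrix (k := k) c m i j = c i j ⊗ₜ[k] T m := rfl

theorem IsComatrix.shift {κ : Type*} [Fintype κ] [DecidableEq κ] {c : Matrix κ κ A}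
    (hc : IsComatrix k c) (m : ℤ) : IsComatrix k (shiftComatrix (k := k) c m) where
  comul_eq i j := by
    rw [shiftComatrix_apply, TensorProduct.comul_tmul, hc.comul_eq, LaurentPolynomial.comul_T]
    simp [TensorProduct.sum_tmul]
  counit_eq i j := by
    rw [shiftComatrix_apply, TensorProduct.counit_tmul, hc.counit_eq, LaurentPolynomial.counit_T,
      one_smul]

theorem Ext.induction {q : Ext k A → Prop} (add : ∀ x y, q x → q y → q (x + y))
    (smul : ∀ (a : k) x, q x → q (a • x)) (zero : q 0)
    (base : ∀ (n : ℕ) (c : Matrix (Fin n) (Fin n) A), IsComatrix k c → ∀ i j (m : ℤ),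
      q (c i j ⊗ₜ T m)) (x : Ext k A) : q x := by
  induction x using TensorProduct.induction_on with
  | zero => exact zero
  | add x y hx hy => exact add x y hx hy
  | tmul a y =>
    induction a using (@comatrix_induction k _ A _ _ _) with
    | add x z hx hz => rw [TensorProduct.add_tmul]; exact add _ _ hx hz
    | smul b x hx => rw [← TensorProduct.smul_tmul']; exact smul _ _ hx
    | zero => rw [TensorProduct.zero_tmul]; exact zero
    | base n c hc i j =>
      induction y using AddMonoidAlgebra.induction_linear with
      | zero => rw [TensorProduct.tmul_zero]; exact zero
      | add f g hf hg => rw [TensorProduct.tmul_add]; exact add _ _ hf hg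
      | single m b =>
        have : (AddMonoidAlgebra.single m b : k[T;T⁻¹]) = b • T m := by
          rw [LaurentPolynomial.T, AddMonoidAlgebra.smul_single, smul_eq_mul, mul_one]
        rw [this, TensorProduct.tmul_smul]
        exact smul _ _ (base n c hc i j m)

theorem Ext.one_def : (1 : Ext k A) = 1 ⊗ₜ T 0 := by
  rw [LaurentPolynomial.T_zero, Algebra.TensorProduct.one_def]

theorem Ext.counit_tmul_T (a : A) (m : ℤ) :
    counit (R := k) (a ⊗ₜ[k] T m : Ext k A) = counit (R := k) a := by
  rw [TensorProduct.counit_tmul, LaurentPolynomial.counit_T, one_smul]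

theorem Ext.tmul_T_mul (a b : A) (m n : ℤ) :
    (a ⊗ₜ[k] T m : Ext k A) * b ⊗ₜ[k] T n = (a * b) ⊗ₜ[k] T (m + n) := by
  rw [Algebra.TensorProduct.tmul_mul_tmul, LaurentPolynomial.T_add]

theorem IsDualQuasitriangular.ext {r : LinearMap.BilinForm k A} (hr : IsDualQuasitriangular r)
    {lam : k} (hlam : lam ≠ 0) : IsDualQuasitriangular (extForm r lam) where
  one_left a := by
    induction a using Ext.induction with
    | add x y hx hy => simp only [map_add, hx, hy]
    | smul a x hx => simp only [map_smul, hx]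
    | zero => simp
    | base n c hc i j m =>
      rw [Ext.one_def, extForm_tmul_T, hr.one_left, Ext.counit_tmul_T]
      simp
  one_right a := by
    induction a using Ext.induction with
    | add x y hx hy => simp only [map_add, LinearMap.add_apply, hx, hy]
    | smul a x hx => simp only [map_smul, LinearMap.smul_apply, hx]
    | zero => simp
    | base n c hc i j m =>
      rw [Ext.one_def, extForm_tmul_T, hr.one_right, Ext.counit_tmul_T]
      simp
  mul_left a b c := by
    induction c using Ext.induction with
    | add x y hx hy => simp only [map_add, hx, hy]
    | smul a x hx => simp only [map_smul, hx]
    | zero => simp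
    | base n c hc i j l =>
      have hl := (hc.shift (k := k) l).comul_eq i j
      simp only [shiftComatrix_apply] at hl
      rw [hl]
      simp only [map_sum, TensorProduct.map_tmul, LinearMap.mul'_apply]
      induction a using Ext.induction with
      | add x y hx hy => simp only [map_add, LinearMap.add_apply, add_mul, hx, hy,
          Finset.sum_add_distrib]
      | smul a x hx => simp only [map_smul, LinearMap.smul_apply, smul_mul_assoc, hx,
          Finset.smul_sum]
      | zero => simp
      | base n' c' hc' i' j' m =>
        induction b using Ext.induction with
        | add x y hx hy => simp only [map_add, LinearMap.add_apply, mul_add, hx, hy,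
            Finset.sum_add_distrib]
        | smul a x hx => simp only [map_smul, LinearMap.smul_apply, mul_smul_comm, hx,
            Finset.smul_sum]
        | zero => simp
        | base n'' c'' hc'' i'' j'' m' =>
          simp only [Ext.tmul_T_mul, extForm_tmul_T, hr.mul_left_comatrix hc]
          rw [add_mul, neg_add, zpow_add₀ hlam, Finset.sum_mul]
          exact Finset.sum_congr rfl fun _ _ => by ring
  mul_right a b c := by
    induction a using Ext.induction with
    | add x y hx hy => simp only [map_add, LinearMap.add_apply, hx, hy]
    | smul a x hx => simp only [map_smul, LinearMap.smul_apply, hx]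
    | zero => simp
    | base n d hd i j l =>
      have hl := (hd.shift (k := k) l).comul_eq i j
      simp only [shiftComatrix_apply] at hl
      rw [hl]
      simp only [map_sum, TensorProduct.map_tmul, LinearMap.mul'_apply, LinearMap.BilinForm.flip_apply]
      induction b using Ext.induction with
      | add x y hx hy => simp only [map_add, mul_add, add_mul, hx, hy,
          Finset.sum_add_distrib]
      | smul a x hx => simp only [map_smul, mul_smul_comm, smul_mul_assoc, hx,
          Finset.smul_sum]
      | zero => simp
      | base n' c' hc' i' j' m =>
        induction c using Ext.induction with
        | add x y hx hy => simp only [map_add, mul_add, add_mul, hx, hy,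
            Finset.sum_add_distrib]
        | smul a x hx => simp only [map_smul, mul_smul_comm, smul_mul_assoc, hx,
            Finset.smul_sum]
        | zero => simp
        | base n'' c'' hc'' i'' j'' m' =>
          simp only [Ext.tmul_T_mul, extForm_tmul_T, hr.mul_right_comatrix hd]
          rw [mul_add, neg_add, zpow_add₀ hlam, Finset.sum_mul]
          exact Finset.sum_congr rfl fun _ _ => by ring
  quasicomm a b := by
    induction a using Ext.induction with
    | add x y hx hy => simp only [TensorProduct.add_tmul, map_add, hx, hy]
    | smul a x hx => simp only [← TensorProduct.smul_tmul', map_smul, hx]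
    | zero => simp only [TensorProduct.zero_tmul, LinearMap.map_zero, LinearEquiv.map_zero]
    | base n c hc i j m =>
      induction b using Ext.induction with
      | add x y hx hy => simp only [TensorProduct.tmul_add, map_add, hx, hy]
      | smul a x hx => simp only [TensorProduct.tmul_smul, map_smul, hx]
      | zero => simp only [TensorProduct.tmul_zero, LinearMap.map_zero, LinearEquiv.map_zero]
      | base n' d hd p l m' =>
        have h := comul_comatrix_tmul (hc.shift (k := k) m) (hd.shift (k := k) m') i j p l
        simp only [shiftComatrix_apply] at h
        rw [h]
        have h2 := congrArg (fun z => lam ^ (-(m * m')) • (z ⊗ₜ[k] T (m + m') : Ext k A))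
          (hr.quasicomm_comatrix hc hd i j p l)
        simp only [TensorProduct.sum_tmul, Finset.smul_sum, ← TensorProduct.smul_tmul',
          smul_smul] at h2
        simp only [map_sum, TensorProduct.map_tmul, LinearMap.comp_apply, LinearEquiv.coe_coe,
          TensorProduct.comm_tmul, LinearMap.mul'_apply, TensorProduct.lift.tmul,
          TensorProduct.rid_tmul, TensorProduct.lid_tmul, extForm_tmul_T, Ext.tmul_T_mul]
        simpa only [mul_comm, add_comm] using h2
  invertible := by
    obtain ⟨s, hs⟩ := hr.invertible
    refine ⟨extForm s lam⁻¹, fun a b => ?_⟩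
    induction a using Ext.induction with
    | add x y hx hy =>
      simp only [TensorProduct.add_tmul, map_add, hx, hy, add_mul, and_self]
    | smul a x hx => simp only [← TensorProduct.smul_tmul', map_smul, hx, smul_mul_assoc, and_self]
    | zero => simp
    | base n c hc i j m =>
      induction b using Ext.induction with
      | add x y hx hy => simp only [TensorProduct.tmul_add, map_add, hx, hy, mul_add, and_self]
      | smul a x hx => simp only [TensorProduct.tmul_smul, map_smul, hx, mul_smul_comm, and_self]
      | zero => simp
      | base n' d hd p l m' =>
        have h := comul_comatrix_tmul (hc.shift (k := k) m) (hd.shift (k := k) m') i j p l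
        simp only [shiftComatrix_apply] at h
        obtain ⟨h1, h2⟩ := hs (c i j) (d p l)
        rw [comul_comatrix_tmul hc hd] at h1 h2
        simp only [map_sum, TensorProduct.map_tmul, LinearMap.mul'_apply,
          TensorProduct.lift.tmul] at h1 h2
        rw [h, Ext.counit_tmul_T, Ext.counit_tmul_T, ← h1]
        constructor
        · simp only [map_sum, TensorProduct.map_tmul, LinearMap.mul'_apply,
            TensorProduct.lift.tmul, extForm_tmul_T]
          refine Finset.sum_congr rfl fun _ _ => Finset.sum_congr rfl fun _ _ => ?_
          rw [mul_mul_mul_comm, inv_zpow, mul_inv_cancel₀ (zpow_ne_zero _ hlam), mul_one]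
        · rw [h1, ← h2]
          simp only [map_sum, TensorProduct.map_tmul, LinearMap.mul'_apply,
            TensorProduct.lift.tmul, extForm_tmul_T]
          refine Finset.sum_congr rfl fun _ _ => Finset.sum_congr rfl fun _ _ => ?_
          rw [mul_mul_mul_comm, inv_zpow, inv_mul_cancel₀ (zpow_ne_zero _ hlam), mul_one]

end ExtensionDual

section CrossSubalgebra

variable {k : Type*} [Field k] {ι : Type*} [Fintype ι] [DecidableEq ι]
  {H : Type*} [Ring H] [HopfAlgebra k H]
  {R R' : Matrix (ι × ι) (ι × ι) k} {r : LinearMap.BilinForm k H} {u : Matrix ι ι H}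
  {Q : Type*} [Ring Q] [Algebra k Q]

namespace IsCovectorSymmetry

variable (S : IsCovectorSymmetry R R' r u)
include S

/-- The matrix `h ↦ g(h₁) r(u ⊗ h₂)` of maps through which the elements of `H` move past a row. -/
def crossMatrix (_ : IsCovectorSymmetry R R' r u) (g : H →ₐ[k] Q) (b a : ι) : H →ₗ[k] Q :=
  LinearMap.mul' k Q ∘ₗ
    TensorProduct.map g.toLinearMap ((Algebra.linearMap k Q) ∘ₗ r (u b a)) ∘ₗ comul (R := k)

theorem crossMatrix_comatrix {κ : Type*} [Fintype κ] [DecidableEq κ] {c : Matrix κ κ H}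
    (hc : IsComatrix k c) (g : H →ₐ[k] Q) (b a : ι) (i j : κ) :
    S.crossMatrix g b a (c i j) = ∑ l, r (u b a) (c l j) • g (c i l) := by
  rw [crossMatrix, LinearMap.comp_apply, LinearMap.comp_apply, hc.comul_eq]
  simp [← Algebra.commutes, Algebra.smul_def]

theorem crossMatrix_one (g : H →ₐ[k] Q) (b a : ι) :
    S.crossMatrix g b a 1 = (1 : Matrix ι ι Q) b a := by
  simp [crossMatrix, Algebra.TensorProduct.one_def, S.dual.one_right, S.comatrix.counit_eq,
    Matrix.one_apply, apply_ite]
  split_ifs with h <;> simp [h]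

theorem crossMatrix_mul (g : H →ₐ[k] Q) (c a : ι) (x y : H) :
    S.crossMatrix g c a (x * y) = ∑ b, S.crossMatrix g b a x * S.crossMatrix g c b y := by
  induction x using (@comatrix_induction k _ H _ _ _) with
  | add x z hx hz => simp only [add_mul, map_add, hx, hz, Finset.sum_add_distrib]
  | smul b x hx => simp only [smul_mul_assoc, map_smul, hx, Finset.smul_sum]
  | zero => simp
  | base n d hd i j =>
    induction y using (@comatrix_induction k _ H _ _ _) with
    | add x z hx hz => simp only [mul_add, map_add, hx, hz, Finset.sum_add_distrib]
    | smul b x hx => simp only [mul_smul_comm, map_smul, hx, Finset.smul_sum]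
    | zero => simp
    | base m e he p l =>
      have h := S.crossMatrix_comatrix (hd.kronecker he) g c a (i, p) (j, l)
      refine h.trans ?_
      simp only [S.dual.mul_right_comatrix S.comatrix, S.crossMatrix_comatrix hd,
        S.crossMatrix_comatrix he, Fintype.sum_prod_type, Finset.sum_mul_sum, smul_mul_smul_comm,
        map_mul, Finset.sum_smul]
      rw [sum_rotate₃]
      refine Finset.sum_congr rfl fun b _ => Finset.sum_congr rfl fun _ _ =>
        Finset.sum_congr rfl fun _ _ => by rw [mul_comm]

/-- The elements of `H` that move past a row by the cross relations. -/
def crossSubalgebra (x : ι → Q) (g : H →ₐ[k] Q) : Subalgebra k H where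
  carrier := {h | ∀ a, x a * g h = ∑ b, S.crossMatrix g b a h * x b}
  mul_mem' {h h'} hh hh' a := by
    have hg : ∀ a, x a * g h' = ∑ b, S.crossMatrix g b a h' * x b := hh'
    rw [map_mul, ← mul_assoc, hh]
    simp only [Finset.sum_mul, mul_assoc, hg, crossMatrix_mul, Finset.mul_sum]
    exact Finset.sum_comm
  add_mem' {h h'} hh hh' a := by
    simp only [map_add, mul_add, hh a, hh' a, add_mul, Finset.sum_add_distrib]
  algebraMap_mem' c a := by
    simp [Algebra.algebraMap_eq_smul_one, S.crossMatrix_one, Matrix.one_apply, ite_mul]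

theorem mem_crossSubalgebra {x : ι → Q} {g : H →ₐ[k] Q} {h : H} :
    h ∈ S.crossSubalgebra x g ↔ ∀ a, x a * g h = ∑ b, S.crossMatrix g b a h * x b := Iff.rfl

theorem crossRow_of_eq_top {x : ι → Q} {g : H →ₐ[k] Q} (h : S.crossSubalgebra x g = ⊤) :
    S.CrossRow x g := by
  intro n c hc a i j
  have : c i j ∈ S.crossSubalgebra x g := h ▸ Algebra.mem_top
  rw [S.mem_crossSubalgebra.mp this a]
  simp only [S.crossMatrix_comatrix hc, Finset.sum_mul, smul_mul_assoc]
  exact Finset.sum_comm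

end IsCovectorSymmetry
end CrossSubalgebra

section Main

variable {ι : Type} [Fintype ι] [DecidableEq ι] {A : Type u} [Ring A] [HopfAlgebra ℂ A]
  {R R' : Matrix (ι × ι) (ι × ι) ℂ} {t : Matrix ι ι A} {r : LinearMap.BilinForm ℂ A} {lam : ℂ}

open LaurentPolynomial (T)

/-- The comatrix `t g` of `Ã`. -/
def extMatrix (t : Matrix ι ι A) : Matrix ι ι (Ext ℂ A) :=
  t.map fun a => (a ⊗ₜ[ℂ] 1) * gExt ℂ A

theorem extMatrix_apply (t : Matrix ι ι A) (i j : ι) :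
    extMatrix t i j = (t i j ⊗ₜ[ℂ] 1) * gExt ℂ A := rfl

theorem extMatrix_eq (t : Matrix ι ι A) : extMatrix t = shiftComatrix t 1 := by
  ext i j
  rw [extMatrix_apply, gExt, Algebra.TensorProduct.tmul_mul_tmul, mul_one, one_mul,
    shiftComatrix_apply]

theorem IsMatrixQuantumGroup.isCovectorSymmetry (hA : IsMatrixQuantumGroup R lam t r)
    (hR : IsCovectorPair R R') (hlam : lam ≠ 0) (ht : Exchange R' t t) :
    IsCovectorSymmetry R R' (extForm r lam) (extMatrix t) where
  pair := hR
  dual := hA.dualQuasitriangular.ext hlam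
  comatrix := by
    rw [extMatrix_eq]
    exact IsComatrix.shift ⟨hA.comul_t, hA.counit_t⟩ 1
  form i j p l := by
    simp only [extMatrix_eq, shiftComatrix_apply]
    rw [extForm_tmul_T, hA.form_t]
    rw [mul_one, zpow_neg_one]
    field_simp
  exchange i p j l := by
    have := congrArg (fun a => a ⊗ₜ[ℂ] (T (1 + 1) : ℂ[T;T⁻¹])) (ht i p j l)
    simp only [extMatrix_eq, shiftComatrix_apply, Ext.tmul_T_mul]
    simpa only [TensorProduct.sum_tmul, TensorProduct.smul_tmul'] using this

theorem isCovectorStructure (S : IsCovectorSymmetry R R' (extForm r lam) (extMatrix t)) :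
    IsCovectorStructure R R' lam t r S.braidedHopfAlgebra where
  coact_gen := S.coact_gen
  braiding_gen j l := by
    have := braiding_of_isSubcomodule (extForm r lam) (β := S.coact.toLinearMap)
      (w := Covector.gen R') (w' := Covector.gen R') (c := extMatrix t) (c' := extMatrix t)
      S.coact_gen S.coact_gen j l
    simp only [S.form] at this
    exact this
  cop_gen := S.cop_gen
  cou_gen := S.cou_gen
  anti_gen := S.anti_gen

theorem isComatrix_gExt : IsComatrix ℂ (fun _ _ : Unit => gExt ℂ A) := by
  have h : IsComatrix ℂ (fun _ _ : Unit => (1 : A)) :=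
    ⟨fun _ _ => by simp [Algebra.TensorProduct.one_def], fun _ _ => by simp⟩
  exact h.shift 1

theorem extForm_extMatrix_gExt (hA : IsMatrixQuantumGroup R lam t r) (b a : ι) :
    extForm r lam (extMatrix t b a) (gExt ℂ A) = lam⁻¹ * (1 : Matrix ι ι ℂ) b a := by
  rw [extMatrix_eq, shiftComatrix_apply, gExt, extForm_tmul_T, hA.dualQuasitriangular.one_right,
    hA.counit_t]
  simp [mul_comm]

theorem extForm_extMatrix_tmul_one (hA : IsMatrixQuantumGroup R lam t r) (b a c d : ι) :
    extForm r lam (extMatrix t b a) (t c d ⊗ₜ[ℂ] 1) = lam * R (b, c) (a, d) := by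
  rw [extMatrix_eq, shiftComatrix_apply, ← LaurentPolynomial.T_zero, extForm_tmul_T, hA.form_t]
  simp

theorem Subalgebra_ext_eq_top (hA : IsMatrixQuantumGroup R lam t r) (B : Subalgebra ℂ (Ext ℂ A))
    (ht : ∀ i j, t i j ⊗ₜ[ℂ] 1 ∈ B) (hg : gExt ℂ A ∈ B)
    (hg' : (1 : A) ⊗ₜ[ℂ] (T (-1) : ℂ[T;T⁻¹]) ∈ B) : B = ⊤ := by
  have h1 : ∀ a : A, a ⊗ₜ[ℂ] (1 : ℂ[T;T⁻¹]) ∈ B := by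
    have : Algebra.adjoin ℂ (Set.range fun p : ι × ι => t p.1 p.2) ≤
        B.comap (Algebra.TensorProduct.includeLeft : A →ₐ[ℂ] Ext ℂ A) := by
      rw [Algebra.adjoin_le_iff]
      rintro _ ⟨p, rfl⟩
      exact ht p.1 p.2
    rw [hA.adjoin_t] at this
    exact fun a => this (Algebra.mem_top (x := a))
  have h2 : ∀ m : ℤ, (1 : A) ⊗ₜ[ℂ] (T m : ℂ[T;T⁻¹]) ∈ B := by
    intro m
    obtain ⟨n, rfl | rfl⟩ := m.eq_nat_or_neg
    · have := B.pow_mem hg n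
      rwa [gExt, Algebra.TensorProduct.tmul_pow, one_pow, LaurentPolynomial.T_pow, mul_one] at this
    · have := B.pow_mem hg' n
      rwa [Algebra.TensorProduct.tmul_pow, one_pow, LaurentPolynomial.T_pow, mul_neg_one] at this
  refine eq_top_iff.mpr fun x hx => ?_
  clear hx
  induction x using Ext.induction with
  | add x y hx hy => exact B.add_mem hx hy
  | smul a x hx => exact B.smul_mem hx a
  | zero => exact B.zero_mem
  | base n c hc i j m =>
    have := B.mul_mem (h1 (c i j)) (h2 m)
    rwa [Algebra.TensorProduct.tmul_mul_tmul, mul_one, one_mul] at this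

theorem gExt_mul_inv : gExt ℂ A * (1 : A) ⊗ₜ[ℂ] (T (-1) : ℂ[T;T⁻¹]) = 1 := by
  rw [gExt, Ext.tmul_T_mul, Ext.one_def, mul_one]; rfl

theorem inv_mul_gExt : (1 : A) ⊗ₜ[ℂ] (T (-1) : ℂ[T;T⁻¹]) * gExt ℂ A = 1 := by
  rw [gExt, Ext.tmul_T_mul, Ext.one_def, mul_one]; rfl

theorem isComatrix_gExt_inv :
    IsComatrix ℂ (fun _ _ : Unit => ((1 : A) ⊗ₜ[ℂ] (T (-1) : ℂ[T;T⁻¹]) : Ext ℂ A)) := by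
  have h : IsComatrix ℂ (fun _ _ : Unit => (1 : A)) :=
    ⟨fun _ _ => by simp [Algebra.TensorProduct.one_def], fun _ _ => by simp⟩
  exact h.shift (-1)

theorem IsCovectorSymmetry.crossRow_of_crossRelations (hA : IsMatrixQuantumGroup R lam t r)
    (hlam : lam ≠ 0) (S : IsCovectorSymmetry R R' (extForm r lam) (extMatrix t))
    {C : Type*} [Ring C] [Algebra ℂ C] {f : Covector R' →ₐ[ℂ] C} {g : Ext ℂ A →ₐ[ℂ] C}
    (h : CrossRelations R R' lam t f g) : S.CrossRow (fun j => f (Covector.gen R' j)) g := by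
  apply S.crossRow_of_eq_top
  refine Subalgebra_ext_eq_top hA _ (fun c d => ?_) ?_ ?_
  · intro a
    have hc : IsComatrix ℂ (shiftComatrix (k := ℂ) t 0) := IsComatrix.shift ⟨hA.comul_t, hA.counit_t⟩ 0
    have h2 : ∀ b, S.crossMatrix g b a (t c d ⊗ₜ[ℂ] 1) =
        ∑ m, (lam * R (b, m) (a, d)) • g (t c m ⊗ₜ[ℂ] 1) := fun b => by
      have := S.crossMatrix_comatrix hc g b a c d
      simpa only [shiftComatrix_apply, LaurentPolynomial.T_zero,
        extForm_extMatrix_tmul_one hA] using this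
    rw [h.p_t]
    simp only [h2, Finset.smul_sum, Finset.sum_mul, smul_mul_assoc, smul_smul]
  · intro a
    have h2 : ∀ b, S.crossMatrix g b a (gExt ℂ A) = (lam⁻¹ * (1 : Matrix ι ι ℂ) b a) •
        g (gExt ℂ A) := fun b => by
      have := S.crossMatrix_comatrix isComatrix_gExt g b a () ()
      simpa [extForm_extMatrix_gExt hA] using this
    rw [h.p_g]
    simp [h2, Matrix.one_apply, ite_smul, ite_mul]
  · intro a
    have h2 : ∀ b, S.crossMatrix g b a (1 ⊗ₜ T (-1)) = (lam * (1 : Matrix ι ι ℂ) b a) •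
        g (1 ⊗ₜ T (-1)) := fun b => by
      have := S.crossMatrix_comatrix isComatrix_gExt_inv g b a () ()
      have h3 : extForm r lam (extMatrix t b a) (1 ⊗ₜ T (-1)) =
          lam * (1 : Matrix ι ι ℂ) b a := by
        rw [extMatrix_eq, shiftComatrix_apply, extForm_tmul_T,
          hA.dualQuasitriangular.one_right, hA.counit_t]
        simp [mul_comm]
      simpa [h3] using this
    have h3 : g (1 ⊗ₜ T (-1)) * g (gExt ℂ A) = 1 := by rw [← map_mul, inv_mul_gExt, map_one]
    have h4 : g (gExt ℂ A) * g (1 ⊗ₜ T (-1)) = 1 := by rw [← map_mul, gExt_mul_inv, map_one]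
    have h5 := congrArg (fun z => lam • (g (1 ⊗ₜ T (-1)) * z * g (1 ⊗ₜ T (-1)))) (h.p_g a)
    simp only [mul_assoc, h4, mul_one, mul_smul_comm, smul_mul_assoc, smul_smul,
      mul_inv_cancel₀ hlam, one_smul] at h5
    rw [← mul_assoc (g _) (g _), h3, one_mul] at h5
    simp [h2, Matrix.one_apply, ite_smul, ite_mul, h5]

theorem isExplicitSemidirect (hA : IsMatrixQuantumGroup R lam t r)
    (hlam : lam ≠ 0) (S : IsCovectorSymmetry R R' (extForm r lam) (extMatrix t)) :
    IsExplicitSemidirect R R' lam t S.inl S.inrBialgHom where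
  injective_i := S.inl_injective
  injective_j := S.inr_injective
  cross := {
    p_g := fun a => by
      have := S.p_mul_inr isComatrix_gExt a () ()
      simp only [extForm_extMatrix_gExt hA] at this
      refine this.trans ?_
      simp [Matrix.one_apply, ite_smul]
      rfl
    p_t := fun a c d => by
      have hc : IsComatrix ℂ (shiftComatrix (k := ℂ) t 0) :=
        IsComatrix.shift ⟨hA.comul_t, hA.counit_t⟩ 0
      have := S.p_mul_inr hc a c d
      simp only [shiftComatrix_apply, LaurentPolynomial.T_zero,
        extForm_extMatrix_tmul_one hA] at this
      refine this.trans ?_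
      rw [Finset.sum_comm]
      simp only [Finset.smul_sum, smul_smul]
      rfl }
  presented C _ _ f g h := by
    have hrow := S.crossRow_of_crossRelations hA hlam h
    refine ⟨S.lift ((Covector.isCovectorRow_gen R').map f) g hrow, ⟨?_, ?_⟩, ?_⟩
    · exact Covector.algHom_ext fun j => S.lift_p _ g hrow j
    · exact AlgHom.ext fun h => S.lift_inr _ g hrow h
    · rintro F ⟨hF1, hF2⟩
      refine S.algHom_ext (fun j => ?_) fun h => ?_
      · rw [S.lift_p]
        exact DFunLike.congr_fun hF1 (Covector.gen R' j)
      · rw [S.lift_inr]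
        exact DFunLike.congr_fun hF2 h
  comul_p a := by
    refine (S.comul_p a).trans ?_
    simp only [extMatrix_apply, map_mul]
    rfl
  comul_t a b := by
    have hc : IsComatrix ℂ (shiftComatrix (k := ℂ) t 0) :=
      IsComatrix.shift ⟨hA.comul_t, hA.counit_t⟩ 0
    exact S.comulHom_inr_comatrix hc a b
  comul_g := by
    refine (S.comulHom_inr_comatrix isComatrix_gExt () ()).trans ?_
    simp
    rfl

/-- The bosonization theorem for braided covectors. -/
theorem hasCovectorBosonization (hR : IsCovectorPair R R') (hlam : lam ≠ 0)
    (hA : IsMatrixQuantumGroup R lam t r) (ht : Exchange R' t t) :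
    HasCovectorBosonization R R' lam t r := by
  have S := hA.isCovectorSymmetry hR hlam ht
  exact ⟨hA.dualQuasitriangular.ext hlam, S.braidedHopfAlgebra, isCovectorStructure S,
    S.Semidirect, inferInstance, inferInstance, S.inl, S.inrBialgHom, S.isBosonization,
    isExplicitSemidirect hA hlam S⟩

end Main

section LegCalculus

variable {k : Type*} [Field k] {ι : Type*} [Fintype ι] [DecidableEq ι]
  {σ : Type*} [Fintype σ] [DecidableEq σ] {a b : σ}

/-- The multi-index `f` with its values at `a`, `b` replaced by `x`, `y`. -/
def setLegs (f : σ → ι) (a b : σ) (x y : ι) : σ → ι :=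
  Function.update (Function.update f a x) b y

theorem setLegs_left (hab : a ≠ b) (f : σ → ι) (x y : ι) : setLegs f a b x y a = x := by
  rw [setLegs, Function.update_of_ne hab, Function.update_self]

theorem setLegs_right (f : σ → ι) (x y : ι) : setLegs f a b x y b = y := by
  rw [setLegs, Function.update_self]

theorem setLegs_of_ne {c : σ} (ha : c ≠ a) (hb : c ≠ b) (f : σ → ι) (x y : ι) :
    setLegs f a b x y c = f c := by
  rw [setLegs, Function.update_of_ne hb, Function.update_of_ne ha]

theorem leg_mul_apply (hab : a ≠ b) (M : Matrix (ι × ι) (ι × ι) k) (N : Matrix (σ → ι) (σ → ι) k)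
    (f g : σ → ι) : (leg a b M * N) f g =
      ∑ x, ∑ y, M (f a, f b) (x, y) * N (setLegs f a b x y) g := by
  rw [Matrix.mul_apply, ← Fintype.sum_prod_type']
  symm
  refine Finset.sum_of_injOn (fun p : ι × ι => setLegs f a b p.1 p.2) ?_
    (fun _ _ => Finset.mem_coe.mpr (Finset.mem_univ _)) ?_ ?_
  · rintro ⟨x, y⟩ - ⟨x', y'⟩ - h
    have h1 := congrFun h a
    have h2 := congrFun h b
    simp only [setLegs_left hab, setLegs_right] at h1 h2
    rw [h1, h2]
  · rintro h - hh
    rw [leg, if_neg, zero_mul]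
    intro hc
    refine hh ⟨(h a, h b), Finset.mem_coe.mpr (Finset.mem_univ _), ?_⟩
    funext c
    dsimp only
    by_cases ha : c = a
    · rw [ha, setLegs_left hab]
    by_cases hb : c = b
    · rw [hb, setLegs_right]
    rw [setLegs_of_ne ha hb, hc c ha hb]
  · rintro ⟨x, y⟩ -
    rw [leg, if_pos fun c ha hb => (setLegs_of_ne ha hb f x y).symm, setLegs_left hab,
      setLegs_right]

theorem leg_mul_leg (hab : a ≠ b) (M N : Matrix (ι × ι) (ι × ι) k) :
    leg a b M * leg a b N = leg a b (M * N) := by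
  ext f g
  rw [leg_mul_apply hab]
  have h : ∀ x y, leg a b N (setLegs f a b x y) g =
      if ∀ c, c ≠ a → c ≠ b → f c = g c then N (x, y) (g a, g b) else 0 := fun x y => by
    rw [leg, setLegs_left hab, setLegs_right]
    refine if_congr ?_ rfl rfl
    refine forall_congr' fun c => forall_congr' fun ha => forall_congr' fun hb => ?_
    rw [setLegs_of_ne ha hb]
  simp only [h]
  rw [leg]
  split_ifs <;> simp [Matrix.mul_apply, Fintype.sum_prod_type]

theorem leg_one : leg a b (1 : Matrix (ι × ι) (ι × ι) k) = 1 := by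
  ext f g
  rw [leg, Matrix.one_apply, Matrix.one_apply, ← ite_and]
  refine if_congr ⟨fun h => funext fun c => ?_, fun h => ?_⟩ rfl rfl
  · obtain ⟨h1, h2⟩ := h
    rw [Prod.mk.injEq] at h2
    by_cases ha : c = a
    · rw [ha, h2.1]
    by_cases hb : c = b
    · rw [hb, h2.2]
    exact h1 c ha hb
  · rw [h]; exact ⟨fun _ _ _ => rfl, rfl⟩

theorem leg_add (M N : Matrix (ι × ι) (ι × ι) k) : leg a b (M + N) = leg a b M + leg a b N := by
  ext f g
  simp only [leg, Matrix.add_apply]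
  split_ifs <;> simp

theorem leg_smul (c : k) (M : Matrix (ι × ι) (ι × ι) k) : leg a b (c • M) = c • leg a b M := by
  ext f g
  simp only [leg, Matrix.smul_apply]
  split_ifs <;> simp

/-- The homomorphism `M ↦ M_{ab}`. -/
def legHom (k ι : Type*) [Field k] [Fintype ι] [DecidableEq ι] (hab : a ≠ b) :
    Matrix (ι × ι) (ι × ι) k →ₐ[k] Matrix (σ → ι) (σ → ι) k :=
  AlgHom.ofLinearMap ⟨⟨leg a b, leg_add⟩, leg_smul⟩ (leg_one)
    fun M N => (leg_mul_leg hab M N).symm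

theorem legHom_apply (hab : a ≠ b) (M : Matrix (ι × ι) (ι × ι) k) :
    legHom k ι hab M = leg a b M := rfl

theorem leg_flip (M : Matrix (ι × ι) (ι × ι) k) : leg b a M = leg a b (flipLegs M) := by
  ext f g
  simp only [leg, flipLegs, Matrix.submatrix_apply, Prod.swap_prod_mk]
  exact if_congr ⟨fun h c ha hb => h c hb ha, fun h c hb ha => h c ha hb⟩ rfl rfl

theorem leg_mul_leg_apply_of_disjoint {c d : σ} (hab : a ≠ b) (hca : c ≠ a) (hcb : c ≠ b)
    (hda : d ≠ a) (hdb : d ≠ b) (M N : Matrix (ι × ι) (ι × ι) k) (f g : σ → ι) :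
    (leg a b M * leg c d N) f g =
      if ∀ e, e ≠ a → e ≠ b → e ≠ c → e ≠ d → f e = g e then
        M (f a, f b) (g a, g b) * N (f c, f d) (g c, g d) else 0 := by
  rw [leg_mul_apply hab, Fintype.sum_eq_single (g a), Fintype.sum_eq_single (g b)]
  · rw [leg, setLegs_of_ne hca hcb, setLegs_of_ne hda hdb, mul_ite, mul_zero]
    refine if_congr ⟨fun h e ha hb hc hd => ?_, fun h e hc hd => ?_⟩ rfl rfl
    · rw [← h e hc hd, setLegs_of_ne ha hb]
    · by_cases ha : e = a
      · rw [ha, setLegs_left hab]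
      by_cases hb : e = b
      · rw [hb, setLegs_right]
      rw [setLegs_of_ne ha hb, h e ha hb hc hd]
  · intro y hy
    rw [leg, if_neg, mul_zero]
    intro h
    have := h b hcb.symm hdb.symm
    rw [setLegs_right] at this
    exact hy this
  · intro x hx
    refine Finset.sum_eq_zero fun y _ => ?_
    rw [leg, if_neg, mul_zero]
    intro h
    have := h a hca.symm hda.symm
    rw [setLegs_left hab] at this
    exact hx this

theorem leg_commute_of_disjoint {c d : σ} (hab : a ≠ b) (hcd : c ≠ d) (hca : c ≠ a) (hcb : c ≠ b)
    (hda : d ≠ a) (hdb : d ≠ b) (M N : Matrix (ι × ι) (ι × ι) k) :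
    leg a b M * leg c d N = leg c d N * leg a b M := by
  ext f g
  rw [leg_mul_leg_apply_of_disjoint hab hca hcb hda hdb,
    leg_mul_leg_apply_of_disjoint hcd hca.symm hda.symm hcb.symm hdb.symm]
  exact if_congr ⟨fun h e hc hd ha hb => h e ha hb hc hd, fun h e ha hb hc hd => h e hc hd ha hb⟩
    (mul_comm _ _) rfl

theorem leg_perm_mul_apply (hab : a ≠ b) (N : Matrix (σ → ι) (σ → ι) k) (f g : σ → ι) :
    (leg a b (perm k ι) * N) f g = N (f ∘ Equiv.swap a b) g := by
  rw [leg_mul_apply hab, Fintype.sum_eq_single (f b), Fintype.sum_eq_single (f a)]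
  · have : setLegs f a b (f b) (f a) = f ∘ Equiv.swap a b := by
      funext c
      by_cases ha : c = a
      · rw [ha, setLegs_left hab, Function.comp_apply, Equiv.swap_apply_left]
      by_cases hb : c = b
      · rw [hb, setLegs_right, Function.comp_apply, Equiv.swap_apply_right]
      rw [setLegs_of_ne ha hb, Function.comp_apply, Equiv.swap_apply_of_ne_of_ne ha hb]
    simp [perm, this]
  · intro y hy
    simp [perm, hy.symm]
  · intro x hx
    simp [perm, hx.symm]

theorem leg_relabel (e : Equiv.Perm σ) (M : Matrix (ι × ι) (ι × ι) k) (f g : σ → ι) :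
    leg a b M (f ∘ e) (g ∘ e) = leg (e a) (e b) M f g := by
  simp only [leg, Function.comp_apply]
  refine if_congr ⟨fun h c ha hb => ?_, fun h c ha hb => h _ (by simpa) (by simpa)⟩ rfl rfl
  have := h (e.symm c) (by rwa [Ne, Equiv.symm_apply_eq]) (by rwa [Ne, Equiv.symm_apply_eq])
  simpa using this

/-- Conjugation by a permutation matrix exchanges two legs. -/
theorem leg_perm_mul_leg (hab : a ≠ b) (c d : σ) (M : Matrix (ι × ι) (ι × ι) k) :
    leg a b (perm k ι) * leg c d M =
      leg (Equiv.swap a b c) (Equiv.swap a b d) M * leg a b (perm k ι) := by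
  have h1 : leg a b (perm k ι) * leg a b (perm k ι) = (1 : Matrix (σ → ι) (σ → ι) k) := by
    rw [leg_mul_leg hab, perm_mul_perm, leg_one]
  have h2 : leg a b (perm k ι) * leg c d M * leg a b (perm k ι) =
      leg (Equiv.swap a b c) (Equiv.swap a b d) M := by
    ext f g
    rw [mul_assoc, leg_perm_mul_apply hab, Matrix.mul_apply]
    have h3 : ∀ h, leg a b (perm k ι) h g = (1 : Matrix (σ → ι) (σ → ι) k) h (g ∘ Equiv.swap a b) :=
      fun h => by
        rw [← mul_one (leg a b _), leg_perm_mul_apply hab, Matrix.one_apply, Matrix.one_apply]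
        refine if_congr ⟨fun h' => ?_, fun h' => ?_⟩ rfl rfl
        · rw [← h']
          funext c
          simp
        · rw [h']
          funext c
          simp
    simp only [h3, ← leg_relabel, Matrix.one_apply, mul_ite, mul_one, mul_zero,
      Finset.sum_ite_eq', Finset.mem_univ, if_true]
  rw [← h2, mul_assoc, h1, mul_one]

theorem isUnit_leg (hab : a ≠ b) {M : Matrix (ι × ι) (ι × ι) k} (hM : IsUnit M) :
    IsUnit (leg a b M) := hM.map (legHom k ι hab)

end LegCalculus

section YangBaxter

variable {k : Type*} [Field k] {ι : Type*} [Fintype ι] [DecidableEq ι]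

theorem leg_qybe_left_apply (R S T : Matrix (ι × ι) (ι × ι) k) (f g : Fin 3 → ι) :
    (leg 0 1 R * leg 0 2 S * leg 1 2 T : Matrix (Fin 3 → ι) (Fin 3 → ι) k) f g = ∑ a, ∑ b, ∑ c,
      R (f 0, f 1) (a, b) * S (a, f 2) (g 0, c) * T (b, c) (g 1, g 2) := by
  rw [mul_assoc, leg_mul_apply (by decide)]
  refine Finset.sum_congr rfl fun a _ => Finset.sum_congr rfl fun b _ => ?_
  rw [leg_mul_apply (by decide)]
  have h : ∀ x c, leg 1 2 T (setLegs (setLegs f 0 1 a b) 0 2 x c) g =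
      if x = g 0 then T (b, c) (g 1, g 2) else 0 := fun x c => by
    simp [leg, setLegs, Fin.forall_fin_succ, Function.update]
  simp only [h, Finset.mul_sum]
  rw [Finset.sum_comm]
  simp [setLegs, mul_assoc]

theorem leg_qybe_right_apply (R S T : Matrix (ι × ι) (ι × ι) k) (f g : Fin 3 → ι) :
    (leg 1 2 T * leg 0 2 S * leg 0 1 R : Matrix (Fin 3 → ι) (Fin 3 → ι) k) f g = ∑ a, ∑ b, ∑ c,
      T (f 1, f 2) (b, c) * S (f 0, c) (a, g 2) * R (a, b) (g 0, g 1) := by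
  rw [mul_assoc, leg_mul_apply (by decide)]
  have h : ∀ b c x a, leg 0 1 R (setLegs (setLegs f 1 2 b c) 0 2 a x) g =
      if x = g 2 then R (a, b) (g 0, g 1) else 0 := fun b c x a => by
    simp [leg, setLegs, Fin.forall_fin_succ, Function.update]
  have h2 : ∀ b c, (leg 0 2 S * leg 0 1 R : Matrix (Fin 3 → ι) (Fin 3 → ι) k)
      (setLegs f 1 2 b c) g =
      ∑ a, S (f 0, c) (a, g 2) * R (a, b) (g 0, g 1) := fun b c => by
    rw [leg_mul_apply (by decide)]
    simp only [h]
    simp [setLegs]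
  simp only [h2, Finset.mul_sum, mul_assoc]
  rw [sum_rotate₃]

theorem isQYBE_iff (R : Matrix (ι × ι) (ι × ι) k) : IsQYBE R ↔ ∀ i p m j l n,
    ∑ a, ∑ b, ∑ c, R (i, p) (a, b) * R (a, m) (j, c) * R (b, c) (l, n) =
      ∑ a, ∑ b, ∑ c, R (p, m) (b, c) * R (i, c) (a, n) * R (a, b) (j, l) := by
  constructor
  · intro h i p m j l n
    have := congrFun (congrFun h ![i, p, m]) ![j, l, n]
    rw [leg_qybe_left_apply, leg_qybe_right_apply] at this
    exact this
  · intro h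
    ext f g
    rw [leg_qybe_left_apply, leg_qybe_right_apply]
    exact h _ _ _ _ _ _

theorem IsQYBE.relabel {R : Matrix (ι × ι) (ι × ι) k} (h : IsQYBE R) (e : Equiv.Perm (Fin 3)) :
    leg (e 0) (e 1) R * leg (e 0) (e 2) R * leg (e 1) (e 2) R =
      leg (e 1) (e 2) R * leg (e 0) (e 2) R * leg (e 0) (e 1) R := by
  have key : ∀ a b, leg (e a) (e b) R =
      (leg a b R).submatrix (Equiv.arrowCongr e.symm (Equiv.refl ι))
        (Equiv.arrowCongr e.symm (Equiv.refl ι)) := fun a b => by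
    ext f g
    exact (leg_relabel e R f g).symm
  have := congrArg (fun X => X.submatrix (Equiv.arrowCongr e.symm (Equiv.refl ι))
        (Equiv.arrowCongr e.symm (Equiv.refl ι))) h
  simpa only [key, Matrix.submatrix_mul_equiv] using this

/-- The matrix `(M₂₁)⁻¹`. -/
def invFlip (M : Matrix (ι × ι) (ι × ι) k) : Matrix (ι × ι) (ι × ι) k := flipLegs M⁻¹

theorem leg_invFlip {σ : Type*} [Fintype σ] [DecidableEq σ] {a b : σ}
    (M : Matrix (ι × ι) (ι × ι) k) : leg a b (invFlip M) = leg b a M⁻¹ := (leg_flip _).symm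

section Mixed

variable {R : Matrix (ι × ι) (ι × ι) k} (h : IsQYBE R) (hR : IsUnit R)
include hR

theorem leg_mul_leg_inv {σ : Type*} [Fintype σ] [DecidableEq σ] {a b : σ} (hab : a ≠ b) :
    leg a b R * leg a b R⁻¹ = 1 := by
  rw [leg_mul_leg hab, Matrix.mul_nonsing_inv _ ((Matrix.isUnit_iff_isUnit_det _).mp hR),
    leg_one]

theorem leg_inv_mul_leg {σ : Type*} [Fintype σ] [DecidableEq σ] {a b : σ} (hab : a ≠ b) :
    leg a b R⁻¹ * leg a b R = 1 := by
  rw [leg_mul_leg hab, Matrix.nonsing_inv_mul _ ((Matrix.isUnit_iff_isUnit_det _).mp hR),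
    leg_one]

include h

theorem IsQYBE.mixed_right : leg (0 : Fin 3) 1 R * leg 0 2 R * leg 1 2 (invFlip R) =
    leg 1 2 (invFlip R) * leg 0 2 R * leg 0 1 R := by
  have h1 := h.relabel (Equiv.swap 1 2)
  have h2 : leg (0 : Fin 3) 2 R * leg 0 1 R * leg 2 1 R = leg 2 1 R * leg 0 1 R * leg 0 2 R := h1
  rw [leg_invFlip]
  calc _ = leg (2 : Fin 3) 1 R⁻¹ * leg 2 1 R * (leg 0 1 R * leg 0 2 R) * leg 2 1 R⁻¹ := by
        rw [leg_inv_mul_leg hR (by decide), one_mul]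
    _ = leg (2 : Fin 3) 1 R⁻¹ * (leg 2 1 R * leg 0 1 R * leg 0 2 R) * leg 2 1 R⁻¹ := by
        simp only [mul_assoc]
    _ = leg (2 : Fin 3) 1 R⁻¹ * leg 0 2 R * leg 0 1 R * (leg 2 1 R * leg 2 1 R⁻¹) := by
        rw [← h2]
        simp only [mul_assoc]
    _ = _ := by rw [leg_mul_leg_inv hR (by decide), mul_one]

theorem IsQYBE.mixed_left : leg (0 : Fin 3) 1 (invFlip R) * leg 0 2 R * leg 1 2 R =
    leg 1 2 R * leg 0 2 R * leg 0 1 (invFlip R) := by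
  have h1 := h.relabel (Equiv.swap 0 1)
  have h2 : leg (1 : Fin 3) 0 R * leg 1 2 R * leg 0 2 R = leg 0 2 R * leg 1 2 R * leg 1 0 R := h1
  rw [leg_invFlip]
  calc _ = leg (1 : Fin 3) 0 R⁻¹ * (leg 0 2 R * leg 1 2 R) * (leg 1 0 R * leg 1 0 R⁻¹) := by
        rw [leg_mul_leg_inv hR (by decide), mul_one, mul_assoc]
    _ = leg (1 : Fin 3) 0 R⁻¹ * (leg 0 2 R * leg 1 2 R * leg 1 0 R) * leg 1 0 R⁻¹ := by
        simp only [mul_assoc]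
    _ = (leg (1 : Fin 3) 0 R⁻¹ * leg 1 0 R) * (leg 1 2 R * leg 0 2 R * leg 1 0 R⁻¹) := by
        rw [← h2]
        simp only [mul_assoc]
    _ = _ := by rw [leg_inv_mul_leg hR (by decide), one_mul]

theorem IsQYBE.mixed_right_right :
    leg (0 : Fin 3) 1 R * leg 0 2 (invFlip R) * leg 1 2 (invFlip R) =
      leg 1 2 (invFlip R) * leg 0 2 (invFlip R) * leg 0 1 R := by
  have h1 := h.relabel (Equiv.swap 0 2 * Equiv.swap 1 2)
  have h2 : leg (2 : Fin 3) 0 R * leg 2 1 R * leg 0 1 R = leg 0 1 R * leg 2 1 R * leg 2 0 R := h1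
  rw [leg_invFlip, leg_invFlip]
  have e1 : leg (2 : Fin 3) 1 R⁻¹ * leg 2 0 R⁻¹ * (leg 2 0 R * leg 2 1 R) = 1 := by
    rw [mul_assoc, ← mul_assoc (leg 2 0 R⁻¹), leg_inv_mul_leg hR (by decide), one_mul,
      leg_inv_mul_leg hR (by decide)]
  have e2 : leg (2 : Fin 3) 1 R * leg 2 0 R * (leg 2 0 R⁻¹ * leg 2 1 R⁻¹) = 1 := by
    rw [mul_assoc, ← mul_assoc (leg 2 0 R), leg_mul_leg_inv hR (by decide), one_mul,
      leg_mul_leg_inv hR (by decide)]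
  calc _ = (leg (2 : Fin 3) 1 R⁻¹ * leg 2 0 R⁻¹ * (leg 2 0 R * leg 2 1 R)) * (leg 0 1 R *
        (leg 2 0 R⁻¹ * leg 2 1 R⁻¹)) := by rw [e1, one_mul, mul_assoc]
    _ = leg (2 : Fin 3) 1 R⁻¹ * leg 2 0 R⁻¹ * (leg 2 0 R * leg 2 1 R * leg 0 1 R) *
        (leg 2 0 R⁻¹ * leg 2 1 R⁻¹) := by simp only [mul_assoc]
    _ = leg (2 : Fin 3) 1 R⁻¹ * leg 2 0 R⁻¹ * leg 0 1 R * (leg 2 1 R * leg 2 0 R *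
        (leg 2 0 R⁻¹ * leg 2 1 R⁻¹)) := by
        rw [h2]
        simp only [mul_assoc]
    _ = _ := by rw [e2, mul_one]

theorem IsQYBE.mixed_left_left :
    leg (0 : Fin 3) 1 (invFlip R) * leg 0 2 (invFlip R) * leg 1 2 R =
      leg 1 2 R * leg 0 2 (invFlip R) * leg 0 1 (invFlip R) := by
  have h1 := h.relabel (Equiv.swap 0 1 * Equiv.swap 1 2)
  have h2 : leg (1 : Fin 3) 2 R * leg 1 0 R * leg 2 0 R = leg 2 0 R * leg 1 0 R * leg 1 2 R := h1
  rw [leg_invFlip, leg_invFlip]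
  have e1 : leg (1 : Fin 3) 0 R⁻¹ * leg 2 0 R⁻¹ * (leg 2 0 R * leg 1 0 R) = 1 := by
    rw [mul_assoc, ← mul_assoc (leg 2 0 R⁻¹), leg_inv_mul_leg hR (by decide), one_mul,
      leg_inv_mul_leg hR (by decide)]
  have e2 : leg (1 : Fin 3) 0 R * leg 2 0 R * (leg 2 0 R⁻¹ * leg 1 0 R⁻¹) = 1 := by
    rw [mul_assoc, ← mul_assoc (leg 2 0 R), leg_mul_leg_inv hR (by decide), one_mul,
      leg_mul_leg_inv hR (by decide)]
  calc _ = leg (1 : Fin 3) 0 R⁻¹ * leg 2 0 R⁻¹ * leg 1 2 R * (leg 1 0 R * leg 2 0 R *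
        (leg 2 0 R⁻¹ * leg 1 0 R⁻¹)) := by rw [e2, mul_one]
    _ = leg (1 : Fin 3) 0 R⁻¹ * leg 2 0 R⁻¹ * (leg 1 2 R * leg 1 0 R * leg 2 0 R) *
        (leg 2 0 R⁻¹ * leg 1 0 R⁻¹) := by simp only [mul_assoc]
    _ = (leg (1 : Fin 3) 0 R⁻¹ * leg 2 0 R⁻¹ * (leg 2 0 R * leg 1 0 R)) *
        (leg 1 2 R * (leg 2 0 R⁻¹ * leg 1 0 R⁻¹)) := by
        rw [h2]
        simp only [mul_assoc]
    _ = _ := by rw [e1, one_mul, mul_assoc]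

end Mixed

end YangBaxter

section ExchangeProducts

variable {k : Type*} [Field k] {ι : Type*} [Fintype ι] [DecidableEq ι] {Q : Type*} [Ring Q]
  [Algebra k Q] {M : Matrix (ι × ι) (ι × ι) k} {u v u' v' : Matrix ι ι Q}

theorem matMul_mul (h : ∀ i j p l, u' i j * v p l = v p l * u' i j) :
    matMul (u * u') (v * v') = matMul u v * matMul u' v' := by
  ext x y
  simp only [matMul, Matrix.mul_apply, Finset.sum_mul_sum, Fintype.sum_prod_type]
  refine Finset.sum_congr rfl fun a _ => Finset.sum_congr rfl fun b _ => ?_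
  rw [mul_assoc, ← mul_assoc (u' _ _), h, mul_assoc, mul_assoc]

theorem matMul_one_one : matMul (1 : Matrix ι ι Q) 1 = 1 := by
  ext ⟨a, b⟩ ⟨c, d⟩
  simp only [matMul, Matrix.one_apply, Prod.mk.injEq]
  split_ifs <;> simp_all

theorem Exchange.one : Exchange M (1 : Matrix ι ι Q) 1 := by
  rw [exchange_iff, matMul_one_one, mul_one, one_mul]

theorem Exchange.mul (huv : Exchange M u v) (huv' : Exchange M u' v')
    (h1 : ∀ i j p l, u' i j * v p l = v p l * u' i j)
    (h2 : ∀ i j p l, v' i j * u p l = u p l * v' i j) : Exchange M (u * u') (v * v') := by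
  rw [exchange_iff] at huv huv' ⊢
  rw [matMul_mul h1, matMul_mul h2, ← mul_assoc, huv, mul_assoc, huv', mul_assoc]

/-- The matrix of products `v₂ u₁` of entries, in the order opposite to `matMul`. -/
def matMulRev (u v : Matrix ι ι Q) : Matrix (ι × ι) (ι × ι) Q := fun x y => v x.2 y.2 * u x.1 y.1

theorem matMul_mul_matMulRev (hu : u * u' = 1) (hv : v * v' = 1) :
    matMul u v * matMulRev u' v' = 1 := by
  ext ⟨a, b⟩ ⟨c, d⟩
  have h : (matMul u v * matMulRev u' v') (a, b) (c, d) =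
      ∑ i, u a i * (v * v') b d * u' i c := by
    simp only [Matrix.mul_apply, Fintype.sum_prod_type, matMul, matMulRev, Finset.mul_sum,
      Finset.sum_mul, mul_assoc]
  have h2 : ∑ i, u a i * u' i c = (1 : Matrix ι ι Q) a c := by rw [← hu, Matrix.mul_apply]
  rw [h, hv, ← matMul_one_one]
  simp only [matMul, ← h2, Matrix.one_apply]
  split_ifs <;> simp

theorem matMulRev_mul_matMul (hu : u' * u = 1) (hv : v' * v = 1) :
    matMulRev u' v' * matMul u v = 1 := by
  ext ⟨a, b⟩ ⟨c, d⟩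
  have h : (matMulRev u' v' * matMul u v) (a, b) (c, d) =
      ∑ i, v' b i * (u' * u) a c * v i d := by
    simp only [Matrix.mul_apply, Fintype.sum_prod_type, matMul, matMulRev, Finset.mul_sum,
      Finset.sum_mul, mul_assoc]
    exact Finset.sum_comm
  have h2 : ∑ i, v' b i * v i d = (1 : Matrix ι ι Q) b d := by rw [← hv, Matrix.mul_apply]
  rw [h, hu, ← matMul_one_one]
  simp only [matMul, ← h2, Matrix.one_apply]
  split_ifs <;> simp

theorem matMul_map_op (x y : ι × ι) : matMul (u.map MulOpposite.op) (v.map MulOpposite.op) x y =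
    MulOpposite.op (matMulRev u v x y) := rfl

theorem exchange_map_op_iff : Exchange M (u.map MulOpposite.op) (v.map MulOpposite.op) ↔
    braid Q M * matMulRev u v = matMulRev v u * braid Q M := by
  rw [exchange_iff]
  have h1 : braid Qᵐᵒᵖ M * matMul (u.map MulOpposite.op) (v.map MulOpposite.op) =
      (braid Q M * matMulRev u v).map MulOpposite.op := by
    ext ⟨a, b⟩ y
    simp only [Matrix.mul_apply, Fintype.sum_prod_type, Matrix.map_apply, braid_apply,
      matMul_map_op, Finset.op_sum, MulOpposite.algebraMap_apply, ← MulOpposite.op_mul,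
      Algebra.commutes]
  have h2 : matMul (v.map MulOpposite.op) (u.map MulOpposite.op) * braid Qᵐᵒᵖ M =
      (matMulRev v u * braid Q M).map MulOpposite.op := by
    ext x y
    simp only [Matrix.mul_apply, Fintype.sum_prod_type, Matrix.map_apply, braid_apply,
      matMul_map_op, Finset.op_sum, MulOpposite.algebraMap_apply, ← MulOpposite.op_mul,
      Algebra.commutes]
  rw [h1, h2]
  exact (Matrix.map_injective MulOpposite.op_injective).eq_iff

theorem Exchange.inv_op (h : Exchange M u v) (hu : u * u' = 1) (hu' : u' * u = 1)
    (hv : v * v' = 1) (hv' : v' * v = 1) :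
    Exchange M (u'.map MulOpposite.op) (v'.map MulOpposite.op) := by
  rw [exchange_iff] at h
  rw [exchange_map_op_iff]
  calc _ = matMulRev v' u' * matMul v u * braid Q M * matMulRev u' v' := by
        rw [matMulRev_mul_matMul hv' hu', one_mul]
    _ = matMulRev v' u' * (braid Q M * matMul u v) * matMulRev u' v' := by
        rw [h, mul_assoc (matMulRev v' u')]
    _ = _ := by rw [mul_assoc, mul_assoc, matMul_mul_matMulRev hu hv, mul_one]

end ExchangeProducts

section SpinAlgebra

/-- The invariant vector `ε^{01} = 1`, `ε^{10} = -q⁻¹` of the `q`-determinant. -/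
def qEps (Q : Type*) [Ring Q] [Algebra ℂ Q] (q : ℂ) : Fin 2 × Fin 2 → Q := fun p =>
  algebraMap ℂ Q (!![0, 1; -q⁻¹, 0] p.1 p.2)

variable {Q : Type*} [Ring Q] [Algebra ℂ Q] {q : ℂ}

theorem matMul_mulVec_qEps (u v : Matrix (Fin 2) (Fin 2) Q) (i k : Fin 2) :
    (matMul u v).mulVec (qEps Q q) (i, k) = u i 0 * v k 1 - q⁻¹ • (u i 1 * v k 0) := by
  simp [Matrix.mulVec, dotProduct, Fintype.sum_prod_type, matMul, qEps, Fin.sum_univ_two,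
    Algebra.smul_def, ← Algebra.commutes, sub_eq_add_neg]

/-- A pair of matrices that satisfies the relations of the `q`-Lorentz spin group. -/
structure IsSpinFamily (q : ℂ) (V : Bool → Matrix (Fin 2) (Fin 2) Q) : Prop where
  tt : Exchange (slR q) (V false) (V false)
  ss : Exchange (slR q) (V true) (V true)
  st : Exchange (slR q) (V true) (V false)
  det : ∀ c, (matMul (V c) (V c)).mulVec (qEps Q q) = qEps Q q

theorem IsSpinFamily.mul {V W : Bool → Matrix (Fin 2) (Fin 2) Q} (hV : IsSpinFamily q V)
    (hW : IsSpinFamily q W) (h : ∀ c d i j k l, W c i j * V d k l = V d k l * W c i j) :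
    IsSpinFamily q (fun c => V c * W c) where
  tt := hV.tt.mul hW.tt (h _ _) (h _ _)
  ss := hV.ss.mul hW.ss (h _ _) (h _ _)
  st := hV.st.mul hW.st (h _ _) (h _ _)
  det c := by rw [matMul_mul (h c c), ← Matrix.mulVec_mulVec, hW.det, hV.det]

theorem IsSpinFamily.one : IsSpinFamily q (fun _ => (1 : Matrix (Fin 2) (Fin 2) Q)) where
  tt := Exchange.one
  ss := Exchange.one
  st := Exchange.one
  det _ := by rw [matMul_one_one, Matrix.one_mulVec]

theorem IsSpinFamily.map {V : Bool → Matrix (Fin 2) (Fin 2) Q} (hV : IsSpinFamily q V)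
    {Q' : Type*} [Ring Q'] [Algebra ℂ Q'] (f : Q →ₐ[ℂ] Q') :
    IsSpinFamily q (fun c => (V c).map f) where
  tt := hV.tt.map f
  ss := hV.ss.map f
  st := hV.st.map f
  det c := by
    ext ⟨i, k⟩
    have := congrArg f (congrFun (hV.det c) (i, k))
    rw [matMul_mulVec_qEps] at this ⊢
    simpa [qEps] using this

theorem IsSpinFamily.inv_op {V W : Bool → Matrix (Fin 2) (Fin 2) Q} (hV : IsSpinFamily q V)
    (h1 : ∀ c, V c * W c = 1) (h2 : ∀ c, W c * V c = 1) :
    IsSpinFamily q (fun c => (W c).map MulOpposite.op) where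
  tt := hV.tt.inv_op (h1 _) (h2 _) (h1 _) (h2 _)
  ss := hV.ss.inv_op (h1 _) (h2 _) (h1 _) (h2 _)
  st := hV.st.inv_op (h1 _) (h2 _) (h1 _) (h2 _)
  det c := by
    have h : (matMulRev (W c) (W c)).mulVec (qEps Q q) = qEps Q q := by
      conv_lhs => rw [← hV.det c, Matrix.mulVec_mulVec, matMulRev_mul_matMul (h2 c) (h2 c),
        Matrix.one_mulVec]
    ext x
    have hx := congrArg MulOpposite.op (congrFun h x)
    refine Eq.trans ?_ hx
    simp only [Matrix.mulVec, dotProduct, matMul_map_op, qEps, MulOpposite.algebraMap_apply,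
      ← MulOpposite.op_mul, Finset.op_sum, Algebra.commutes]

theorem exchange_slR_relations (hq : q ≠ 0) {u : Matrix (Fin 2) (Fin 2) Q}
    (h : Exchange (slR q) u u) :
    u 0 1 * u 0 0 = q • (u 0 0 * u 0 1) ∧ u 1 1 * u 1 0 = q • (u 1 0 * u 1 1) ∧
    u 1 0 * u 0 0 = q • (u 0 0 * u 1 0) ∧ u 1 1 * u 0 1 = q • (u 0 1 * u 1 1) ∧
    u 1 0 * u 0 1 = u 0 1 * u 1 0 ∧
    u 1 1 * u 0 0 = u 0 0 * u 1 1 + (q - q⁻¹) • (u 0 1 * u 1 0) := by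
  have e1 := h 0 0 0 1
  have e2 := h 1 1 0 1
  have e3 := h 0 1 0 0
  have e4 := h 0 1 1 1
  have e5 := h 1 0 0 1
  have e6 := h 0 1 0 1
  simp [slR, Fin.sum_univ_two] at e1 e2 e3 e4 e5 e6
  refine ⟨e1.symm, e2.symm, ?_, ?_, e5, ?_⟩
  · have : q⁻¹ • (u 1 0 * u 0 0) = u 0 0 * u 1 0 := by
      rw [sub_smul] at e3
      have := sub_eq_zero.mpr e3
      rw [← sub_eq_zero, ← neg_eq_zero, ← this]
      abel
    rw [← this, smul_smul, mul_inv_cancel₀ hq, one_smul]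
  · have : q⁻¹ • (u 1 1 * u 0 1) = u 0 1 * u 1 1 := by
      rw [sub_smul] at e4
      have := sub_eq_zero.mpr e4
      rw [← sub_eq_zero, ← neg_eq_zero, ← this]
      abel
    rw [← this, smul_smul, mul_inv_cancel₀ hq, one_smul]
  · rw [← e6, e5]

theorem mulVec_qEps_of_det (hq : q ≠ 0) {u : Matrix (Fin 2) (Fin 2) Q} (h : Exchange (slR q) u u)
    (hdet : u 0 0 * u 1 1 - q⁻¹ • (u 0 1 * u 1 0) = 1) :
    (matMul u u).mulVec (qEps Q q) = qEps Q q := by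
  obtain ⟨r1, r2, r3, r4, r5, r6⟩ := exchange_slR_relations hq h
  ext ⟨i, k⟩
  rw [matMul_mulVec_qEps]
  fin_cases i <;> fin_cases k
  · simp [qEps, r1, smul_smul, inv_mul_cancel₀ hq]
  · simpa [qEps] using hdet
  · have : u 0 0 * u 1 1 = 1 + q⁻¹ • (u 0 1 * u 1 0) := by rw [← hdet]; abel
    simp only [Fin.mk_one, Fin.zero_eta, r5, r6, this]
    simp [qEps, smul_add, sub_smul, smul_smul, inv_mul_cancel₀ hq,
      Algebra.algebraMap_eq_smul_one]
  · simp [qEps, r2, smul_smul, inv_mul_cancel₀ hq]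

/-- The inverse of a matrix of generators of `SL_q(2)`. -/
def spinInv (q : ℂ) (u : Matrix (Fin 2) (Fin 2) Q) : Matrix (Fin 2) (Fin 2) Q :=
  !![u 1 1, -(q • u 0 1); -(q⁻¹ • u 1 0), u 0 0]

theorem mul_spinInv (hq : q ≠ 0) {u : Matrix (Fin 2) (Fin 2) Q} (h : Exchange (slR q) u u)
    (hdet : u 0 0 * u 1 1 - q⁻¹ • (u 0 1 * u 1 0) = 1) : u * spinInv q u = 1 := by
  obtain ⟨r1, r2, r3, r4, r5, r6⟩ := exchange_slR_relations hq h
  have : u 0 0 * u 1 1 = 1 + q⁻¹ • (u 0 1 * u 1 0) := by rw [← hdet]; abel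
  ext i j
  fin_cases i <;> fin_cases j <;>
    simp [Matrix.mul_apply, spinInv, Fin.sum_univ_two, r1, r2, r5, r6, this, smul_smul,
      inv_mul_cancel₀ hq, sub_smul]

theorem spinInv_mul (hq : q ≠ 0) {u : Matrix (Fin 2) (Fin 2) Q} (h : Exchange (slR q) u u)
    (hdet : u 0 0 * u 1 1 - q⁻¹ • (u 0 1 * u 1 0) = 1) : spinInv q u * u = 1 := by
  obtain ⟨r1, r2, r3, r4, r5, r6⟩ := exchange_slR_relations hq h
  have : u 0 0 * u 1 1 = 1 + q⁻¹ • (u 0 1 * u 1 0) := by rw [← hdet]; abel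
  ext i j
  fin_cases i <;> fin_cases j <;>
    simp [Matrix.mul_apply, spinInv, Fin.sum_univ_two, r3, r4, r5, r6, this, smul_smul,
      inv_mul_cancel₀ hq, sub_smul]

/-- The generators of the `q`-Lorentz spin group: `t` for `false` and `s` for `true`. -/
def spinGen : Bool → Fin 2 → Fin 2 → SpinGen
  | false => SpinGen.t
  | true => SpinGen.s

/-- The matrices `t` and `s` of generators of the `q`-Lorentz spin group. -/
def spinU (q : ℂ) (c : Bool) : Matrix (Fin 2) (Fin 2) (SpinLorentz q) := fun i j =>
  RingQuot.mkAlgHom ℂ (SpinRel q) (FreeAlgebra.ι ℂ (spinGen c i j))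

theorem exchange_spinU {c d : Bool} (h : ∀ i k j l, SpinRel q
    (exchangeLeft q (spinGen c) (spinGen d) i k j l)
    (exchangeRight q (spinGen c) (spinGen d) i k j l)) :
    Exchange (slR q) (spinU q c) (spinU q d) := fun i k j l => by
  have := RingQuot.mkAlgHom_rel ℂ (h i k j l)
  simp only [exchangeLeft, exchangeRight, map_sum, map_smul, map_mul] at this
  exact this

theorem spinU_det (c : Bool) : spinU q c 0 0 * spinU q c 1 1 -
    q⁻¹ • (spinU q c 0 1 * spinU q c 1 0) = 1 := by
  have h : SpinRel q (qdet q (spinGen c)) 1 := by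
    cases c
    · exact SpinRel.det_t
    · exact SpinRel.det_s
  have := RingQuot.mkAlgHom_rel ℂ h
  simp only [qdet, map_sub, map_smul, map_mul, map_one] at this
  exact this

theorem exchange_spinU_self : ∀ c, Exchange (slR q) (spinU q c) (spinU q c)
  | false => exchange_spinU SpinRel.tt
  | true => exchange_spinU SpinRel.ss

theorem exchange_spinU_st : Exchange (slR q) (spinU q true) (spinU q false) :=
  exchange_spinU SpinRel.st

theorem isSpinFamily_spinU (hq : q ≠ 0) : IsSpinFamily q (spinU q) where
  tt := exchange_spinU_self false
  ss := exchange_spinU_self true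
  st := exchange_spinU_st
  det c := mulVec_qEps_of_det hq (exchange_spinU_self c) (spinU_det c)

/-- The images of the generators under a map to an algebra. -/
def spinGenMap (V : Bool → Matrix (Fin 2) (Fin 2) Q) : SpinGen → Q
  | .t i j => V false i j
  | .s i j => V true i j

/-- The algebra map from the `q`-Lorentz spin group given by matrices that satisfy its relations. -/
def spinLift {V : Bool → Matrix (Fin 2) (Fin 2) Q} (h : IsSpinFamily q V) :
    SpinLorentz q →ₐ[ℂ] Q :=
  RingQuot.liftAlgHom ℂ ⟨FreeAlgebra.lift ℂ (spinGenMap V), fun x y hxy => by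
    have hd : ∀ c, V c 0 0 * V c 1 1 - q⁻¹ • (V c 0 1 * V c 1 0) = 1 := fun c => by
      have := congrFun (h.det c) (0, 1)
      rw [matMul_mulVec_qEps] at this
      simpa [qEps] using this
    cases hxy with
    | tt i k j l => simpa [exchangeLeft, exchangeRight, spinGenMap] using h.tt i k j l
    | ss i k j l => simpa [exchangeLeft, exchangeRight, spinGenMap] using h.ss i k j l
    | st i k j l => simpa [exchangeLeft, exchangeRight, spinGenMap] using h.st i k j l
    | det_t => simpa [qdet, spinGenMap] using hd false
    | det_s => simpa [qdet, spinGenMap] using hd true⟩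

@[simp] theorem spinLift_spinU {V : Bool → Matrix (Fin 2) (Fin 2) Q} (h : IsSpinFamily q V)
    (c : Bool) (i j : Fin 2) : spinLift h (spinU q c i j) = V c i j := by
  rw [spinU, spinLift, RingQuot.liftAlgHom_mkAlgHom_apply]
  cases c <;> simp [spinGen, spinGenMap]

theorem spinAlgHom_ext {f g : SpinLorentz q →ₐ[ℂ] Q}
    (h : ∀ c i j, f (spinU q c i j) = g (spinU q c i j)) : f = g := by
  refine RingQuot.ringQuot_ext' ℂ f g (FreeAlgebra.hom_ext (funext fun x => ?_))
  cases x with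
  | t i j => exact h false i j
  | s i j => exact h true i j

theorem adjoin_spinU : Algebra.adjoin ℂ
    (Set.range fun p : Bool × Fin 2 × Fin 2 => spinU q p.1 p.2.1 p.2.2) = ⊤ := by
  have h1 : ∀ x, RingQuot.mkAlgHom ℂ (SpinRel q) (FreeAlgebra.ι ℂ x) ∈ Algebra.adjoin ℂ
      (Set.range fun p : Bool × Fin 2 × Fin 2 => spinU q p.1 p.2.1 p.2.2) := fun x => by
    cases x with
    | t i j => exact Algebra.subset_adjoin ⟨(false, i, j), rfl⟩
    | s i j => exact Algebra.subset_adjoin ⟨(true, i, j), rfl⟩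
  rw [eq_top_iff, ← (AlgHom.range_eq_top _).mpr (RingQuot.mkAlgHom_surjective ℂ (SpinRel q)),
    ← Algebra.map_top, ← FreeAlgebra.adjoin_range_ι, AlgHom.map_adjoin, Algebra.adjoin_le_iff]
  rintro _ ⟨_, ⟨x, rfl⟩, rfl⟩
  exact h1 x

/-- The coproduct of the `q`-Lorentz spin group. -/
def spinComul (hq : q ≠ 0) : SpinLorentz q →ₐ[ℂ] SpinLorentz q ⊗[ℂ] SpinLorentz q :=
  spinLift (((isSpinFamily_spinU hq).map Algebra.TensorProduct.includeLeft).mul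
    ((isSpinFamily_spinU hq).map (Q' := SpinLorentz q ⊗[ℂ] SpinLorentz q)
      Algebra.TensorProduct.includeRight) fun c d i j k l => by simp)

theorem spinComul_spinU (hq : q ≠ 0) (c : Bool) (i j : Fin 2) : spinComul hq (spinU q c i j) =
    ∑ a, spinU q c i a ⊗ₜ[ℂ] spinU q c a j := by
  rw [spinComul, spinLift_spinU]
  simp [Matrix.mul_apply]

/-- The counit of the `q`-Lorentz spin group. -/
def spinCounit (q : ℂ) : SpinLorentz q →ₐ[ℂ] ℂ := spinLift IsSpinFamily.one

theorem spinCounit_spinU (c : Bool) (i j : Fin 2) :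
    spinCounit q (spinU q c i j) = (1 : Matrix (Fin 2) (Fin 2) ℂ) i j := spinLift_spinU _ c i j

instance [NeZero q] : Bialgebra ℂ (SpinLorentz q) :=
  Bialgebra.ofAlgHom (spinComul (NeZero.ne q)) (spinCounit q)
    (spinAlgHom_ext (Q := SpinLorentz q ⊗[ℂ] (SpinLorentz q ⊗[ℂ] SpinLorentz q)) fun c i j => by
      simp [spinComul_spinU, TensorProduct.sum_tmul, TensorProduct.tmul_sum, -Fin.sum_univ_two]
      exact Finset.sum_comm)
    (spinAlgHom_ext (Q := ℂ ⊗[ℂ] SpinLorentz q) fun c i j => by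
      simp [spinComul_spinU, spinCounit_spinU, Matrix.one_apply, TensorProduct.ite_tmul,
        -Fin.sum_univ_two])
    (spinAlgHom_ext (Q := SpinLorentz q ⊗[ℂ] ℂ) fun c i j => by
      simp [spinComul_spinU, spinCounit_spinU, Matrix.one_apply, TensorProduct.tmul_ite,
        -Fin.sum_univ_two])

variable [NeZero q]

theorem isComatrix_spinU (c : Bool) : IsComatrix ℂ (spinU q c) where
  comul_eq := spinComul_spinU (NeZero.ne q) c
  counit_eq := spinCounit_spinU c

/-- The antipode of the `q`-Lorentz spin group, as a map to the opposite algebra. -/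
def spinAntipode (q : ℂ) [NeZero q] : SpinLorentz q →ₐ[ℂ] (SpinLorentz q)ᵐᵒᵖ :=
  spinLift ((isSpinFamily_spinU (NeZero.ne q)).inv_op (W := fun c => spinInv q (spinU q c))
    (fun c => mul_spinInv (NeZero.ne q) (exchange_spinU_self c) (spinU_det c))
    (fun c => spinInv_mul (NeZero.ne q) (exchange_spinU_self c) (spinU_det c)))

theorem spinAntipode_spinU (c : Bool) (i j : Fin 2) :
    (spinAntipode q (spinU q c i j)).unop = spinInv q (spinU q c) i j :=
  congrArg MulOpposite.unop (spinLift_spinU _ c i j)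

theorem antipodeSubalgebra_spinAntipode : antipodeSubalgebra (spinAntipode q) = ⊤ := by
  rw [eq_top_iff, ← adjoin_spinU, Algebra.adjoin_le_iff]
  rintro _ ⟨⟨c, i, j⟩, rfl⟩
  constructor
  · have h := congrFun (congrFun (spinInv_mul (NeZero.ne q) (exchange_spinU_self c)
      (spinU_det c)) i) j
    rw [Matrix.mul_apply] at h
    simp only [(isComatrix_spinU (q := q) c).comul_eq, (isComatrix_spinU (q := q) c).counit_eq, map_sum,
      LinearMap.rTensor_tmul, LinearMap.mul'_apply, LinearMap.comp_apply,
      AlgHom.toLinearMap_apply, LinearEquiv.coe_coe, MulOpposite.coe_opLinearEquiv_symm,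
      spinAntipode_spinU, h, Matrix.one_apply]
    split_ifs <;> simp
  · have h := congrFun (congrFun (mul_spinInv (NeZero.ne q) (exchange_spinU_self c)
      (spinU_det c)) i) j
    rw [Matrix.mul_apply] at h
    simp only [(isComatrix_spinU (q := q) c).comul_eq, (isComatrix_spinU (q := q) c).counit_eq, map_sum,
      LinearMap.lTensor_tmul, LinearMap.mul'_apply, LinearMap.comp_apply,
      AlgHom.toLinearMap_apply, LinearEquiv.coe_coe, MulOpposite.coe_opLinearEquiv_symm,
      spinAntipode_spinU, h, Matrix.one_apply]
    split_ifs <;> simp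

instance : HopfAlgebra ℂ (SpinLorentz q) :=
  hopfAlgebraOfAntihom (spinAntipode q) antipodeSubalgebra_spinAntipode

theorem antipode_spinU (c : Bool) (i j : Fin 2) :
    antipode ℂ (spinU q c i j) = spinInv q (spinU q c) i j := spinAntipode_spinU c i j

end SpinAlgebra

section SpinRMatrix

variable {q : ℂ}

theorem slR_mul_slR_inv (hq : q ≠ 0) : slR q * slR q⁻¹ = 1 := by
  ext ⟨i, k⟩ ⟨j, l⟩
  rw [Matrix.mul_apply, Fintype.sum_prod_type]
  fin_cases i <;> fin_cases k <;> fin_cases j <;> fin_cases l <;>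
    simp [slR, hq]

theorem slR_inv (hq : q ≠ 0) : (slR q)⁻¹ = slR q⁻¹ := Matrix.inv_eq_right_inv (slR_mul_slR_inv hq)

theorem isUnit_slR (hq : q ≠ 0) : IsUnit (slR q) := by
  have h := slR_mul_slR_inv (inv_ne_zero hq)
  rw [inv_inv] at h
  exact ⟨⟨slR q, slR q⁻¹, slR_mul_slR_inv hq, h⟩, rfl⟩

theorem isQYBE_slR (hq : q ≠ 0) : IsQYBE (slR q) := by
  rw [isQYBE_iff]
  intro i p m j l n
  fin_cases i <;> fin_cases p <;> fin_cases m <;> fin_cases j <;> fin_cases l <;> fin_cases n <;>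
    simp [slR] <;> field_simp <;> ring

/-- The `R`-matrices of the pairs of generating matrices of the `q`-Lorentz spin group, up to
normalization. -/
def spinK (q : ℂ) : Bool → Bool → Matrix (Fin 2 × Fin 2) (Fin 2 × Fin 2) ℂ
  | false, true => invFlip (slR q)
  | false, false => slR q
  | true, false => slR q
  | true, true => slR q

/-- The normalization factors, in terms of a square root `c` of `q⁻¹`. -/
def spinScale (c : ℂ) : Bool → Bool → ℂ
  | false, true => c⁻¹
  | false, false => c
  | true, false => c
  | true, true => c

theorem spinK_qybe (hq : q ≠ 0) (x y z : Bool) (i p m j l n : Fin 2) :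
    ∑ a, ∑ b, ∑ c, spinK q x y (i, p) (a, b) * spinK q x z (a, m) (j, c) *
        spinK q y z (b, c) (l, n) =
      ∑ a, ∑ b, ∑ c, spinK q y z (p, m) (b, c) * spinK q x z (i, c) (a, n) *
        spinK q x y (a, b) (j, l) := by
  have key : leg (0 : Fin 3) 1 (spinK q x y) * leg 0 2 (spinK q x z) * leg 1 2 (spinK q y z) =
      leg 1 2 (spinK q y z) * leg 0 2 (spinK q x z) * leg 0 1 (spinK q x y) := by
    have h := isQYBE_slR hq
    have hu := isUnit_slR hq
    cases x <;> cases y <;> cases z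
    · exact h
    · exact h.mixed_right_right hu
    · exact h.mixed_left hu
    · exact h.mixed_left_left hu
    · exact h
    · exact h.mixed_right hu
    · exact h
    · exact h
  have := congrFun (congrFun key ![i, p, m]) ![j, l, n]
  rw [leg_qybe_left_apply, leg_qybe_right_apply] at this
  exact this

theorem spinK_false_true (hq : q ≠ 0) : spinK q false true = flipLegs (slR q⁻¹) := by
  rw [spinK, invFlip, slR_inv hq]

theorem spinK_det (hq : q ≠ 0) {c : ℂ} (hc : c ^ 2 = q⁻¹) (x z : Bool) (i k m n : Fin 2) :
    spinScale c x z ^ 2 * ∑ a, (spinK q x z (i, m) (0, a) * spinK q x z (k, a) (1, n) -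
        q⁻¹ * (spinK q x z (i, m) (1, a) * spinK q x z (k, a) (0, n))) =
      qEps ℂ q (i, k) * (1 : Matrix (Fin 2) (Fin 2) ℂ) m n := by
  cases x <;> cases z <;> (try rw [spinK_false_true hq]) <;>
    simp only [spinScale, inv_pow, hc, inv_inv, spinK] <;>
    fin_cases i <;> fin_cases k <;> fin_cases m <;> fin_cases n <;>
    simp [slR, flipLegs, qEps, hq] <;> field_simp <;> simp

theorem spinK_det' (hq : q ≠ 0) {c : ℂ} (hc : c ^ 2 = q⁻¹) (x z : Bool) (i k m n : Fin 2) :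
    spinScale c x z ^ 2 * ∑ a, (spinK q x z (m, k) (a, 1) * spinK q x z (a, i) (n, 0) -
        q⁻¹ * (spinK q x z (m, k) (a, 0) * spinK q x z (a, i) (n, 1))) =
      qEps ℂ q (i, k) * (1 : Matrix (Fin 2) (Fin 2) ℂ) m n := by
  cases x <;> cases z <;> (try rw [spinK_false_true hq]) <;>
    simp only [spinScale, inv_pow, hc, inv_inv, spinK] <;>
    fin_cases i <;> fin_cases k <;> fin_cases m <;> fin_cases n <;>
    simp [slR, flipLegs, qEps, hq] <;> field_simp <;> simp

end SpinRMatrix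

section SpinRepresentation

variable {q c : ℂ}

/-- The matrices by which the generators of the `q`-Lorentz spin group act in the fundamental
representation labelled by `z`. -/
def spinRepMatrix (q c : ℂ) (z x : Bool) :
    Matrix (Fin 2) (Fin 2) (Matrix (Fin 2) (Fin 2) ℂ) := fun i j => Matrix.of fun m n =>
  spinScale c x z * spinK q x z (i, m) (j, n)

theorem spinRepMatrix_apply (z x : Bool) (i j m n : Fin 2) :
    spinRepMatrix q c z x i j m n = spinScale c x z * spinK q x z (i, m) (j, n) := rfl

theorem exchange_spinRepMatrix (hq : q ≠ 0) (x y z : Bool) :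
    Exchange (spinK q x y) (spinRepMatrix q c z x) (spinRepMatrix q c z y) := by
  intro i k j l
  ext m n
  have h := congrArg (fun w => spinScale c x z * spinScale c y z * w)
    (spinK_qybe hq x y z i k m j l n)
  simp only [Matrix.sum_apply, Matrix.smul_apply, Matrix.mul_apply, spinRepMatrix_apply,
    smul_eq_mul, Finset.mul_sum] at h ⊢
  refine Eq.trans ?_ (h.trans ?_)
  · exact Finset.sum_congr rfl fun _ _ => Finset.sum_congr rfl fun _ _ =>
      Finset.sum_congr rfl fun _ _ => by ring
  · exact Finset.sum_congr rfl fun _ _ => Finset.sum_congr rfl fun _ _ =>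
      Finset.sum_congr rfl fun _ _ => by ring

theorem isSpinFamily_spinRepMatrix (hq : q ≠ 0) (hc : c ^ 2 = q⁻¹) (z : Bool) :
    IsSpinFamily q (spinRepMatrix q c z) where
  tt := exchange_spinRepMatrix hq false false z
  ss := exchange_spinRepMatrix hq true true z
  st := exchange_spinRepMatrix hq true false z
  det x := by
    ext ⟨i, k⟩ m n
    rw [matMul_mulVec_qEps]
    have h := spinK_det hq hc x z i k m n
    simp only [Matrix.sub_apply, Matrix.smul_apply, Matrix.mul_apply, spinRepMatrix_apply,
      smul_eq_mul]
    have h2 : qEps (Matrix (Fin 2) (Fin 2) ℂ) q (i, k) m n =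
        qEps ℂ q (i, k) * (1 : Matrix (Fin 2) (Fin 2) ℂ) m n := by
      simp only [qEps, Matrix.algebraMap_matrix_apply, Matrix.one_apply]
      split_ifs <;> simp
    rw [h2, ← h, Finset.mul_sum, Finset.mul_sum, ← Finset.sum_sub_distrib]
    exact Finset.sum_congr rfl fun _ _ => by ring

/-- The fundamental representations of the `q`-Lorentz spin group. -/
def spinRep (hq : q ≠ 0) (hc : c ^ 2 = q⁻¹) (z : Bool) :
    SpinLorentz q →ₐ[ℂ] Matrix (Fin 2) (Fin 2) ℂ :=
  spinLift (isSpinFamily_spinRepMatrix hq hc z)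

theorem spinRep_spinU (hq : q ≠ 0) (hc : c ^ 2 = q⁻¹) (z x : Bool) (i j m n : Fin 2) :
    spinRep hq hc z (spinU q x i j) m n = spinScale c x z * spinK q x z (i, m) (j, n) := by
  rw [spinRep, spinLift_spinU, spinRepMatrix_apply]

end SpinRepresentation

section TensorRepresentation

variable {S : Type*} [Ring S] [Algebra ℂ S] {κ : Type*} [Fintype κ] [DecidableEq κ]

open scoped Kronecker

/-- The homomorphism `M ↦ M ⊗ 1`. -/
def kronLeft (κ : Type*) [Fintype κ] [DecidableEq κ] :
    Matrix κ κ ℂ →ₐ[ℂ] Matrix (κ × κ) (κ × κ) ℂ :=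
  AlgHom.ofLinearMap ⟨⟨fun M => M ⊗ₖ (1 : Matrix κ κ ℂ), fun M N => Matrix.add_kronecker M N 1⟩,
    fun a M => Matrix.smul_kronecker a M 1⟩
    Matrix.one_kronecker_one
    fun M N => by
      have := Matrix.mul_kronecker_mul M N (1 : Matrix κ κ ℂ) (1 : Matrix κ κ ℂ)
      rwa [mul_one] at this

/-- The homomorphism `M ↦ 1 ⊗ M`. -/
def kronRight (κ : Type*) [Fintype κ] [DecidableEq κ] :
    Matrix κ κ ℂ →ₐ[ℂ] Matrix (κ × κ) (κ × κ) ℂ :=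
  AlgHom.ofLinearMap ⟨⟨fun M => (1 : Matrix κ κ ℂ) ⊗ₖ M, fun M N => Matrix.kronecker_add 1 M N⟩,
    fun a M => Matrix.kronecker_smul a 1 M⟩
    Matrix.one_kronecker_one
    fun M N => by
      have := Matrix.mul_kronecker_mul (1 : Matrix κ κ ℂ) (1 : Matrix κ κ ℂ) M N
      rwa [mul_one] at this

theorem kronLeft_mul_kronRight (M N : Matrix κ κ ℂ) :
    kronLeft κ M * kronRight κ N = M ⊗ₖ N := by
  change (M ⊗ₖ (1 : Matrix κ κ ℂ)) * ((1 : Matrix κ κ ℂ) ⊗ₖ N) = _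
  rw [← Matrix.mul_kronecker_mul, mul_one, one_mul]

theorem kronRight_mul_kronLeft (M N : Matrix κ κ ℂ) :
    kronRight κ N * kronLeft κ M = M ⊗ₖ N := by
  change ((1 : Matrix κ κ ℂ) ⊗ₖ N) * (M ⊗ₖ (1 : Matrix κ κ ℂ)) = _
  rw [← Matrix.mul_kronecker_mul, mul_one, one_mul]

/-- The tensor product of representations. -/
def tensorRep (ρ τ : S →ₐ[ℂ] Matrix κ κ ℂ) : S ⊗[ℂ] S →ₐ[ℂ] Matrix (κ × κ) (κ × κ) ℂ :=
  Algebra.TensorProduct.lift ((kronLeft κ).comp ρ) ((kronRight κ).comp τ) fun a b => by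
    change kronLeft κ (ρ a) * kronRight κ (τ b) = kronRight κ (τ b) * kronLeft κ (ρ a)
    rw [kronLeft_mul_kronRight, kronRight_mul_kronLeft]

/-- The tensor product of representations, in the opposite order. -/
def tensorRepRev (ρ τ : S →ₐ[ℂ] Matrix κ κ ℂ) : S ⊗[ℂ] S →ₐ[ℂ] Matrix (κ × κ) (κ × κ) ℂ :=
  Algebra.TensorProduct.lift ((kronRight κ).comp τ) ((kronLeft κ).comp ρ) fun a b => by
    change kronRight κ (τ a) * kronLeft κ (ρ b) = kronLeft κ (ρ b) * kronRight κ (τ a)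
    rw [kronLeft_mul_kronRight, kronRight_mul_kronLeft]

theorem tensorRep_tmul_apply (ρ τ : S →ₐ[ℂ] Matrix κ κ ℂ) (a b : S) (i k j l : κ) :
    tensorRep ρ τ (a ⊗ₜ b) (i, k) (j, l) = ρ a i j * τ b k l := by
  rw [tensorRep, Algebra.TensorProduct.lift_tmul, AlgHom.comp_apply, AlgHom.comp_apply,
    kronLeft_mul_kronRight, Matrix.kronecker_apply]

theorem tensorRepRev_tmul_apply (ρ τ : S →ₐ[ℂ] Matrix κ κ ℂ) (a b : S) (i k j l : κ) :
    tensorRepRev ρ τ (a ⊗ₜ b) (i, k) (j, l) = τ a k l * ρ b i j := by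
  rw [tensorRepRev, Algebra.TensorProduct.lift_tmul, AlgHom.comp_apply, AlgHom.comp_apply,
    kronRight_mul_kronLeft, Matrix.kronecker_apply, mul_comm]

/-- The coefficient functional `a ↦ ρ(a)_{ij}`. -/
def repCoeff (ρ : S →ₐ[ℂ] Matrix κ κ ℂ) (i j : κ) : S →ₗ[ℂ] ℂ :=
  Matrix.entryLinearMap ℂ ℂ i j ∘ₗ ρ.toLinearMap

@[simp] theorem repCoeff_apply (ρ : S →ₐ[ℂ] Matrix κ κ ℂ) (i j : κ) (a : S) :
    repCoeff ρ i j a = ρ a i j := rfl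

theorem tensorRep_apply (ρ τ : S →ₐ[ℂ] Matrix κ κ ℂ) (w : S ⊗[ℂ] S) (i k j l : κ) :
    tensorRep ρ τ w (i, k) (j, l) =
      LinearMap.mul' ℂ ℂ (TensorProduct.map (repCoeff ρ i j) (repCoeff τ k l) w) := by
  induction w with
  | zero => simp
  | add x y hx hy => simp only [map_add, Matrix.add_apply, hx, hy]
  | tmul a b => simp [tensorRep_tmul_apply]

theorem tensorRepRev_apply (ρ τ : S →ₐ[ℂ] Matrix κ κ ℂ) (w : S ⊗[ℂ] S) (i k j l : κ) :
    tensorRepRev ρ τ w (i, k) (j, l) =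
      LinearMap.mul' ℂ ℂ (TensorProduct.map (repCoeff τ k l) (repCoeff ρ i j) w) := by
  induction w with
  | zero => simp
  | add x y hx hy => simp only [map_add, Matrix.add_apply, hx, hy]
  | tmul a b => simp [tensorRepRev_tmul_apply]

end TensorRepresentation

section SpinForm

variable {q c : ℂ} [NeZero q] (hc : c ^ 2 = q⁻¹)

/-- The fundamental `R`-matrices intertwine the two tensor products of the representations. -/
theorem spinK_intertwines (y z : Bool) (x : SpinLorentz q) :
    spinK q y z * tensorRepRev (spinRep (NeZero.ne q) hc y) (spinRep (NeZero.ne q) hc z)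
        (comul (R := ℂ) x) =
      tensorRep (spinRep (NeZero.ne q) hc y) (spinRep (NeZero.ne q) hc z)
        (comul (R := ℂ) x) * spinK q y z := by
  have hx : x ∈ Algebra.adjoin ℂ
      (Set.range fun p : Bool × Fin 2 × Fin 2 => spinU q p.1 p.2.1 p.2.2) := by
    rw [adjoin_spinU]; exact Algebra.mem_top
  induction hx using Algebra.adjoin_induction with
  | mem x hx =>
    obtain ⟨⟨w, m, n⟩, rfl⟩ := hx
    ext ⟨i, k⟩ ⟨j, l⟩
    have h := congrArg (fun s => spinScale c w y * spinScale c w z * s)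
      (spinK_qybe (NeZero.ne q) w y z m i k n j l)
    simp only [(isComatrix_spinU (q := q) w).comul_eq, map_sum, Matrix.mul_apply, Matrix.sum_apply,
      Fintype.sum_prod_type, tensorRep_tmul_apply, tensorRepRev_tmul_apply, spinRep_spinU,
      Finset.mul_sum, Finset.sum_mul] at h ⊢
    refine (sum_rotate₃ _).trans (Eq.trans ?_ (h.symm.trans (Eq.trans ?_ (sum_rotate₃ _).symm)))
    · exact Finset.sum_congr rfl fun _ _ => Finset.sum_congr rfl fun _ _ =>
        Finset.sum_congr rfl fun _ _ => by ring
    · exact Finset.sum_congr rfl fun _ _ => Finset.sum_congr rfl fun _ _ =>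
        Finset.sum_congr rfl fun _ _ => by ring
  | algebraMap a =>
    rw [Bialgebra.comul_algebraMap, AlgHom.commutes, AlgHom.commutes, Algebra.commutes]
  | add x y _ _ hx hy => simp only [map_add, mul_add, add_mul, hx, hy]
  | mul x y _ _ hx hy =>
    rw [Bialgebra.comul_mul, map_mul, map_mul, ← mul_assoc, hx, mul_assoc, hy, mul_assoc]

theorem tensorRepRev_mulVec_qEps (z : Bool) (x : SpinLorentz q) :
    (tensorRepRev (spinRep (NeZero.ne q) hc z) (spinRep (NeZero.ne q) hc z)
        (comul (R := ℂ) x)).mulVec (qEps ℂ q) = counit (R := ℂ) x • qEps ℂ q := by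
  have hx : x ∈ Algebra.adjoin ℂ
      (Set.range fun p : Bool × Fin 2 × Fin 2 => spinU q p.1 p.2.1 p.2.2) := by
    rw [adjoin_spinU]; exact Algebra.mem_top
  induction hx using Algebra.adjoin_induction with
  | mem x hx =>
    obtain ⟨⟨w, m, n⟩, rfl⟩ := hx
    ext ⟨i, k⟩
    have h := spinK_det' (NeZero.ne q) hc w z i k m n
    have h2 : ∀ M : Matrix (Fin 2 × Fin 2) (Fin 2 × Fin 2) ℂ, M.mulVec (qEps ℂ q) (i, k) =
        M (i, k) (0, 1) - q⁻¹ * M (i, k) (1, 0) := fun M => by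
      simp [Matrix.mulVec, dotProduct, Fintype.sum_prod_type, qEps]
      ring
    rw [h2, Pi.smul_apply, (isComatrix_spinU (q := q) w).counit_eq, smul_eq_mul,
      mul_comm _ (qEps ℂ q _), ← h]
    simp only [(isComatrix_spinU (q := q) w).comul_eq, map_sum, Matrix.sum_apply,
      tensorRepRev_tmul_apply, spinRep_spinU, Finset.mul_sum, ← Finset.sum_sub_distrib]
    exact Finset.sum_congr rfl fun _ _ => by ring
  | algebraMap a =>
    rw [Bialgebra.comul_algebraMap, AlgHom.commutes, Bialgebra.counit_algebraMap,
      Algebra.algebraMap_eq_smul_one, Matrix.smul_mulVec, Matrix.one_mulVec]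
  | add x y _ _ hx hy => rw [map_add, map_add, Matrix.add_mulVec, hx, hy, map_add, add_smul]
  | mul x y _ _ hx hy =>
    rw [Bialgebra.comul_mul, map_mul, ← Matrix.mulVec_mulVec, hy, Matrix.mulVec_smul, hx,
      Bialgebra.counit_mul, smul_smul, mul_comm]

/-- The coefficient functionals of the fundamental representations, in the opposite of the
convolution algebra. -/
def spinFunctional (z : Bool) :
    Matrix (Fin 2) (Fin 2) (WithConv (SpinLorentz q →ₗ[ℂ] ℂ))ᵐᵒᵖ := fun i j =>
  MulOpposite.op (WithConv.toConv (repCoeff (spinRep (NeZero.ne q) hc z) i j))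

theorem spinFunctional_mul_apply (y z : Bool) (i j k l : Fin 2) (x : SpinLorentz q) :
    (spinFunctional hc y i j * spinFunctional hc z k l).unop x =
      tensorRepRev (spinRep (NeZero.ne q) hc y) (spinRep (NeZero.ne q) hc z)
        (comul (R := ℂ) x) (i, k) (j, l) := by
  rw [tensorRepRev_apply]
  rfl

theorem spinFunctional_mul_apply' (y z : Bool) (i j k l : Fin 2) (x : SpinLorentz q) :
    (spinFunctional hc z k l * spinFunctional hc y i j).unop x =
      tensorRep (spinRep (NeZero.ne q) hc y) (spinRep (NeZero.ne q) hc z)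
        (comul (R := ℂ) x) (i, k) (j, l) := by
  rw [tensorRep_apply]
  rfl

theorem unop_sum_smul_apply {α β : Type*} [Fintype α] [Fintype β] (f : α → β → ℂ)
    (F : α → β → (WithConv (SpinLorentz q →ₗ[ℂ] ℂ))ᵐᵒᵖ) (x : SpinLorentz q) :
    (∑ a, ∑ b, f a b • F a b).unop x = ∑ a, ∑ b, f a b * (F a b).unop x := by
  have h : ∀ F : (WithConv (SpinLorentz q →ₗ[ℂ] ℂ))ᵐᵒᵖ, F.unop x =
      (LinearMap.applyₗ x ∘ₗ (WithConv.linearEquiv ℂ _).toLinearMap ∘ₗ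
        (MulOpposite.opLinearEquiv ℂ).symm.toLinearMap) F := fun F => rfl
  simp only [h, map_sum, map_smul, smul_eq_mul]

theorem exchange_spinFunctional (y z : Bool) :
    Exchange (spinK q y z) (spinFunctional (q := q) hc y) (spinFunctional hc z) := by
  intro i k j l
  apply MulOpposite.unop_injective
  ext x
  have h := congrFun (congrFun (spinK_intertwines hc y z x) (i, k)) (j, l)
  simp only [Matrix.mul_apply, Fintype.sum_prod_type] at h
  refine (unop_sum_smul_apply _ _ _).trans (Eq.trans ?_ (unop_sum_smul_apply _ _ _).symm)
  refine Eq.trans (Finset.sum_congr rfl fun a _ => Finset.sum_congr rfl fun b _ => ?_)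
    (h.trans (Finset.sum_congr rfl fun a _ => Finset.sum_congr rfl fun b _ => ?_))
  · rw [spinFunctional_mul_apply]
  · rw [spinFunctional_mul_apply', mul_comm]

theorem isSpinFamily_spinFunctional : IsSpinFamily q (spinFunctional (q := q) hc) where
  tt := exchange_spinFunctional hc false false
  ss := exchange_spinFunctional hc true true
  st := exchange_spinFunctional hc true false
  det z := by
    ext ⟨i, k⟩
    apply MulOpposite.unop_injective
    ext x
    have h := congrFun (tensorRepRev_mulVec_qEps hc z x) (i, k)
    have h2 : ∀ M : Matrix (Fin 2 × Fin 2) (Fin 2 × Fin 2) ℂ, M.mulVec (qEps ℂ q) (i, k) =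
        M (i, k) (0, 1) - q⁻¹ * M (i, k) (1, 0) := fun M => by
      simp [Matrix.mulVec, dotProduct, Fintype.sum_prod_type, qEps]
      ring
    rw [h2, ← spinFunctional_mul_apply, ← spinFunctional_mul_apply] at h
    rw [matMul_mulVec_qEps]
    refine h.trans ?_
    rw [Pi.smul_apply, smul_eq_mul, mul_comm]
    rfl

/-- The dual quasitriangular structure, as an algebra map to the opposite of the convolution
algebra. -/
def spinFormHom : SpinLorentz q →ₐ[ℂ] (WithConv (SpinLorentz q →ₗ[ℂ] ℂ))ᵐᵒᵖ :=
  spinLift (isSpinFamily_spinFunctional hc)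

/-- The dual quasitriangular structure of the `q`-Lorentz spin group. -/
def spinForm : LinearMap.BilinForm ℂ (SpinLorentz q) :=
  ((WithConv.linearEquiv ℂ _).toLinearMap ∘ₗ (MulOpposite.opLinearEquiv ℂ).symm.toLinearMap ∘ₗ
    (spinFormHom hc).toLinearMap).flip

theorem spinForm_apply (a b : SpinLorentz q) : spinForm hc a b = (spinFormHom hc b).unop a := rfl

theorem spinForm_one_right (a : SpinLorentz q) : spinForm hc a 1 = counit (R := ℂ) a := by
  rw [spinForm_apply, map_one]
  rfl

theorem spinForm_mul_right (a b b' : SpinLorentz q) : spinForm hc a (b * b') =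
    LinearMap.mul' ℂ ℂ (TensorProduct.map ((spinForm hc).flip b') ((spinForm hc).flip b)
      (comul (R := ℂ) a)) := by
  rw [spinForm_apply, map_mul]
  rfl

theorem spinForm_spinU_right (a : SpinLorentz q) (z : Bool) (i j : Fin 2) :
    spinForm hc a (spinU q z i j) = spinRep (NeZero.ne q) hc z a i j := by
  rw [spinForm_apply, spinFormHom, spinLift_spinU]
  rfl

theorem spinForm_spinU (x z : Bool) (i j k l : Fin 2) :
    spinForm hc (spinU q x i j) (spinU q z k l) = spinScale c x z * spinK q x z (i, k) (j, l) := by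
  rw [spinForm_spinU_right, spinRep_spinU]

end SpinForm

section ConvolutionInverse

variable {k : Type*} [Field k] {H : Type*} [Ring H] [HopfAlgebra k H] {r : LinearMap.BilinForm k H}

/-- A form that is multiplicative in its first argument is convolution-invertible. -/
theorem exists_convolution_inverse (h1 : ∀ a, r 1 a = counit (R := k) a)
    (hmul : ∀ {κ : Type} [Fintype κ] [DecidableEq κ] {c : Matrix κ κ H}, IsComatrix k c →
      ∀ a b i j, r (a * b) (c i j) = ∑ l, r a (c i l) * r b (c l j)) :
    ∃ s : LinearMap.BilinForm k H, ∀ a b : H,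
      LinearMap.mul' k k (TensorProduct.map (TensorProduct.lift r) (TensorProduct.lift s)
          (comul (R := k) (a ⊗ₜ[k] b))) = counit (R := k) a * counit (R := k) b ∧
      LinearMap.mul' k k (TensorProduct.map (TensorProduct.lift s) (TensorProduct.lift r)
          (comul (R := k) (a ⊗ₜ[k] b))) = counit (R := k) a * counit (R := k) b := by
  refine ⟨r ∘ₗ antipode k, fun a b => ?_⟩
  induction a using (@comatrix_induction k _ H _ _ _) with
  | add x y hx hy => simp only [TensorProduct.add_tmul, map_add, hx, hy, add_mul, and_self]
  | smul x y hy =>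
    simp only [← TensorProduct.smul_tmul', map_smul, hy, smul_mul_assoc, and_self]
  | zero => simp
  | base n c hc i j =>
    induction b using (@comatrix_induction k _ H _ _ _) with
    | add x y hx hy => simp only [TensorProduct.tmul_add, map_add, hx, hy, mul_add, and_self]
    | smul x y hy => simp only [TensorProduct.tmul_smul, map_smul, hy, mul_smul_comm, and_self]
    | zero => simp
    | base n' d hd p l =>
      rw [comul_comatrix_tmul hc hd, hc.counit_eq]
      simp only [map_sum, TensorProduct.map_tmul, TensorProduct.lift.tmul, LinearMap.mul'_apply,
        LinearMap.comp_apply, ← hmul hd]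
      constructor
      · rw [← LinearMap.sum_apply, ← map_sum, hc.sum_mul_antipode, Matrix.one_apply,
          Matrix.one_apply]
        split_ifs <;> simp [h1]
      · rw [← LinearMap.sum_apply, ← map_sum, hc.sum_antipode_mul, Matrix.one_apply,
          Matrix.one_apply]
        split_ifs <;> simp [h1]

end ConvolutionInverse

section QuasicommutingMatrices

theorem sum_swap_pairs {M : Type*} [AddCommMonoid M] {α β γ δ : Type*} [Fintype α] [Fintype β]
    [Fintype γ] [Fintype δ] (f : α → β → γ → δ → M) :
    ∑ a, ∑ b, ∑ c, ∑ d, f a b c d = ∑ c, ∑ d, ∑ a, ∑ b, f a b c d :=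
  (sum_rotate₄ _).trans (sum_rotate₄ _)

variable {k : Type*} [Field k] {H : Type*} [Ring H] [Algebra k H]
  {κ κ' κ'' : Type*} [Fintype κ] [Fintype κ'] [Fintype κ'']

/-- The relation `b₁ a₁ r(a₂ ⊗ b₂) = r(a₁ ⊗ b₁) a₂ b₂` for the entries of two matrices. -/
def Quasicommute (r : LinearMap.BilinForm k H) (c : Matrix κ κ H) (d : Matrix κ' κ' H) : Prop :=
  ∀ i j p l, ∑ q, ∑ m, r (c q j) (d m l) • (d p m * c i q) =
    ∑ q, ∑ m, r (c i q) (d p m) • (c q j * d m l)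

variable {r : LinearMap.BilinForm k H} {c : Matrix κ κ H} {d : Matrix κ' κ' H}
  {e : Matrix κ'' κ'' H}

theorem Quasicommute.kronecker_left (hce : Quasicommute r c e) (hde : Quasicommute r d e)
    (he : ∀ a b i j, r (a * b) (e i j) = ∑ l, r a (e i l) * r b (e l j)) :
    Quasicommute r (fun x y : κ × κ' => c x.1 y.1 * d x.2 y.2) e := by
  rintro ⟨i, i'⟩ ⟨j, j'⟩ p l
  simp only [Fintype.sum_prod_type, he]
  calc _ = ∑ q', ∑ s, r (d q' j') (e s l) •
          ((∑ q, ∑ m, r (c q j) (e m s) • (e p m * c i q)) * d i' q') := by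
        simp only [Finset.sum_smul, Finset.smul_sum, Finset.sum_mul, smul_mul_assoc, smul_smul,
          mul_assoc]
        rw [Finset.sum_comm]
        refine Finset.sum_congr rfl fun q' _ => (sum_rotate₃ _).trans ?_
        exact Finset.sum_congr rfl fun _ _ => Finset.sum_congr rfl fun _ _ =>
          Finset.sum_congr rfl fun _ _ => by rw [mul_comm (r _ _)]
    _ = ∑ q, ∑ m, r (c i q) (e p m) •
          (c q j * ∑ q', ∑ s, r (d q' j') (e s l) • (e m s * d i' q')) := by
        simp only [hce _ _ _ _, Finset.smul_sum, Finset.sum_mul, Finset.mul_sum, smul_mul_assoc,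
          mul_smul_comm, smul_smul, mul_assoc]
        refine (sum_swap_pairs _).trans ?_
        exact Finset.sum_congr rfl fun _ _ => Finset.sum_congr rfl fun _ _ =>
          Finset.sum_congr rfl fun _ _ => Finset.sum_congr rfl fun _ _ => by
            rw [mul_comm (r _ _)]
    _ = _ := by
        simp only [hde _ _ _ _, Finset.sum_smul, Finset.smul_sum, Finset.mul_sum, mul_smul_comm,
          smul_smul, mul_assoc]
        refine Finset.sum_congr rfl fun q _ => ?_
        rw [Finset.sum_comm]
        exact Finset.sum_congr rfl fun _ _ => Finset.sum_comm

theorem Quasicommute.kronecker_right (hcd : Quasicommute r c d) (hce : Quasicommute r c e)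
    (hc : ∀ a b i j, r (c i j) (a * b) = ∑ l, r (c i l) b * r (c l j) a) :
    Quasicommute r c (fun x y : κ' × κ'' => d x.1 y.1 * e x.2 y.2) := by
  rintro i j ⟨p, p'⟩ ⟨l, l'⟩
  simp only [Fintype.sum_prod_type, hc]
  calc _ = ∑ s, ∑ m, r (c s j) (d m l) •
          (d p m * ∑ q, ∑ m', r (c q s) (e m' l') • (e p' m' * c i q)) := by
        simp only [Finset.sum_smul, Finset.smul_sum, Finset.mul_sum, mul_smul_comm, smul_smul,
          mul_assoc]
        refine (sum_rotate₄ _).trans (Finset.sum_congr rfl fun _ _ => Finset.sum_comm.trans ?_)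
        exact Finset.sum_congr rfl fun _ _ =>
          Finset.sum_congr rfl fun _ _ => Finset.sum_congr rfl fun _ _ => by rw [mul_comm (r _ _)]
    _ = ∑ q, ∑ m', r (c i q) (e p' m') •
          ((∑ s, ∑ m, r (c s j) (d m l) • (d p m * c q s)) * e m' l') := by
        simp only [hce _ _ _ _, Finset.smul_sum, Finset.sum_mul, Finset.mul_sum, smul_mul_assoc,
          mul_smul_comm, smul_smul, mul_assoc]
        refine (sum_swap_pairs _).trans ?_
        exact Finset.sum_congr rfl fun _ _ => Finset.sum_congr rfl fun _ _ =>
          Finset.sum_congr rfl fun _ _ => Finset.sum_congr rfl fun _ _ => by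
            rw [mul_comm (r _ _)]
    _ = _ := by
        simp only [hcd _ _ _ _, Finset.sum_smul, Finset.smul_sum, Finset.sum_mul, smul_mul_assoc,
          smul_smul, mul_assoc]
        refine (sum_swap_pairs _).trans ?_
        exact Finset.sum_congr rfl fun _ _ => Finset.sum_congr rfl fun _ _ => Finset.sum_comm

end QuasicommutingMatrices

section Inverse

variable {k : Type*} [Field k] {ι : Type*} [Fintype ι] [DecidableEq ι] {Q : Type*} [Ring Q]
  [Algebra k Q] {M : Matrix (ι × ι) (ι × ι) k} {u v : Matrix ι ι Q}

theorem braid_invFlip_mul (hM : IsUnit M) : braid Q (invFlip M) * braid Q M = 1 := by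
  have h := (Matrix.isUnit_iff_isUnit_det _).mp hM
  rw [braid_mul_braid]
  have : perm k ι * invFlip M = M⁻¹ * perm k ι := by
    rw [invFlip, ← perm_mul_mul_perm, mul_assoc, ← mul_assoc, perm_mul_perm, one_mul]
  rw [this, mul_assoc, ← mul_assoc (perm k ι) (perm k ι), perm_mul_perm, one_mul,
    Matrix.nonsing_inv_mul _ h]
  simp

theorem braid_mul_invFlip (hM : IsUnit M) : braid Q M * braid Q (invFlip M) = 1 := by
  have h := (Matrix.isUnit_iff_isUnit_det _).mp hM
  rw [braid_mul_braid]
  have : perm k ι * invFlip M = M⁻¹ * perm k ι := by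
    rw [invFlip, ← perm_mul_mul_perm, mul_assoc, ← mul_assoc, perm_mul_perm, one_mul]
  rw [this, mul_assoc, ← mul_assoc M, Matrix.mul_nonsing_inv _ h, one_mul, perm_mul_perm]
  simp

theorem Exchange.invFlip (h : Exchange M v u) (hM : IsUnit M) : Exchange (invFlip M) u v := by
  rw [exchange_iff] at h ⊢
  calc _ = braid Q (BraidedMomentum.invFlip M) * (matMul u v * braid Q M) *
        braid Q (BraidedMomentum.invFlip M) := by
        rw [mul_assoc, mul_assoc, braid_mul_invFlip hM, mul_one]
    _ = _ := by rw [← h, ← mul_assoc, braid_invFlip_mul hM, one_mul]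

end Inverse

section SpinDualQuasitriangular

variable {q c : ℂ} [NeZero q] (hc : c ^ 2 = q⁻¹)

theorem isComatrix_one_unit {k C : Type*} [Field k] [Ring C] [Bialgebra k C] :
    IsComatrix k (1 : Matrix Unit Unit C) where
  comul_eq i j := by simp [Algebra.TensorProduct.one_def]
  counit_eq i j := by simp

/-- Induction over the matrix coalgebras of products of generators. -/
theorem spin_induction {p : SpinLorentz q → Prop} (x : SpinLorentz q)
    (add : ∀ x y, p x → p y → p (x + y)) (smul : ∀ (a : ℂ) x, p x → p (a • x))
    (Pm : ∀ {κ : Type} [Fintype κ] [DecidableEq κ], Matrix κ κ (SpinLorentz q) → Prop)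
    (one : Pm (1 : Matrix Unit Unit (SpinLorentz q)))
    (mul : ∀ {κ : Type} [Fintype κ] [DecidableEq κ] (z : Bool) (c : Matrix κ κ (SpinLorentz q)),
      IsComatrix ℂ c → Pm c →
        Pm (fun x y : Fin 2 × κ => spinU q z x.1 y.1 * c x.2 y.2))
    (base : ∀ {κ : Type} [Fintype κ] [DecidableEq κ] (c : Matrix κ κ (SpinLorentz q)),
      IsComatrix ℂ c → Pm c → ∀ i j, p (c i j)) : p x := by
  have hx : x ∈ Algebra.adjoin ℂ
      (Set.range fun p : Bool × Fin 2 × Fin 2 => spinU q p.1 p.2.1 p.2.2) := by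
    rw [adjoin_spinU]; exact Algebra.mem_top
  rw [← Subalgebra.mem_toSubmodule, Algebra.adjoin_eq_span] at hx
  have key : ∀ y ∈ Submonoid.closure
      (Set.range fun p : Bool × Fin 2 × Fin 2 => spinU q p.1 p.2.1 p.2.2),
      ∃ (κ : Type) (_ : Fintype κ) (_ : DecidableEq κ) (c : Matrix κ κ (SpinLorentz q)) (i j : κ),
        IsComatrix ℂ c ∧ Pm c ∧ c i j = y := fun y hy => by
    induction hy using Submonoid.closure_induction_left with
    | one => exact ⟨Unit, _, _, 1, (), (), isComatrix_one_unit, one, rfl⟩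
    | mul_left x hx y _ ih =>
      obtain ⟨⟨z, i', j'⟩, rfl⟩ := hx
      obtain ⟨κ, _, _, c, i, j, hc, hP, rfl⟩ := ih
      exact ⟨Fin 2 × κ, _, _, _, (i', i), (j', j), (isComatrix_spinU z).kronecker hc,
        mul z c hc hP, rfl⟩
  induction hx using Submodule.span_induction with
  | mem y hy =>
    obtain ⟨κ, _, _, c, i, j, hc, hP, rfl⟩ := key y hy
    exact base c hc hP i j
  | zero =>
    have := smul 0 _ (base 1 isComatrix_one_unit one () ())
    rwa [zero_smul] at this
  | add x y _ _ hx hy => exact add x y hx hy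
  | smul a x _ hx => exact smul a x hx

theorem spinForm_mul_right_comatrix {κ : Type*} [Fintype κ] [DecidableEq κ]
    {d : Matrix κ κ (SpinLorentz q)} (hd : IsComatrix ℂ d) (a b : SpinLorentz q) (i j : κ) :
    spinForm hc (d i j) (a * b) = ∑ l, spinForm hc (d i l) b * spinForm hc (d l j) a := by
  rw [spinForm_mul_right, hd.comul_eq]
  simp

theorem spinForm_one_left (b : SpinLorentz q) : spinForm hc 1 b = counit (R := ℂ) b := by
  refine spin_induction (p := fun b => spinForm hc 1 b = counit (R := ℂ) b) b
    (fun x y hx hy => by rw [map_add, hx, hy, map_add])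
    (fun a x hx => by rw [map_smul, hx, map_smul])
    (fun {κ} _ _ d => ∀ i j : κ, spinForm hc 1 (d i j) = counit (R := ℂ) (d i j))
    (fun i j => by simp [spinForm_one_right]) (fun {κ _ _} z d hd h => ?_)
    (fun d _ h => h)
  rintro ⟨i, i'⟩ ⟨j, j'⟩
  rw [spinForm_mul_right, Bialgebra.comul_one, Algebra.TensorProduct.one_def,
    TensorProduct.map_tmul, LinearMap.mul'_apply]
  change spinForm hc 1 (d i' j') * spinForm hc 1 (spinU q z i j) =
    counit (R := ℂ) (spinU q z i j * d i' j')
  rw [h, spinForm_spinU_right, map_one, Bialgebra.counit_mul,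
    (isComatrix_spinU (q := q) z).counit_eq,
    mul_comm]

theorem spinForm_mul_left (a b x : SpinLorentz q) : spinForm hc (a * b) x =
    LinearMap.mul' ℂ ℂ (TensorProduct.map (spinForm hc a) (spinForm hc b)
      (comul (R := ℂ) x)) := by
  have hbase : ∀ {κ : Type} [Fintype κ] [DecidableEq κ] (d : Matrix κ κ (SpinLorentz q)),
      IsComatrix ℂ d → (∀ a b i j, spinForm hc (a * b) (d i j) =
        ∑ l, spinForm hc a (d i l) * spinForm hc b (d l j)) → ∀ i j, spinForm hc (a * b) (d i j) =
      LinearMap.mul' ℂ ℂ (TensorProduct.map (spinForm hc a) (spinForm hc b)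
        (comul (R := ℂ) (d i j))) := fun d hd h i j => by
    rw [h, hd.comul_eq]
    simp
  refine spin_induction (p := fun x => spinForm hc (a * b) x =
    LinearMap.mul' ℂ ℂ (TensorProduct.map (spinForm hc a) (spinForm hc b) (comul (R := ℂ) x))) x
    (fun x y hx hy => by simp only [map_add, hx, hy])
    (fun a x hx => by simp only [map_smul, hx])
    (fun {κ} _ _ d => ∀ a b, ∀ i j : κ, spinForm hc (a * b) (d i j) =
      ∑ l, spinForm hc a (d i l) * spinForm hc b (d l j))
    (fun a b i j => by simp [spinForm_one_right]) (fun {κ _ _} z d hd h => ?_) hbase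
  rintro a b ⟨i, p⟩ ⟨j, l⟩
  induction a using (@comatrix_induction ℂ _ (SpinLorentz q) _ _ _) with
  | add x y hx hy => simp only [add_mul, map_add, LinearMap.add_apply, hx, hy,
      Finset.sum_add_distrib]
  | smul x y hy => simp only [smul_mul_assoc, map_smul, LinearMap.smul_apply, hy, Finset.smul_sum]
  | zero => simp
  | base n A hA m n =>
    induction b using (@comatrix_induction ℂ _ (SpinLorentz q) _ _ _) with
    | add x y hx hy => simp only [mul_add, map_add, LinearMap.add_apply, hx, hy,
        Finset.sum_add_distrib]
    | smul x y hy => simp only [mul_smul_comm, map_smul, LinearMap.smul_apply, hy, Finset.smul_sum]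
    | zero => simp
    | base n' B hB m' n' =>
      have e := spinForm_mul_right_comatrix hc (hA.kronecker hB) (spinU q z i j) (d p l) (m, m')
        (n, n')
      dsimp only at e
      rw [e]
      simp only [Fintype.sum_prod_type, h, spinForm_spinU_right, map_mul, Matrix.mul_apply,
        spinForm_mul_right_comatrix hc hA, spinForm_mul_right_comatrix hc hB,
        Finset.sum_mul_sum]
      refine (sum_swap_pairs _).trans (Finset.sum_comm.trans ?_)
      exact Finset.sum_congr rfl fun _ _ => Finset.sum_congr rfl fun _ _ =>
        Finset.sum_congr rfl fun _ _ => Finset.sum_congr rfl fun _ _ => mul_mul_mul_comm _ _ _ _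

theorem exchange_spinK (x z : Bool) : Exchange (spinK q x z) (spinU q x) (spinU q z) := by
  cases x <;> cases z
  · exact exchange_spinU_self false
  · exact exchange_spinU_st.invFlip (isUnit_slR (NeZero.ne q))
  · exact exchange_spinU_st
  · exact exchange_spinU_self true

theorem IsComatrix.sum_counit_smul {k C : Type*} [Field k] [AddCommGroup C] [Module k C]
    [Coalgebra k C] {κ : Type*} [Fintype κ] [DecidableEq κ] {d : Matrix κ κ C}
    (hd : IsComatrix k d) (p l : κ) : ∑ m, counit (R := k) (d m l) • d p m = d p l ∧
      ∑ m, counit (R := k) (d p m) • d m l = d p l := by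
  simp [hd.counit_eq, Matrix.one_apply]

theorem quasicommute_spinU (x z : Bool) :
    Quasicommute (spinForm hc) (spinU q x) (spinU q z) := fun i j p l => by
  have := congrArg (fun w => spinScale c x z • w) (exchange_spinK (q := q) x z i p j l)
  simp only [Finset.smul_sum, smul_smul] at this
  simp only [spinForm_spinU]
  exact this.symm

theorem isDualQuasitriangular_spinForm : IsDualQuasitriangular (spinForm (q := q) hc) where
  one_left := spinForm_one_left hc
  one_right := spinForm_one_right hc
  mul_left := spinForm_mul_left hc
  mul_right := spinForm_mul_right hc
  quasicomm a b := by
    have hml : ∀ {κ : Type} [Fintype κ] [DecidableEq κ] {d : Matrix κ κ (SpinLorentz q)},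
      IsComatrix ℂ d → ∀ a b i j, spinForm hc (a * b) (d i j) =
        ∑ l, spinForm hc a (d i l) * spinForm hc b (d l j) := fun hd a b i j => by
      rw [spinForm_mul_left, hd.comul_eq]
      simp
    refine spin_induction (p := fun a => TensorProduct.rid ℂ _ (TensorProduct.map
        (LinearMap.mul' ℂ _ ∘ₗ (TensorProduct.comm ℂ _ _).toLinearMap)
        (TensorProduct.lift (spinForm hc)) (comul (R := ℂ) (a ⊗ₜ[ℂ] b))) =
      TensorProduct.lid ℂ _ (TensorProduct.map (TensorProduct.lift (spinForm hc))
        (LinearMap.mul' ℂ _) (comul (R := ℂ) (a ⊗ₜ[ℂ] b)))) a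
      (fun x y hx hy => by simp only [TensorProduct.add_tmul, map_add, hx, hy])
      (fun a x hx => by simp only [← TensorProduct.smul_tmul', map_smul, hx])
      (fun {κ} _ _ d => ∀ z, Quasicommute (spinForm hc) d (spinU q z)) ?_ ?_ ?_
    · intro z i j p l
      simp only [Matrix.one_apply, if_true, spinForm_one_left, mul_one, one_mul, Finset.univ_unique,
        Finset.sum_singleton, IsComatrix.sum_counit_smul (isComatrix_spinU (q := q) z)]
    · intro κ _ _ x d hd h z
      exact (quasicommute_spinU hc x z).kronecker_left (h z) (hml (isComatrix_spinU z))
    · intro κ _ _ d hd h i j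
      refine spin_induction (p := fun b => TensorProduct.rid ℂ _ (TensorProduct.map
          (LinearMap.mul' ℂ _ ∘ₗ (TensorProduct.comm ℂ _ _).toLinearMap)
          (TensorProduct.lift (spinForm hc)) (comul (R := ℂ) (d i j ⊗ₜ[ℂ] b))) =
        TensorProduct.lid ℂ _ (TensorProduct.map (TensorProduct.lift (spinForm hc))
          (LinearMap.mul' ℂ _) (comul (R := ℂ) (d i j ⊗ₜ[ℂ] b)))) b
        (fun x y hx hy => by simp only [TensorProduct.tmul_add, map_add, hx, hy])
        (fun a x hx => by simp only [TensorProduct.tmul_smul, map_smul, hx])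
        (fun {κ} _ _ e => Quasicommute (spinForm hc) d e) ?_ ?_ ?_
      · intro i j p l
        simp only [Matrix.one_apply, if_true, spinForm_one_right, mul_one, one_mul,
          Finset.univ_unique, Finset.sum_singleton, IsComatrix.sum_counit_smul hd]
      · intro κ _ _ z e he hde
        exact (h z).kronecker_right hde (spinForm_mul_right_comatrix hc hd)
      · intro κ _ _ e he hde p l
        rw [comul_comatrix_tmul hd he]
        simpa using hde i j p l
  invertible := exists_convolution_inverse (spinForm_one_left hc) fun hd a b i j => by
    rw [spinForm_mul_left, hd.comul_eq]
    simp

end SpinDualQuasitriangular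

section ComatrixSubalgebra

variable (k : Type*) [Field k] {H : Type*} [Ring H] [HopfAlgebra k H] {κ : Type*} [Fintype κ]
  [DecidableEq κ]

/-- The subalgebra generated by the entries of a matrix. -/
abbrev entryAlgebra (c : Matrix κ κ H) : Subalgebra k H :=
  Algebra.adjoin k (Set.range fun p : κ × κ => c p.1 p.2)

variable {k} {c : Matrix κ κ H}

/-- The entries of a matrix, as elements of the subalgebra that they generate. -/
def entryGen (k : Type*) [Field k] [HopfAlgebra k H] (c : Matrix κ κ H) :
    Matrix κ κ (entryAlgebra k c) := fun i j => ⟨c i j, Algebra.subset_adjoin ⟨(i, j), rfl⟩⟩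

theorem val_entryGen (i j : κ) : (entryAlgebra k c).val (entryGen k c i j) = c i j := rfl

theorem adjoin_entryGen :
    Algebra.adjoin k (Set.range fun p : κ × κ => entryGen k c p.1 p.2) = ⊤ := by
  rw [← Algebra.adjoin_adjoin_coe_preimage]
  congr 1
  ext ⟨x, hx⟩
  simp [entryGen]

theorem entry_algHom_ext {Q : Type*} [Ring Q] [Algebra k Q] {f g : entryAlgebra k c →ₐ[k] Q}
    (h : ∀ i j, f (entryGen k c i j) = g (entryGen k c i j)) : f = g := by
  refine AlgHom.ext_of_adjoin_eq_top adjoin_entryGen ?_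
  rintro _ ⟨⟨i, j⟩, rfl⟩
  exact h i j

theorem map_val_injective (A : Subalgebra k H) :
    Function.Injective (Algebra.TensorProduct.map A.val A.val) :=
  TensorProduct.map_injective_of_flat_flat A.val.toLinearMap A.val.toLinearMap
    Subtype.val_injective Subtype.val_injective

section

variable (hc : IsComatrix k c)
include hc

theorem IsComatrix.comul_mem_range (x : entryAlgebra k c) :
    Bialgebra.comulAlgHom k H x ∈
      (Algebra.TensorProduct.map (entryAlgebra k c).val (entryAlgebra k c).val).range := by
  have h : entryAlgebra k c ≤ (Algebra.TensorProduct.map (entryAlgebra k c).val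
      (entryAlgebra k c).val).range.comap (Bialgebra.comulAlgHom k H) := by
    rw [Algebra.adjoin_le_iff]
    rintro _ ⟨⟨i, j⟩, rfl⟩
    refine ⟨∑ l, entryGen k c i l ⊗ₜ entryGen k c l j, ?_⟩
    change Algebra.TensorProduct.map _ _ _ = comul (R := k) (c i j)
    simp only [map_sum, Algebra.TensorProduct.map_tmul, val_entryGen, hc.comul_eq]
  exact h x.2

/-- The restriction of the coproduct. -/
def IsComatrix.entryComul : entryAlgebra k c →ₐ[k] entryAlgebra k c ⊗[k] entryAlgebra k c :=
  (AlgEquiv.ofInjective _ (map_val_injective (entryAlgebra k c))).symm.toAlgHom.comp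
    (((Bialgebra.comulAlgHom k H).comp (entryAlgebra k c).val).codRestrict _ hc.comul_mem_range)

theorem IsComatrix.map_val_entryComul (x : entryAlgebra k c) :
    Algebra.TensorProduct.map (entryAlgebra k c).val (entryAlgebra k c).val (hc.entryComul x) =
      comul (R := k) (x : H) :=
  congrArg Subtype.val (AlgEquiv.apply_symm_apply
    (AlgEquiv.ofInjective _ (map_val_injective (entryAlgebra k c))) _)

theorem IsComatrix.entryComul_entryGen (i j : κ) :
    hc.entryComul (entryGen k c i j) = ∑ l, entryGen k c i l ⊗ₜ entryGen k c l j := by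
  apply map_val_injective
  rw [hc.map_val_entryComul]
  simp only [map_sum, Algebra.TensorProduct.map_tmul, val_entryGen]
  exact hc.comul_eq i j

theorem IsComatrix.counit_val_entryGen (i j : κ) :
    ((Bialgebra.counitAlgHom k H).comp (entryAlgebra k c).val) (entryGen k c i j) =
      (1 : Matrix κ κ k) i j := hc.counit_eq i j

/-- The subalgebra generated by a matrix coalgebra is a bialgebra. -/
abbrev IsComatrix.entryBialgebra : Bialgebra k (entryAlgebra k c) :=
  Bialgebra.ofAlgHom hc.entryComul ((Bialgebra.counitAlgHom k H).comp (entryAlgebra k c).val)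
    (entry_algHom_ext fun i j => by
      simp only [AlgHom.comp_apply, hc.entryComul_entryGen, map_sum,
        Algebra.TensorProduct.map_tmul, TensorProduct.sum_tmul, TensorProduct.tmul_sum,
        AlgHom.id_apply]
      exact Finset.sum_comm)
    (entry_algHom_ext fun i j => by
      rw [AlgHom.comp_apply, hc.entryComul_entryGen]
      simp only [map_sum, Algebra.TensorProduct.map_tmul, hc.counit_val_entryGen]
      simp [Matrix.one_apply, TensorProduct.ite_tmul])
    (entry_algHom_ext fun i j => by
      rw [AlgHom.comp_apply, hc.entryComul_entryGen]
      simp only [map_sum, Algebra.TensorProduct.map_tmul, hc.counit_val_entryGen]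
      simp [Matrix.one_apply, TensorProduct.tmul_ite])

variable (hS : ∀ a b : H, antipode k (a * b) = antipode k b * antipode k a)
  (hmem : ∀ i j, antipode k (c i j) ∈ entryAlgebra k c)
include hS hmem

omit hc in
theorem antipode_mem_entryAlgebra (x : entryAlgebra k c) :
    antipode k (x : H) ∈ entryAlgebra k c := by
  obtain ⟨x, hx⟩ := x
  induction hx using Algebra.adjoin_induction with
  | mem x hx =>
    obtain ⟨⟨i, j⟩, rfl⟩ := hx
    exact hmem i j
  | algebraMap a =>
    have : antipode k (algebraMap k H a) = algebraMap k H a := by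
      rw [Algebra.algebraMap_eq_smul_one, map_smul, HopfAlgebra.antipode_one]
    change antipode k (algebraMap k H a) ∈ _
    rw [this]
    exact Subalgebra.algebraMap_mem _ _
  | add x y _ _ hx hy =>
    change antipode k (x + y) ∈ _
    rw [map_add]
    exact add_mem hx hy
  | mul x y _ _ hx hy =>
    change antipode k (x * y) ∈ _
    rw [hS]
    exact mul_mem hy hx

omit hc in
/-- The restriction of the antipode. -/
def entryAntipode : entryAlgebra k c →ₐ[k] (entryAlgebra k c)ᵐᵒᵖ :=
  AlgHom.ofLinearMap ((MulOpposite.opLinearEquiv k).toLinearMap ∘ₗ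
      ((antipode k) ∘ₗ (entryAlgebra k c).val.toLinearMap).codRestrict
        (Subalgebra.toSubmodule (entryAlgebra k c)) (antipode_mem_entryAlgebra hS hmem))
    (MulOpposite.unop_injective (Subtype.ext HopfAlgebra.antipode_one))
    fun x y => MulOpposite.unop_injective (Subtype.ext (hS x y))

/-- The subalgebra generated by a matrix coalgebra whose antipode it contains is a Hopf algebra. -/
abbrev IsComatrix.entryHopfAlgebra : HopfAlgebra k (entryAlgebra k c) :=
  letI := hc.entryBialgebra
  hopfAlgebraOfAntihom (entryAntipode hS hmem) (by
    rw [eq_top_iff, ← adjoin_entryGen, Algebra.adjoin_le_iff]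
    rintro _ ⟨⟨i, j⟩, rfl⟩
    have h1 : comul (R := k) (entryGen k c i j) = ∑ l, entryGen k c i l ⊗ₜ entryGen k c l j :=
      hc.entryComul_entryGen i j
    have h2 : counit (R := k) (entryGen k c i j) = (1 : Matrix κ κ k) i j := hc.counit_eq i j
    constructor
    · simp only [h1, h2, map_sum, LinearMap.rTensor_tmul, LinearMap.mul'_apply]
      apply Subtype.val_injective
      refine (map_sum (entryAlgebra k c).val _ _).trans ((hc.sum_antipode_mul i j).trans ?_)
      rw [Matrix.one_apply, Matrix.one_apply]
      split_ifs <;> simp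
    · simp only [h1, h2, map_sum, LinearMap.lTensor_tmul, LinearMap.mul'_apply]
      apply Subtype.val_injective
      refine (map_sum (entryAlgebra k c).val _ _).trans ((hc.sum_mul_antipode i j).trans ?_)
      rw [Matrix.one_apply, Matrix.one_apply]
      split_ifs <;> simp)

end

end ComatrixSubalgebra

section RestrictedForm

variable {k : Type*} [Field k] {A H : Type*} [Ring A] [HopfAlgebra k A] [Ring H] [HopfAlgebra k H]

theorem IsComatrix.map {κ : Type*} [Fintype κ] [DecidableEq κ] {c : Matrix κ κ A}
    (hc : IsComatrix k c) (f : A →ₐc[k] H) : IsComatrix k (c.map f) where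
  comul_eq i j := by
    rw [Matrix.map_apply, ← CoalgHomClass.map_comp_comul_apply, hc.comul_eq]
    simp
  counit_eq i j := by
    rw [Matrix.map_apply, CoalgHomClass.counit_comp_apply, hc.counit_eq]

/-- A dual quasitriangular structure restricts to a sub-Hopf algebra. -/
theorem IsDualQuasitriangular.restrict {r : LinearMap.BilinForm k H}
    (hr : IsDualQuasitriangular r) (f : A →ₐc[k] H) (hf : Function.Injective f) :
    IsDualQuasitriangular (r.compl₁₂ (f : A →ₗ[k] H) (f : A →ₗ[k] H)) where
  one_left a := by
    change r (f 1) (f a) = _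
    rw [map_one, hr.one_left, CoalgHomClass.counit_comp_apply]
  one_right a := by
    change r (f a) (f 1) = _
    rw [map_one, hr.one_right, CoalgHomClass.counit_comp_apply]
  mul_left a b x := by
    induction x using (@comatrix_induction k _ A _ _ _) with
    | add x y hx hy => simp only [map_add, hx, hy]
    | smul x y hy => simp only [map_smul, hy]
    | zero => simp
    | base n c hc i j =>
      change r (f (a * b)) (c.map f i j) = _
      rw [map_mul, hr.mul_left_comatrix (hc.map f), hc.comul_eq]
      simp
  mul_right x a b := by
    induction x using (@comatrix_induction k _ A _ _ _) with
    | add x y hx hy => simp only [map_add, LinearMap.add_apply, hx, hy]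
    | smul x y hy => simp only [map_smul, LinearMap.smul_apply, hy]
    | zero => simp
    | base n c hc i j =>
      change r (c.map f i j) (f (a * b)) = _
      rw [map_mul, hr.mul_right_comatrix (hc.map f), hc.comul_eq]
      simp
  quasicomm a b := by
    induction a using (@comatrix_induction k _ A _ _ _) with
    | add x y hx hy => simp only [TensorProduct.add_tmul, map_add, hx, hy]
    | smul x y hy => simp only [← TensorProduct.smul_tmul', map_smul, hy]
    | zero => simp
    | base n c hc i j =>
      induction b using (@comatrix_induction k _ A _ _ _) with
      | add x y hx hy => simp only [TensorProduct.tmul_add, map_add, hx, hy]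
      | smul x y hy => simp only [TensorProduct.tmul_smul, map_smul, hy]
      | zero => simp
      | base n' d hd p l =>
        rw [comul_comatrix_tmul hc hd]
        apply hf
        simpa using hr.quasicomm_comatrix (hc.map f) (hd.map f) i j p l
  invertible := exists_convolution_inverse
    (fun a => by
      change r (f 1) (f a) = _
      rw [map_one, hr.one_left, CoalgHomClass.counit_comp_apply])
    fun {κ _ _ c} hc a b i j => by
      change r (f (a * b)) (c.map f i j) = _
      rw [map_mul, hr.mul_left_comatrix (hc.map f)]
      rfl

end RestrictedForm

section LorentzGroup

variable {q : ℂ}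

theorem lorentzMatrix_eq : lorentzMatrix q =
    fun I J => spinU q false I.1 J.1 * spinU q true I.2 J.2 := by
  ext I J
  exact map_mul _ _ _

theorem spinU_mul_spinU_mem (i j p l : Fin 2) :
    spinU q false i j * spinU q true p l ∈ LorentzSO q :=
  Algebra.subset_adjoin ⟨((i, p), (j, l)), by rw [lorentzMatrix_eq]⟩

variable [NeZero q]

theorem spinU_true_mul_false_mem (i j p l : Fin 2) :
    spinU q true i j * spinU q false p l ∈ LorentzSO q := by
  have h := exchange_spinU_st (q := q)
  have key : spinU q true i j * spinU q false p l = ∑ x, ∑ y, (slR q)⁻¹ (i, p) (x, y) •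
      ∑ a, ∑ b, slR q (a, b) (j, l) • (spinU q false y b * spinU q true x a) := by
    simp only [← h _ _ _ _]
    have h1 : ∀ a b, ∑ x, ∑ y, (slR q)⁻¹ (i, p) (x, y) * slR q (x, y) (a, b) =
        (1 : Matrix (Fin 2 × Fin 2) (Fin 2 × Fin 2) ℂ) (i, p) (a, b) := fun a b => by
      rw [← Matrix.nonsing_inv_mul _ ((Matrix.isUnit_iff_isUnit_det _).mp
        (isUnit_slR (NeZero.ne q))), Matrix.mul_apply, Fintype.sum_prod_type]
    simp only [Finset.smul_sum, smul_smul]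
    rw [sum_swap_pairs]
    simp only [← Finset.sum_smul, h1, Matrix.one_apply, Prod.mk.injEq]
    fin_cases i <;> fin_cases p <;> simp
  rw [key]
  exact Subalgebra.sum_mem _ fun _ _ => Subalgebra.sum_mem _ fun _ _ => Subalgebra.smul_mem _
    (Subalgebra.sum_mem _ fun _ _ => Subalgebra.sum_mem _ fun _ _ => Subalgebra.smul_mem _
      (spinU_mul_spinU_mem _ _ _ _) _) _

theorem isComatrix_lorentzMatrix : IsComatrix ℂ (lorentzMatrix q) := by
  rw [lorentzMatrix_eq]
  exact (isComatrix_spinU false).kronecker (isComatrix_spinU true)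

theorem antipode_spin_mul (a b : SpinLorentz q) :
    antipode ℂ (a * b) = antipode ℂ b * antipode ℂ a :=
  congrArg MulOpposite.unop (map_mul (spinAntipode q) a b)

theorem antipode_spinU_mem_span (c : Bool) (i j : Fin 2) : antipode ℂ (spinU q c i j) ∈
    Submodule.span ℂ (Set.range fun p : Fin 2 × Fin 2 => spinU q c p.1 p.2) := by
  have h : ∀ i j, spinU q c i j ∈
      Submodule.span ℂ (Set.range fun p : Fin 2 × Fin 2 => spinU q c p.1 p.2) := fun i j =>
    Submodule.subset_span ⟨(i, j), rfl⟩
  rw [antipode_spinU]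
  fin_cases i <;> fin_cases j
  · exact h 1 1
  · exact Submodule.neg_mem _ (Submodule.smul_mem _ _ (h 0 1))
  · exact Submodule.neg_mem _ (Submodule.smul_mem _ _ (h 1 0))
  · exact h 0 0

theorem antipode_lorentzMatrix_mem (I J : Fin 2 × Fin 2) :
    antipode ℂ (lorentzMatrix q I J) ∈ LorentzSO q := by
  rw [lorentzMatrix_eq, antipode_spin_mul]
  have h : Submodule.span ℂ (Set.range fun p : Fin 2 × Fin 2 => spinU q true p.1 p.2) *
      Submodule.span ℂ (Set.range fun p : Fin 2 × Fin 2 => spinU q false p.1 p.2) ≤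
      Subalgebra.toSubmodule (LorentzSO q) := by
    rw [Submodule.span_mul_span, Submodule.span_le]
    rintro _ ⟨_, ⟨p, rfl⟩, _, ⟨p', rfl⟩, rfl⟩
    exact spinU_true_mul_false_mem _ _ _ _
  exact h (Submodule.mul_mem_mul (antipode_spinU_mem_span _ _ _) (antipode_spinU_mem_span _ _ _))

/-- The Hopf algebra `SO_q(1,3)`. -/
def LorentzGroup (q : ℂ) : Type := LorentzSO q

instance : Ring (LorentzGroup q) := inferInstanceAs (Ring (LorentzSO q))

instance : HopfAlgebra ℂ (LorentzGroup q) :=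
  (isComatrix_lorentzMatrix (q := q)).entryHopfAlgebra antipode_spin_mul antipode_lorentzMatrix_mem

/-- The vector matrix, as a matrix over `SO_q(1,3)`. -/
def lorentzGen (q : ℂ) [NeZero q] : Matrix (Fin 2 × Fin 2) (Fin 2 × Fin 2) (LorentzGroup q) :=
  entryGen ℂ (lorentzMatrix q)

theorem isComatrix_lorentzGen : IsComatrix ℂ (lorentzGen q) where
  comul_eq := (isComatrix_lorentzMatrix (q := q)).entryComul_entryGen
  counit_eq := (isComatrix_lorentzMatrix (q := q)).counit_val_entryGen

/-- The identification of the Hopf algebra `SO_q(1,3)` with the subalgebra generated by the vector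
matrix. -/
def lorentzEquiv (q : ℂ) [NeZero q] : LorentzGroup q ≃ₐ[ℂ] LorentzSO q :=
  (AlgEquiv.refl : LorentzSO q ≃ₐ[ℂ] LorentzSO q)

/-- The inclusion of `SO_q(1,3)` into the `q`-Lorentz spin group. -/
def lorentzVal (q : ℂ) [NeZero q] : LorentzGroup q →ₐc[ℂ] SpinLorentz q :=
  BialgHom.ofAlgHom ((LorentzSO q).val.comp (lorentzEquiv q).toAlgHom) rfl
    (AlgHom.ext (isComatrix_lorentzMatrix (q := q)).map_val_entryComul)

/-- The dual quasitriangular structure of `SO_q(1,3)`. -/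
def lorentzForm {c : ℂ} (hc : c ^ 2 = q⁻¹) : LinearMap.BilinForm ℂ (LorentzGroup q) :=
  (spinForm hc).compl₁₂ (lorentzVal q : LorentzGroup q →ₗ[ℂ] SpinLorentz q)
    (lorentzVal q : LorentzGroup q →ₗ[ℂ] SpinLorentz q)

theorem isDualQuasitriangular_lorentzForm {c : ℂ} (hc : c ^ 2 = q⁻¹) :
    IsDualQuasitriangular (lorentzForm (q := q) hc) :=
  (isDualQuasitriangular_spinForm hc).restrict (lorentzVal q) Subtype.val_injective

theorem lorentzR_apply (I J K L : Fin 2 × Fin 2) : lorentzR q (I, K) (J, L) =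
    ∑ m, ∑ a, ∑ n, ∑ b, (slR q)⁻¹ (K.2, I.1) (m, a) * (slR q (a, K.1) (J.1, n) *
      (slR q (I.2, m) (b, L.2) * slR q (b, n) (J.2, L.1))) := by
  obtain ⟨i, i'⟩ := I
  obtain ⟨j, j'⟩ := J
  obtain ⟨k, k'⟩ := K
  obtain ⟨l, l'⟩ := L
  rw [lorentzR, Matrix.submatrix_apply, mul_assoc, mul_assoc, leg_mul_apply (by decide)]
  refine Finset.sum_congr rfl fun m _ => Finset.sum_congr rfl fun a _ => ?_
  have h : ∀ (b y : Fin 2) (h : Fin 4 → Fin 2), leg (1 : Fin 4) 2 (slR q) (setLegs h 1 3 b y)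
      (spinorIndices ((j, j'), (l, l'))) =
      if h 0 = j ∧ y = l' then slR q (b, h 2) (j', l) else 0 := fun b y h => by
    simp [leg, setLegs, spinorIndices, Fin.forall_fin_succ, Function.update]
  have h2 : ∀ (h : Fin 4 → Fin 2), (leg (1 : Fin 4) 3 (slR q) * leg 1 2 (slR q) :
      Matrix (Fin 4 → Fin 2) (Fin 4 → Fin 2) ℂ) h (spinorIndices ((j, j'), (l, l'))) =
      if h 0 = j then ∑ b, slR q (h 1, h 3) (b, l') * slR q (b, h 2) (j', l) else 0 := fun h' => by
    rw [leg_mul_apply (by decide)]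
    simp only [h]
    by_cases h0 : h' 0 = j <;> simp [h0, -Fin.sum_univ_two]
  rw [leg_mul_apply (by decide)]
  simp only [h2]
  simp [setLegs, spinorIndices, Function.update, -Fin.sum_univ_two, Finset.mul_sum]

theorem lorentzForm_lorentzGen {c : ℂ} (hc : c ^ 2 = q⁻¹) (I J K L : Fin 2 × Fin 2) :
    lorentzForm hc (lorentzGen q I J) (lorentzGen q K L) = q⁻¹ * lorentzR q (I, K) (J, L) := by
  change spinForm hc (lorentzMatrix q I J) (lorentzMatrix q K L) = _
  have hr := isDualQuasitriangular_spinForm (q := q) hc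
  have h1 : lorentzMatrix q I J = spinU q false I.1 J.1 * spinU q true I.2 J.2 := by
    rw [lorentzMatrix_eq]
  have h2 : ∀ K L, lorentzMatrix q K L = spinU q false K.1 L.1 * spinU q true K.2 L.2 := by
    intro K L
    rw [lorentzMatrix_eq]
  rw [h1, hr.mul_left_comatrix isComatrix_lorentzMatrix, lorentzR_apply]
  simp only [h2, hr.mul_right_comatrix (isComatrix_spinU _), spinForm_spinU, Fintype.sum_prod_type,
    Finset.mul_sum, Finset.sum_mul]
  rw [Finset.sum_comm]
  refine Finset.sum_congr rfl fun m _ => (sum_rotate₃ _).trans ?_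
  refine Finset.sum_congr rfl fun a _ => Finset.sum_congr rfl fun n _ =>
    Finset.sum_congr rfl fun b _ => ?_
  have hc0 : c ≠ 0 := fun h => inv_ne_zero (NeZero.ne q) (by rw [← hc, h]; simp)
  simp only [spinScale, spinK, invFlip, flipLegs, Matrix.submatrix_apply, Prod.swap_prod_mk, ← hc]
  field_simp

theorem isMatrixQuantumGroup_lorentz {c : ℂ} (hc : c ^ 2 = q⁻¹) :
    IsMatrixQuantumGroup (lorentzR q) q⁻¹ (lorentzGen q) (lorentzForm hc) where
  comul_t := isComatrix_lorentzGen.comul_eq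
  counit_t := isComatrix_lorentzGen.counit_eq
  adjoin_t := adjoin_entryGen
  dualQuasitriangular := isDualQuasitriangular_lorentzForm hc
  form_t := lorentzForm_lorentzGen hc

end LorentzGroup

section MatrixQuantumGroup

variable {ι : Type} [Fintype ι] [DecidableEq ι] {A : Type*} [Ring A] [HopfAlgebra ℂ A]
  {R : Matrix (ι × ι) (ι × ι) ℂ} {lam : ℂ} {t : Matrix ι ι A} {r : LinearMap.BilinForm ℂ A}

theorem IsMatrixQuantumGroup.exchange_generators (h : IsMatrixQuantumGroup R lam t r)
    (hlam : lam ≠ 0) : Exchange R t t := fun i p j l => by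
  have ht : IsComatrix ℂ t := ⟨h.comul_t, h.counit_t⟩
  have := congrArg (fun x => lam⁻¹ • x)
    (h.dualQuasitriangular.quasicomm_comatrix ht ht i j p l)
  simp only [h.form_t, Finset.smul_sum, smul_smul, inv_mul_cancel_left₀ hlam] at this
  exact this.symm

theorem IsMatrixQuantumGroup.isQYBE (h : IsMatrixQuantumGroup R lam t r)
    (hlam : lam ≠ 0) : IsQYBE R := by
  have ht : IsComatrix ℂ t := ⟨h.comul_t, h.counit_t⟩
  rw [isQYBE_iff]
  intro i p m j l n
  have := congrArg (fun x => lam⁻¹ * (lam⁻¹ * r x (t m n))) (h.exchange_generators hlam i p j l)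
  simp only [map_sum, map_smul, LinearMap.sum_apply, LinearMap.smul_apply, smul_eq_mul,
    h.dualQuasitriangular.mul_left_comatrix ht, h.form_t, Finset.mul_sum] at this
  refine Eq.trans ?_ (this.trans ?_)
  · refine Finset.sum_congr rfl fun a _ => Finset.sum_congr rfl fun b _ =>
      Finset.sum_congr rfl fun c _ => ?_
    field_simp
  · refine Finset.sum_congr rfl fun a _ => Finset.sum_congr rfl fun b _ =>
      Finset.sum_congr rfl fun c _ => ?_
    field_simp

end MatrixQuantumGroup

section PolynomialPair

variable {k : Type*} [Field k] {ι : Type*} [Fintype ι] [DecidableEq ι]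
  {R R' : Matrix (ι × ι) (ι × ι) k}

theorem leg_mul_leg_perm_mul {σ : Type*} [Fintype σ] [DecidableEq σ] {a b : σ} (hab : a ≠ b) :
    leg a b R = leg a b (perm k ι) * leg a b (perm k ι * R) := by
  rw [leg_mul_leg hab, ← mul_assoc, perm_mul_perm, one_mul]

theorem leg_perm_mul_perm {σ : Type*} [Fintype σ] [DecidableEq σ] {a b : σ} (hab : a ≠ b) :
    leg a b (perm k ι) * leg a b (perm k ι) = 1 := by
  rw [leg_mul_leg hab, perm_mul_perm, leg_one]

theorem commute_leg_of_mem_adjoin (h : perm k ι * R' ∈ Algebra.adjoin k {perm k ι * R})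
    {σ : Type*} [Fintype σ] [DecidableEq σ] {a b : σ} (hab : a ≠ b)
    {Y : Matrix (σ → ι) (σ → ι) k} (hY : Commute Y (leg a b (perm k ι * R))) :
    Commute Y (leg a b (perm k ι * R')) := by
  have h1 : leg a b (perm k ι * R') ∈ Algebra.adjoin k {leg a b (perm k ι * R)} := by
    have := Subalgebra.mem_map.mpr ⟨_, h, (legHom_apply hab (perm k ι * R'))⟩
    rwa [AlgHom.map_adjoin, Set.image_singleton, legHom_apply] at this
  exact Algebra.commute_of_mem_adjoin_singleton_of_commute h1 hY

theorem IsQYBE.mixed_left_of_mem_adjoin (hR : IsQYBE R)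
    (h : perm k ι * R' ∈ Algebra.adjoin k {perm k ι * R}) :
    leg (0 : Fin 3) 1 R * leg 0 2 R * leg 1 2 R' = leg 1 2 R' * leg 0 2 R * leg 0 1 R := by
  have hp : leg (0 : Fin 3) 1 R * leg 0 2 R * leg 1 2 (perm k ι) =
      leg 1 2 (perm k ι) * (leg 0 2 R * leg 0 1 R) := by
    have h1 : leg (1 : Fin 3) 2 (perm k ι) * leg 0 2 R = leg 0 1 R * leg 1 2 (perm k ι) :=
      leg_perm_mul_leg (by decide) _ _ _
    have h2 : leg (1 : Fin 3) 2 (perm k ι) * leg 0 1 R = leg 0 2 R * leg 1 2 (perm k ι) :=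
      leg_perm_mul_leg (by decide) _ _ _
    rw [← mul_assoc, h1, mul_assoc (leg 0 1 R) (leg 1 2 (perm k ι)), h2, ← mul_assoc]
  have hc : Commute (leg (0 : Fin 3) 2 R * leg 0 1 R) (leg 1 2 (perm k ι * R)) := by
    have h1 : leg (0 : Fin 3) 1 R * leg 0 2 R * leg 1 2 R = leg 1 2 R * leg 0 2 R * leg 0 1 R := hR
    rw [leg_mul_leg_perm_mul (a := 1) (b := 2) (by decide), ← mul_assoc, hp] at h1
    have h2 := congrArg (fun X => leg (1 : Fin 3) 2 (perm k ι) * X) h1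
    simp only [← mul_assoc, leg_perm_mul_perm (k := k) (ι := ι) (a := (1 : Fin 3)) (b := 2)
      (by decide), one_mul] at h2
    rw [Commute, SemiconjBy, h2, mul_assoc]
  rw [leg_mul_leg_perm_mul (R := R') (a := 1) (b := 2) (by decide), ← mul_assoc, hp, mul_assoc,
    (commute_leg_of_mem_adjoin h (by decide) hc).eq]
  simp only [mul_assoc]

theorem IsQYBE.mixed_right_of_mem_adjoin (hR : IsQYBE R)
    (h : perm k ι * R' ∈ Algebra.adjoin k {perm k ι * R}) :
    leg (1 : Fin 3) 2 R * leg 0 2 R * leg 0 1 R' = leg 0 1 R' * leg 0 2 R * leg 1 2 R := by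
  have hp : leg (1 : Fin 3) 2 R * leg 0 2 R * leg 0 1 (perm k ι) =
      leg 0 1 (perm k ι) * (leg 0 2 R * leg 1 2 R) := by
    have h1 : leg (0 : Fin 3) 1 (perm k ι) * leg 0 2 R = leg 1 2 R * leg 0 1 (perm k ι) :=
      leg_perm_mul_leg (by decide) _ _ _
    have h2 : leg (0 : Fin 3) 1 (perm k ι) * leg 1 2 R = leg 0 2 R * leg 0 1 (perm k ι) :=
      leg_perm_mul_leg (by decide) _ _ _
    rw [← mul_assoc, h1, mul_assoc (leg 1 2 R) (leg 0 1 (perm k ι)), h2, ← mul_assoc]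
  have hc : Commute (leg (0 : Fin 3) 2 R * leg 1 2 R) (leg 0 1 (perm k ι * R)) := by
    have h1 : leg (1 : Fin 3) 2 R * leg 0 2 R * leg 0 1 R = leg 0 1 R * leg 0 2 R * leg 1 2 R :=
      hR.symm
    rw [leg_mul_leg_perm_mul (a := 0) (b := 1) (by decide), ← mul_assoc, hp] at h1
    have h2 := congrArg (fun X => leg (0 : Fin 3) 1 (perm k ι) * X) h1
    simp only [← mul_assoc, leg_perm_mul_perm (k := k) (ι := ι) (a := (0 : Fin 3)) (b := 1)
      (by decide), one_mul] at h2
    rw [Commute, SemiconjBy, h2, mul_assoc]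
  rw [leg_mul_leg_perm_mul (R := R') (a := 0) (b := 1) (by decide), ← mul_assoc, hp, mul_assoc,
    (commute_leg_of_mem_adjoin h (by decide) hc).eq]
  simp only [mul_assoc]

theorem flipLegs_mul_of_mem_adjoin (h : perm k ι * R' ∈ Algebra.adjoin k {perm k ι * R}) :
    flipLegs R * R' = flipLegs R' * R := by
  rw [← perm_mul_mul_perm, ← perm_mul_mul_perm, mul_assoc, mul_assoc (perm k ι * R')]
  exact (Algebra.commute_of_mem_adjoin_self h).eq

theorem Exchange.of_mem_adjoin {Q : Type*} [Ring Q] [Algebra k Q] {u : Matrix ι ι Q}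
    (hu : Exchange R u u) (h : perm k ι * R' ∈ Algebra.adjoin k {perm k ι * R}) :
    Exchange R' u u := by
  rw [exchange_iff] at hu ⊢
  have h1 : braid Q R' ∈ Algebra.adjoin k {braid Q R} := by
    have := Subalgebra.mem_map.mpr ⟨_, h, (rfl : (Algebra.ofId k Q).mapMatrix (perm k ι * R') = _)⟩
    rwa [AlgHom.map_adjoin, Set.image_singleton] at this
  exact (Algebra.commute_of_mem_adjoin_singleton_of_commute h1 hu.symm).symm

/-- A solution of the quantum Yang--Baxter equation and a matrix that is polynomial in it form a
pair as needed for the braided covectors. -/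
theorem isCovectorPair_of_mem_adjoin (hR : IsQYBE R) (h1 : IsUnit R) (h2 : IsUnit R')
    (h : perm k ι * R' ∈ Algebra.adjoin k {perm k ι * R})
    (hlin : (perm k ι * R + 1) * (perm k ι * R' - 1) = 0) : IsCovectorPair R R' where
  isUnit_R := h1
  isUnit_R' := h2
  qybe := hR
  mixed_left := hR.mixed_left_of_mem_adjoin h
  mixed_right := hR.mixed_right_of_mem_adjoin h
  linear := hlin
  flip := flipLegs_mul_of_mem_adjoin h

end PolynomialPair

section LorentzMatrix

variable {q : ℂ}

theorem slR_hecke (hq : q ≠ 0) : (perm ℂ (Fin 2) * slR q) * (perm ℂ (Fin 2) * slR q) =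
    1 + (q - q⁻¹) • (perm ℂ (Fin 2) * slR q) := by
  ext ⟨i, k⟩ ⟨j, l⟩
  simp only [Matrix.mul_apply (M := perm ℂ (Fin 2) * slR q), Matrix.add_apply, Matrix.smul_apply,
    perm_mul_apply, Fintype.sum_prod_type]
  fin_cases i <;> fin_cases k <;> fin_cases j <;> fin_cases l <;>
    simp [slR] <;> (try field_simp) <;> (try ring)

/-- The product of two commuting elements that satisfy the Hecke relation has a cubic minimal
polynomial. -/
theorem hecke_mul_cubic {B : Type*} [Ring B] [Algebra ℂ B] {q : ℂ} (hq : q ≠ 0) {X Y : B}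
    (hXY : X * Y = Y * X) (hX : X * X = 1 + (q - q⁻¹) • X) (hY : Y * Y = 1 + (q - q⁻¹) • Y) :
    (X * Y + 1) * ((X * Y - (q ^ 2)⁻¹ • 1) * (X * Y - q ^ 2 • 1)) = 0 := by
  have e1 : X * Y * X = Y + (q - q⁻¹) • (X * Y) := by
    rw [hXY, mul_assoc, hX, mul_add, mul_one, mul_smul_comm]
  have e2 : X * Y * Y = X + (q - q⁻¹) • (X * Y) := by
    rw [mul_assoc, hY, mul_add, mul_one, mul_smul_comm]
  have e3 : X * Y * (X * Y) = 1 + (q - q⁻¹) • (X + Y) + (q - q⁻¹) ^ 2 • (X * Y) := by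
    rw [← mul_assoc, e1, add_mul, hY, smul_mul_assoc, e2]
    module
  have e4 : (X * Y - (q ^ 2)⁻¹ • 1) * (X * Y - q ^ 2 • 1) =
      (2 : ℂ) • 1 + (q - q⁻¹) • (X + Y) - (2 : ℂ) • (X * Y) := by
    simp only [sub_mul, mul_sub, e3, smul_mul_assoc, mul_smul_comm, one_mul, mul_one]
    have : (q - q⁻¹) ^ 2 = q ^ 2 + (q ^ 2)⁻¹ - 2 := by field_simp; ring
    rw [this]
    match_scalars <;> field_simp <;> ring
  rw [e4]
  simp only [add_mul, mul_sub, mul_add, mul_smul_comm, mul_one, one_mul, e1, e2, e3]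
  module

/-- The four spinor indices of a pair of vector indices, as an equivalence. -/
def spinorEquiv : (Fin 2 × Fin 2) × (Fin 2 × Fin 2) ≃ (Fin 4 → Fin 2) where
  toFun := spinorIndices
  invFun f := ((f 0, f 1), (f 2, f 3))
  left_inv _ := rfl
  right_inv f := by
    ext i
    fin_cases i <;> rfl

/-- The algebra isomorphism between matrices with four spinor indices and matrices with two vector
indices. -/
def vectorLegs : Matrix (Fin 4 → Fin 2) (Fin 4 → Fin 2) ℂ ≃ₐ[ℂ]
    Matrix ((Fin 2 × Fin 2) × (Fin 2 × Fin 2)) ((Fin 2 × Fin 2) × (Fin 2 × Fin 2)) ℂ :=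
  Matrix.reindexAlgEquiv ℂ ℂ spinorEquiv.symm

theorem lorentzR_eq : lorentzR q = vectorLegs (leg (3 : Fin 4) 0 (slR q)⁻¹ * leg 0 2 (slR q) *
    leg 1 3 (slR q) * leg 1 2 (slR q)) := rfl

theorem perm_vector_eq : perm ℂ (Fin 2 × Fin 2) =
    vectorLegs (leg (0 : Fin 4) 2 (perm ℂ (Fin 2)) * leg 1 3 (perm ℂ (Fin 2))) := by
  ext ⟨⟨i, i'⟩, ⟨k, k'⟩⟩ ⟨⟨j, j'⟩, ⟨l, l'⟩⟩
  change _ = (leg (0 : Fin 4) 2 (perm ℂ (Fin 2)) * leg 1 3 (perm ℂ (Fin 2)) :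
    Matrix (Fin 4 → Fin 2) (Fin 4 → Fin 2) ℂ) ![i, i', k, k'] ![j, j', l, l']
  rw [leg_mul_leg_apply_of_disjoint (by decide) (by decide) (by decide) (by decide) (by decide)]
  simp [perm, Fin.forall_fin_succ]
  by_cases h1 : i = l <;> by_cases h2 : i' = l' <;> by_cases h3 : k = j <;>
    by_cases h4 : k' = j' <;> simp [h1, h2, h3, h4]

theorem isUnit_lorentzR (hq : q ≠ 0) : IsUnit (lorentzR q) := by
  have h := isUnit_slR hq
  have h' : IsUnit (slR q)⁻¹ := Matrix.isUnit_nonsing_inv_iff.mpr h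
  rw [lorentzR_eq]
  exact ((((isUnit_leg (by decide) h').mul (isUnit_leg (by decide) h)).mul
    (isUnit_leg (by decide) h)).mul (isUnit_leg (by decide) h)).map vectorLegs

theorem perm_mul_lorentzR : perm ℂ (Fin 2 × Fin 2) * lorentzR q =
    vectorLegs (leg (1 : Fin 4) 2 (slR q)⁻¹ * (leg 0 2 (perm ℂ (Fin 2) * slR q) *
      leg 1 3 (perm ℂ (Fin 2) * slR q)) * leg 1 2 (slR q)) := by
  rw [perm_vector_eq, lorentzR_eq, ← map_mul]
  congr 1
  have h1 : leg (1 : Fin 4) 3 (perm ℂ (Fin 2)) * leg 3 0 (slR q)⁻¹ =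
      leg 1 0 (slR q)⁻¹ * leg 1 3 (perm ℂ (Fin 2)) := leg_perm_mul_leg (by decide) _ _ _
  have h2 : leg (0 : Fin 4) 2 (perm ℂ (Fin 2)) * leg 1 0 (slR q)⁻¹ =
      leg 1 2 (slR q)⁻¹ * leg 0 2 (perm ℂ (Fin 2)) := leg_perm_mul_leg (by decide) _ _ _
  have h3 : leg (1 : Fin 4) 3 (perm ℂ (Fin 2)) * leg 0 2 (slR q) =
      leg 0 2 (slR q) * leg 1 3 (perm ℂ (Fin 2)) := leg_perm_mul_leg (by decide) _ _ _
  calc _ = leg (0 : Fin 4) 2 (perm ℂ (Fin 2)) * (leg 1 3 (perm ℂ (Fin 2)) *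
        leg 3 0 (slR q)⁻¹) * leg 0 2 (slR q) * leg 1 3 (slR q) * leg 1 2 (slR q) := by
        simp only [mul_assoc]
    _ = (leg (0 : Fin 4) 2 (perm ℂ (Fin 2)) * leg 1 0 (slR q)⁻¹) * (leg 1 3 (perm ℂ (Fin 2)) *
        leg 0 2 (slR q)) * leg 1 3 (slR q) * leg 1 2 (slR q) := by
        rw [h1]
        simp only [mul_assoc]
    _ = leg (1 : Fin 4) 2 (slR q)⁻¹ * ((leg 0 2 (perm ℂ (Fin 2)) * leg 0 2 (slR q)) *
        (leg 1 3 (perm ℂ (Fin 2)) * leg 1 3 (slR q))) * leg 1 2 (slR q) := by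
        rw [h2, h3]
        simp only [mul_assoc]
    _ = _ := by rw [leg_mul_leg (by decide), leg_mul_leg (by decide)]

theorem lorentzR_cubic (hq : q ≠ 0) : (perm ℂ (Fin 2 × Fin 2) * lorentzR q + 1) *
    ((perm ℂ (Fin 2 × Fin 2) * lorentzR q - (q ^ 2)⁻¹ • 1) *
      (perm ℂ (Fin 2 × Fin 2) * lorentzR q - q ^ 2 • 1)) = 0 := by
  have hH : ∀ {a b : Fin 4}, a ≠ b → leg a b (perm ℂ (Fin 2) * slR q) *
      leg a b (perm ℂ (Fin 2) * slR q) = 1 + (q - q⁻¹) • leg a b (perm ℂ (Fin 2) * slR q) :=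
    fun hab => by rw [leg_mul_leg hab, slR_hecke hq, leg_add, leg_one, leg_smul]
  have hu := isUnit_slR hq
  have e1 : leg (1 : Fin 4) 2 (slR q) * leg 1 2 (slR q)⁻¹ = 1 := leg_mul_leg_inv hu (by decide)
  have e2 : leg (1 : Fin 4) 2 (slR q)⁻¹ * leg 1 2 (slR q) = 1 := leg_inv_mul_leg hu (by decide)
  have key := hecke_mul_cubic hq (leg_commute_of_disjoint (a := (0 : Fin 4)) (b := 2) (c := 1)
    (d := 3) (by decide) (by decide) (by decide) (by decide) (by decide) (by decide) _ _)
    (hH (by decide)) (hH (by decide))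
  set Z := leg (0 : Fin 4) 2 (perm ℂ (Fin 2) * slR q) * leg 1 3 (perm ℂ (Fin 2) * slR q) with hZ
  have hconj : ∀ W W' : Matrix (Fin 4 → Fin 2) (Fin 4 → Fin 2) ℂ,
      (leg (1 : Fin 4) 2 (slR q)⁻¹ * W * leg 1 2 (slR q)) *
        (leg (1 : Fin 4) 2 (slR q)⁻¹ * W' * leg 1 2 (slR q)) =
      leg (1 : Fin 4) 2 (slR q)⁻¹ * (W * W') * leg 1 2 (slR q) := fun W W' => by
    calc _ = leg (1 : Fin 4) 2 (slR q)⁻¹ * W * (leg (1 : Fin 4) 2 (slR q) *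
        leg 1 2 (slR q)⁻¹) * W' * leg 1 2 (slR q) := by simp only [mul_assoc]
      _ = _ := by rw [e1, mul_one]; simp only [mul_assoc]
  have h1 : perm ℂ (Fin 2 × Fin 2) * lorentzR q + 1 = vectorLegs
      (leg (1 : Fin 4) 2 (slR q)⁻¹ * (Z + 1) * leg 1 2 (slR q)) := by
    rw [perm_mul_lorentzR, mul_add, add_mul, mul_one, e2, map_add, map_one]
  have h2 : ∀ a : ℂ, perm ℂ (Fin 2 × Fin 2) * lorentzR q - a • 1 = vectorLegs
      (leg (1 : Fin 4) 2 (slR q)⁻¹ * (Z - a • 1) * leg 1 2 (slR q)) := fun a => by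
    rw [perm_mul_lorentzR, mul_sub, sub_mul, mul_smul_comm, mul_one, smul_mul_assoc, e2,
      map_sub, map_smul, map_one]
  rw [h1, h2, h2, ← map_mul, ← map_mul, hconj, hconj, key, mul_zero, zero_mul, map_zero]

theorem perm_mul_minkowskiR' (q μ : ℂ) : perm ℂ (Fin 2 × Fin 2) * minkowskiR' q μ =
    1 + μ • ((perm ℂ (Fin 2 × Fin 2) * lorentzR q - (q ^ 2)⁻¹ • 1) *
      (perm ℂ (Fin 2 × Fin 2) * lorentzR q - q ^ 2 • 1)) := by
  rw [minkowskiR', mul_add, perm_mul_perm, mul_smul_comm, ← mul_assoc, perm_mul_perm, one_mul]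

theorem perm_mul_minkowskiR'_mem (q μ : ℂ) : perm ℂ (Fin 2 × Fin 2) * minkowskiR' q μ ∈
    Algebra.adjoin ℂ {perm ℂ (Fin 2 × Fin 2) * lorentzR q} := by
  have h := Algebra.self_mem_adjoin_singleton ℂ (perm ℂ (Fin 2 × Fin 2) * lorentzR q)
  rw [perm_mul_minkowskiR']
  exact add_mem (one_mem _) (Subalgebra.smul_mem _ (mul_mem
    (sub_mem h (Subalgebra.smul_mem _ (one_mem _) _))
    (sub_mem h (Subalgebra.smul_mem _ (one_mem _) _))) _)

theorem isCovectorPair_minkowski (hq : q ≠ 0) {μ : ℂ} (h : IsUnit (minkowskiR' q μ))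
    (hR : IsQYBE (lorentzR q)) : IsCovectorPair (lorentzR q) (minkowskiR' q μ) :=
  isCovectorPair_of_mem_adjoin hR (isUnit_lorentzR hq) h (perm_mul_minkowskiR'_mem q μ) (by
    rw [perm_mul_minkowskiR', add_sub_cancel_left, mul_smul_comm, lorentzR_cubic hq, smul_zero])

end LorentzMatrix

end

end BraidedMomentum

theorem theorem6 :
    -- the bosonization of the braided covectors
    (∀ (ι : Type) [Fintype ι] [DecidableEq ι] (R R' : Matrix (ι × ι) (ι × ι) ℂ)
      (A : Type u) [Ring A] [HopfAlgebra ℂ A] (t : Matrix ι ι A)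
      (r : LinearMap.BilinForm ℂ A) (lam : ℂ),
      IsCovectorPair R R' → lam ≠ 0 → IsMatrixQuantumGroup R lam t r → Exchange R' t t →
        HasCovectorBosonization R R' lam t r) ∧
    -- its application to braided Minkowski space: the `q`-Poincaré group
    (∀ q μ : ℂ, q ≠ 0 → μ ≠ 0 → IsUnit (minkowskiR' q μ) →
      IsCovectorPair (lorentzR q) (minkowskiR' q μ) ∧
      ∃ (A : Type) (_ : Ring A) (_ : HopfAlgebra ℂ A) (φ : A ≃ₐ[ℂ] LorentzSO q)
        (t : Matrix (Fin 2 × Fin 2) (Fin 2 × Fin 2) A) (r : LinearMap.BilinForm ℂ A),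
        (∀ I J, (φ (t I J) : SpinLorentz q) = lorentzMatrix q I J) ∧
        IsMatrixQuantumGroup (lorentzR q) q⁻¹ t r ∧
        HasCovectorBosonization (lorentzR q) (minkowskiR' q μ) q⁻¹ t r) := by
  refine ⟨fun ι _ _ R R' A _ _ t r lam hR hlam hA ht => hasCovectorBosonization hR hlam hA ht,
    fun q μ hq _ hR' => ?_⟩
  have : NeZero q := ⟨hq⟩
  obtain ⟨c, hc⟩ := IsAlgClosed.exists_pow_nat_eq q⁻¹ (n := 2) (by norm_num)
  have hA := isMatrixQuantumGroup_lorentz hc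
  have hlam := inv_ne_zero hq
  have hP := isCovectorPair_minkowski hq hR' (hA.isQYBE hlam)
  exact ⟨hP, LorentzGroup q, inferInstance, inferInstance, lorentzEquiv q, lorentzGen q,
    lorentzForm hc, fun _ _ => rfl, hA, hasCovectorBosonization hP hlam hA
      ((hA.exchange_generators hlam).of_mem_adjoin (perm_mul_minkowskiR'_mem q μ))⟩
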